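/- **Setting.** Let $X_1,X_2,\dots$ be i.i.d. with Lebesgue density $p$, where $p(x)=\exp(-(g(x)-q(x)))$ for $x\ge 0$ and $p(x)=0$ for $x<0$. The function $g$ is positive and convex on $[0,\infty)$, four times differentiable on $(0,\infty)$, with $g(x)/x\to\infty$ as $x\to\infty$; $q$ is measurable, and bounded on $[0,\infty)$. Put $h=g'$ and $\psi(t)=h^{\leftarrow}(t)=\inf\{x>0: h(x)\ge t\}$. $RV(\rho)$ denotes the functions that are regularly varying at infinity with index $\rho$. One of the following two cases holds. *Regularly varying case.* There are $\beta>0$, $\theta\le\beta-2$, $A>0$, $c>0$ and a function $\epsilon$, continuous on $[A,\infty)$ and twice differentiable on $(A,\infty)$, with $h(x)=x^{\beta}\,c\exp\int_A^x\frac{\epsilon(u)}{u}du$ for $x\ge A$, $\epsilon(x)=o(1)$, $x|\epsilon'(x)|=O(1)$ and $x^2|\epsilon''(x)|=O(1)$ as $x\to\infty$; moreover $|h''|\in RV(\theta)$; and either $q=0$ on $[0,\infty)$ or $|q|\in RV(\eta)$ for some $\eta<\theta-\frac{3\beta}{2}-\frac32$. *Rapidly varying case.* There are $A>0$, $c>0$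 and a function $\epsilon$, continuous on $[A,\infty)$ and twice differentiable on $(A,\infty)$, with $\psi(t)=c\exp\int_A^t\frac{\epsilon(u)}{u}du$ for $t\ge A$, $\epsilon(t)\to0$, $t\epsilon'(t)/\epsilon(t)\to0$ and $t^2\epsilon''(t)/\epsilon(t)\to0$ as $t\to\infty$; and either $q=0$ on $[0,\infty)$ or $|q\circ\psi|\in RV(\eta)$ for some $\eta<-\frac12$. **Notation.** Let $\Phi(t)=E[e^{tX_1}]$, $m=(\log\Phi)'$, $s^2=(\log\Phi)''$ with $s\ge 0$, $\mu_3=(\log\Phi)'''$. Let $S_1^n=X_1+\dots+X_n$, let $p^{*n}$ be the $n$-fold convolution power of $p$, and for $n>k$ let $$p(X_1^k=y_1^k\mid S_1^n=\sigma)=\frac{\prod_{i=1}^k p(y_i)\;p^{*(n-k)}(\sigma-y_1-\dots-y_k)}{p^{*n}(\sigma)}$$ be the conditional density of $(X_1,\dots,X_k)$ at $y_1^k=(y_1,\dots,y_k)$ given $S_1^n=\sigma$. Write $\mathfrak n(\mu,v,\cdot)$ for the normal density with mean $\mu$ and variance $v$. Let $a_n\to\infty$ be real numbers such that, with $t_{(n)}$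 defined by $m(t_{(n)})=a_n$, $$0<\liminf_{n\to\infty}\frac{a_n}{s(t_{(n)})\sqrt n}\le\limsup_{n\to\infty}\frac{a_n}{s(t_{(n)})\sqrt n}<\infty .$$ **Theorem.** Let $k$ be fixed. For $y_1^k\in\mathbb R^k$ and $1\le i\le k$ put $$m_i=\frac{na_n-(y_1+\dots+y_{i-1})}{n-i+1},\qquad m(t_i)=m_i,\qquad s_i^2=s^2(t_i),$$ $$\beta_i=(n-i+1)s_i^2,\qquad \alpha_i=t_i+\frac{\mu_3(t_i)}{2(n-i+1)s_i^2},\qquad g_i(x)=C_i\,p(x)\,\mathfrak n(\alpha_i\beta_i+a_n,\beta_i,x),$$ where $C_i$ is the constant such that $\int g_i(x)\,dx=1$. Then: 1. For every fixed $y_1^k\in\mathbb R^k$, as $n\to\infty$, $$p(X_1^k=y_1^k\mid S_1^n=na_n)=\prod_{i=1}^k g_i(y_i)\,(1+o(1)).$$ 2. Conditional independence is lost: if $k\ge2$, then for every fixed $y_1^k\in[0,\infty)^k$ the joint conditional density is not asymptotically equivalent to the product of its marginals, that is, $p(X_1^k=y_1^k\mid S_1^n=na_n)=\prod_{i=1}^k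 p(X_1=y_i\mid S_1^n=na_n)\,(1+o(1))$ does not hold. -/

import Mathlib

open MeasureTheory ProbabilityTheory Filter Topology Set

noncomputable section

/-- `f` is regularly varying at infinity with index `ρ`: it is positive and measurable on a
half-line `[A, ∞)` and `f (λ x) / f x → λ ^ ρ` for every `λ > 0`. -/
def IsRegularlyVarying (f : ℝ → ℝ) (ρ : ℝ) : Prop :=
  (∃ A : ℝ, (∀ x, A ≤ x → 0 < f x) ∧ Measurable (fun x : Ici A => f x)) ∧
  ∀ r : ℝ, 0 < r → Tendsto (fun x => f (r * x) / f x) atTop (𝓝 (r ^ ρ))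

/-- On the half-line `[A, ∞)`, `A > 0`, the function `f` is `x ^ ρ` times a slowly varying
function in Karamata form, `f x = x ^ ρ * c * exp (∫_A^x ε(u)/u du)` with `c > 0`, where `ε` is
continuous on `[A, ∞)` and twice differentiable on `(A, ∞)`. -/
def HasKaramataForm (f : ℝ → ℝ) (ρ A : ℝ) (ε : ℝ → ℝ) : Prop :=
  0 < A ∧ ContinuousOn ε (Ici A) ∧
  (∀ x, A < x → DifferentiableAt ℝ ε x ∧ DifferentiableAt ℝ (deriv ε) x) ∧
  ∃ c : ℝ, 0 < c ∧ ∀ x, A ≤ x → f x = x ^ ρ * (c * Real.exp (∫ u in A..x, ε u / u))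

/-- The generalized inverse `h^←(t) = inf {x > 0 : h x ≥ t}` of a nondecreasing function on
the positive half-line. -/
def genInv (h : ℝ → ℝ) (t : ℝ) : ℝ := sInf {x : ℝ | 0 < x ∧ t ≤ h x}

/-- The regularly varying case for `h = g'` and `q`: `h(x) = x ^ β l(x)` with `β > 0` and `l` in
smooth Karamata form, `|h''|` regularly varying of index `θ ≤ β - 2`, and `q` either zero or with
`|q|` regularly varying of index `η < θ - 3β/2 - 3/2`. -/
def RegularCase (h q : ℝ → ℝ) : Prop :=
  ∃ β θ A : ℝ, ∃ ε : ℝ → ℝ, 0 < β ∧ θ ≤ β - 2 ∧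
    HasKaramataForm h β A ε ∧
    Tendsto ε atTop (𝓝 0) ∧
    (fun x => x * |deriv ε x|) =O[atTop] (fun _ => (1 : ℝ)) ∧
    (fun x => x ^ 2 * |iteratedDeriv 2 ε x|) =O[atTop] (fun _ => (1 : ℝ)) ∧
    IsRegularlyVarying (fun x => |iteratedDeriv 2 h x|) θ ∧
    ((∀ x, 0 ≤ x → q x = 0) ∨
      ∃ η : ℝ, η < θ - 3 * β / 2 - 3 / 2 ∧ IsRegularlyVarying (fun x => |q x|) η)

/-- The rapidly varying case for `h = g'` and `q`: `ψ = h^←` is slowly varying in smooth Karamata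
form, and `q` is either zero or such that `|q ∘ ψ|` is regularly varying of index `η < -1/2`. -/
def RapidCase (h q : ℝ → ℝ) : Prop :=
  ∃ A : ℝ, ∃ ε : ℝ → ℝ,
    HasKaramataForm (genInv h) 0 A ε ∧
    Tendsto ε atTop (𝓝 0) ∧
    Tendsto (fun t => t * deriv ε t / ε t) atTop (𝓝 0) ∧
    Tendsto (fun t => t ^ 2 * iteratedDeriv 2 ε t / ε t) atTop (𝓝 0) ∧
    ((∀ x, 0 ≤ x → q x = 0) ∨
      ∃ η : ℝ, η < -(1 / 2) ∧ IsRegularlyVarying (fun t => |q (genInv h t)|) η)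

/-- The function `p(x) = exp (-(g x - q x))` on `[0, ∞)`, extended by `0`. -/
def expDensity (g q : ℝ → ℝ) (x : ℝ) : ℝ :=
  if 0 ≤ x then Real.exp (-(g x - q x)) else 0

/-- The standing assumptions on the density `p = exp (-(g - q))`. -/
structure StandingAssumptions (g q : ℝ → ℝ) : Prop where
  g_pos : ∀ x, 0 ≤ x → 0 < g x
  g_convex : ConvexOn ℝ (Ici 0) g
  g_diff : ∀ j : ℕ, j < 4 → DifferentiableOn ℝ (iteratedDeriv j g) (Ioi 0)
  g_superlinear : Tendsto (fun x => g x / x) atTop atTop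
  q_meas : Measurable q
  q_bdd : ∃ M : ℝ, ∀ x, 0 ≤ x → |q x| ≤ M
  variation : RegularCase (deriv g) q ∨ RapidCase (deriv g) q
  integral_eq_one : ∫ x, expDensity g q x = 1

/-- The law on `ℝ` with Lebesgue density `p`. -/
def lawOf (p : ℝ → ℝ) : Measure ℝ := volume.withDensity (fun x => ENNReal.ofReal (p x))

/-- `κ_j(t)`, the `j`-th derivative at `t` of `log Φ`, where `Φ` is the moment generating function
of the law with density `p`. -/
def logMgfDeriv (p : ℝ → ℝ) (j : ℕ) (t : ℝ) : ℝ := iteratedDeriv j (cgf id (lawOf p)) t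

/-- The mean function `m(t) = (log Φ)'(t)`. -/
def tiltMean (p : ℝ → ℝ) (t : ℝ) : ℝ := logMgfDeriv p 1 t

/-- The variance function `s²(t) = (log Φ)''(t)`. -/
def tiltVar (p : ℝ → ℝ) (t : ℝ) : ℝ := logMgfDeriv p 2 t

/-- The third centered moment `μ₃(t) = (log Φ)'''(t)`. -/
def tiltThird (p : ℝ → ℝ) (t : ℝ) : ℝ := logMgfDeriv p 3 t

/-- The solution `t` of `m(t) = a` (an arbitrary real number when there is none). -/
def tiltParam (p : ℝ → ℝ) (a : ℝ) : ℝ := Function.invFun (tiltMean p) a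

/-- The density of the sum of `n ≥ 1` independent variables with density `p`: the `n`-fold
convolution power of `p` (by convention `0` for `n = 0`). -/
def sumDensity (p : ℝ → ℝ) : ℕ → ℝ → ℝ
  | 0 => fun _ => 0
  | 1 => p
  | n + 2 => fun x => ∫ u, p u * sumDensity p (n + 1) (x - u)

/-- The joint density of `(X₁, …, X_k)` and `X₁ + ⋯ + X_n` at `(y, σ)`, for `X₁, …, X_n` i.i.d.
with density `p` and `k < n`. -/
def jointDensity (p : ℝ → ℝ) (n k : ℕ) (y : Fin k → ℝ) (σ : ℝ) : ℝ :=
  (∏ i, p (y i)) * sumDensity p (n - k) (σ - ∑ i, y i)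

/-- The conditional density of `(X₁, …, X_k)` at `y` given `X₁ + ⋯ + X_n = σ`. -/
def condDensity (p : ℝ → ℝ) (n k : ℕ) (σ : ℝ) (y : Fin k → ℝ) : ℝ :=
  jointDensity p n k y σ / sumDensity p n σ

section Justification

variable {Ω : Type*} [MeasurableSpace Ω] {P : Measure Ω} {p : ℝ → ℝ}

theorem measurable_sumDensity (hp : Measurable p) : ∀ n, Measurable (sumDensity p n)
  | 0 => measurable_const
  | 1 => hp
  | n + 2 => by
    have ih := measurable_sumDensity hp (n + 1)
    have : StronglyMeasurable (Function.uncurry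
        fun x u : ℝ => p u * sumDensity p (n + 1) (x - u)) := by
      apply Measurable.stronglyMeasurable
      unfold Function.uncurry
      fun_prop
    exact this.integral_prod_right.measurable

theorem sumDensity_nonneg (hp0 : ∀ x, 0 ≤ p x) : ∀ n x, 0 ≤ sumDensity p n x
  | 0, _ => le_rfl
  | 1, x => hp0 x
  | n + 2, _ => integral_nonneg fun u => mul_nonneg (hp0 u) (sumDensity_nonneg hp0 (n + 1) _)

/-- Convolving with the law of density `p` raises the convolution power of the density. -/
theorem lawOf_sumDensity_conv (hp : Measurable p) (hp0 : ∀ x, 0 ≤ p x)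
    [IsFiniteMeasure (lawOf p)] (n : ℕ) [IsFiniteMeasure (lawOf (sumDensity p (n + 1)))] :
    (lawOf p) ∗ (lawOf (sumDensity p (n + 1))) = lawOf (sumDensity p (n + 2)) := by
  have hm := measurable_sumDensity hp (n + 1)
  have key : (lawOf p) ∗ (lawOf (sumDensity p (n + 1))) = volume.withDensity
      (MeasureTheory.lconvolution (fun x => ENNReal.ofReal (p x))
        (fun x => ENNReal.ofReal (sumDensity p (n + 1) x)) volume) :=
    conv_withDensity_eq_lconvolution (by fun_prop) (by fun_prop)
  have hfin : ∫⁻ x, (MeasureTheory.lconvolution (fun x => ENNReal.ofReal (p x))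
        (fun x => ENNReal.ofReal (sumDensity p (n + 1) x)) volume) x ≠ ⊤ := by
    rw [← setLIntegral_univ, ← withDensity_apply _ MeasurableSet.univ, ← key]
    exact measure_ne_top _ _
  rw [key]
  refine withDensity_congr_ae ?_
  have hmeas : Measurable (MeasureTheory.lconvolution (fun x => ENNReal.ofReal (p x))
        (fun x => ENNReal.ofReal (sumDensity p (n + 1) x)) volume) := by
    fun_prop
  filter_upwards [ae_lt_top hmeas hfin] with x hx
  have hsub : ∀ u : ℝ, -u + x = x - u := fun u => by ring
  simp only [MeasureTheory.lconvolution, hsub] at hx ⊢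
  simp only [sumDensity]
  rw [integral_eq_lintegral_of_nonneg_ae, ENNReal.ofReal_toReal]
  · exact lintegral_congr fun u => (ENNReal.ofReal_mul (hp0 u)).symm
  · refine ne_of_eq_of_ne (lintegral_congr fun u => ENNReal.ofReal_mul (hp0 u)) hx.ne
  · exact Eventually.of_forall fun u => mul_nonneg (hp0 u) (sumDensity_nonneg hp0 (n + 1) _)
  · exact (by fun_prop : Measurable fun u => p u * sumDensity p (n + 1) (x - u)).aestronglyMeasurable

/-- `sumDensity p (n + 1)` is the density of a sum of `n + 1` independent variables with
density `p`. -/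
theorem map_sum_eq_lawOf_sumDensity [IsProbabilityMeasure P] (hp : Measurable p)
    (hp0 : ∀ x, 0 ≤ p x) {X : ℕ → Ω → ℝ} (hX : ∀ i, Measurable (X i)) (hind : iIndepFun X P)
    (hlaw : ∀ i, P.map (X i) = lawOf p) (m n : ℕ) :
    P.map (fun ω => ∑ j ∈ Finset.Ico m (m + (n + 1)), X j ω) = lawOf (sumDensity p (n + 1)) := by
  induction n generalizing m with
  | zero => simpa [sumDensity] using hlaw m
  | succ n ih =>
    have hfp : IsFiniteMeasure (lawOf p) := hlaw 0 ▸ inferInstance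
    have hfn : IsFiniteMeasure (lawOf (sumDensity p (n + 1))) := ih (m + 1) ▸ inferInstance
    rw [← lawOf_sumDensity_conv hp hp0 n, ← hlaw m, ← ih (m + 1)]
    have hI : IndepFun (X m) (fun ω => ∑ j ∈ Finset.Ico (m + 1) (m + 1 + (n + 1)), X j ω) P := by
      have := (hind.indepFun_finsetSum_of_notMem hX
        (s := Finset.Ico (m + 1) (m + 1 + (n + 1))) (i := m) (by simp)).symm
      convert this using 2
      simp
    rw [← hI.map_add_eq_map_conv_map (hX m) (by fun_prop)]
    congr 1
    funext ω
    rw [Finset.sum_eq_sum_Ico_succ_bot (by omega)]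
    simp only [Pi.add_apply]
    congr 2
    congr 1
    omega

/-- `jointDensity p n k` is the joint density of `(X₁, …, X_k)` and `X₁ + ⋯ + X_n`, when `k < n`
and the `X_i` are independent with density `p`. -/
theorem map_prodMk_sum_eq_withDensity [IsProbabilityMeasure P] (hp : Measurable p)
    (hp0 : ∀ x, 0 ≤ p x) {X : ℕ → Ω → ℝ} (hX : ∀ i, Measurable (X i)) (hind : iIndepFun X P)
    (hlaw : ∀ i, P.map (X i) = lawOf p) {k n : ℕ} (hkn : k < n) :
    P.map (fun ω => ((fun i : Fin k => X i ω), ∑ j ∈ Finset.range n, X j ω)) =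
      (volume : Measure ((Fin k → ℝ) × ℝ)).withDensity
        (fun z => ENNReal.ofReal (jointDensity p n k z.1 z.2)) := by
  have hfp : IsProbabilityMeasure (lawOf p) :=
    hlaw 0 ▸ Measure.isProbabilityMeasure_map (hX 0).aemeasurable
  obtain ⟨l, rfl⟩ : ∃ l, n = k + (l + 1) := ⟨n - k - 1, by omega⟩
  have hS := measurable_sumDensity hp (l + 1)
  have hT := map_sum_eq_lawOf_sumDensity hp hp0 hX hind hlaw k l
  have hY : P.map (fun ω => fun i : Fin k => X i ω) =
      volume.withDensity (fun y : Fin k → ℝ => ENNReal.ofReal (∏ i, p (y i))) := by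
    have h1 := hind.precomp (g := fun i : Fin k => (i : ℕ)) Fin.val_injective
    rw [iIndepFun_iff_map_fun_eq_pi_map (fun i => (hX _).aemeasurable)] at h1
    have h2 : P.map (fun ω => fun i : Fin k => X i ω) =
        Measure.pi (fun _ : Fin k => lawOf p) := by
      simpa [Function.comp_def, hlaw] using h1
    rw [h2]
    have hint : Integrable p := by
      refine ⟨hp.aestronglyMeasurable, ?_⟩
      rw [hasFiniteIntegral_iff_ofReal (Eventually.of_forall hp0), ← setLIntegral_univ,
        ← withDensity_apply _ MeasurableSet.univ]
      exact measure_lt_top (lawOf p) _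
    refine (Measure.pi_eq fun s hs => ?_)
    rw [withDensity_apply _ (MeasurableSet.univ_pi hs), volume_pi, Measure.restrict_pi_pi,
      ← ofReal_integral_eq_lintegral_ofReal, integral_fintype_prod_eq_prod,
      ENNReal.ofReal_prod_of_nonneg (fun i _ => integral_nonneg fun x => hp0 x)]
    · refine Finset.prod_congr rfl fun i _ => ?_
      rw [lawOf, withDensity_apply _ (hs i), ofReal_integral_eq_lintegral_ofReal
        hint.restrict (Eventually.of_forall hp0)]
    · exact Integrable.fintype_prod fun i => hint.restrict
    · exact Eventually.of_forall fun y => Finset.prod_nonneg fun i _ => hp0 _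
  have hI : IndepFun (fun ω => fun i : Fin k => X i ω)
      (fun ω => ∑ j ∈ Finset.Ico k (k + (l + 1)), X j ω) P := by
    have := hind.indepFun_finset (Finset.range k) (Finset.Ico k (k + (l + 1)))
      (by rw [Finset.disjoint_left]; intro x; simp; omega) hX
    have := this.comp
      (φ := fun v : (Finset.range k → ℝ) => fun i : Fin k => v ⟨i, by simp⟩)
      (ψ := fun v : (Finset.Ico k (k + (l + 1)) → ℝ) => ∑ j, v j) (by fun_prop) (by fun_prop)
    have e : (fun ω => ∑ j ∈ Finset.Ico k (k + (l + 1)), X j ω) =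
        fun ω => ∑ j : Finset.Ico k (k + (l + 1)), X j ω :=
      funext fun ω => (Finset.sum_coe_sort (Finset.Ico k (k + (l + 1))) (fun j => X j ω)).symm
    rw [e]
    exact this
  have hmap : (fun ω => ((fun i : Fin k => X i ω), ∑ j ∈ Finset.range (k + (l + 1)), X j ω)) =
      (fun z : (Fin k → ℝ) × ℝ => (z.1, ∑ i, z.1 i + z.2)) ∘
      (fun ω => ((fun i : Fin k => X i ω), ∑ j ∈ Finset.Ico k (k + (l + 1)), X j ω)) := by
    funext ω
    simp only [Function.comp_apply, Prod.mk.injEq, true_and]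
    rw [Fin.sum_univ_eq_sum_range (fun i => X i ω) k, Finset.sum_range_add_sum_Ico _ (by omega)]
  rw [hmap, ← Measure.map_map (by fun_prop) (by fun_prop),
    hI.map_prod_eq_prod_map_map (by fun_prop) (by fun_prop), hY, hT, lawOf,
    prod_withDensity (by fun_prop) (by fun_prop)]
  have hf : Measurable fun y : Fin k → ℝ => ∏ i, p (y i) := by fun_prop
  refine Measure.ext_of_lintegral _ fun F hF => ?_
  have hJ : Measurable fun z : (Fin k → ℝ) × ℝ => jointDensity p (k + (l + 1)) k z.1 z.2 := by
    unfold jointDensity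
    rw [Nat.add_sub_cancel_left]
    fun_prop
  rw [lintegral_map hF (by fun_prop), lintegral_withDensity_eq_lintegral_mul _ (by fun_prop)
    (by fun_prop), lintegral_withDensity_eq_lintegral_mul _ (by fun_prop) hF,
    Measure.volume_eq_prod, lintegral_prod _ (by fun_prop), lintegral_prod _ (by fun_prop)]
  refine lintegral_congr fun y => ?_
  refine Eq.trans (lintegral_congr fun t => ?_)
    (lintegral_add_left_eq_self (μ := (volume : Measure ℝ)) _ (∑ i, y i))
  simp only [Pi.mul_apply, jointDensity, Nat.add_sub_cancel_left, add_sub_cancel_left]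
  rw [ENNReal.ofReal_mul (Finset.prod_nonneg fun i _ => hp0 _)]

end Justification

section Approximation

/- Indices are shifted by one: `i : Fin k` with value `0, …, k - 1` stands for the index
`i + 1 ∈ {1, …, k}`, so that `n - i` below is `n - (i + 1) + 1`. -/

/-- `m_i`, the mean still to be reached by each of the remaining variables, given the values of
the preceding ones and the value `n a` of the whole sum. -/
def remMean (a : ℝ) (n : ℕ) {k : ℕ} (y : Fin k → ℝ) (i : Fin k) : ℝ :=
  ((n : ℝ) * a - ∑ j ∈ Finset.Iio i, y j) / ((n : ℝ) - (i : ℕ))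

/-- `t_i`, defined by `m(t_i) = m_i`. -/
def remParam (p : ℝ → ℝ) (a : ℝ) (n : ℕ) {k : ℕ} (y : Fin k → ℝ) (i : Fin k) : ℝ :=
  tiltParam p (remMean a n y i)

/-- `β_i`. -/
def approxVar (p : ℝ → ℝ) (a : ℝ) (n : ℕ) {k : ℕ} (y : Fin k → ℝ) (i : Fin k) : ℝ :=
  ((n : ℝ) - (i : ℕ)) * tiltVar p (remParam p a n y i)

/-- `α_i`. -/
def approxShift (p : ℝ → ℝ) (a : ℝ) (n : ℕ) {k : ℕ} (y : Fin k → ℝ) (i : Fin k) : ℝ :=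
  remParam p a n y i + tiltThird p (remParam p a n y i) /
    (2 * ((n : ℝ) - (i : ℕ)) * tiltVar p (remParam p a n y i))

/-- `x ↦ p(x) 𝔫(α_i β_i + a, β_i, x)`, the unnormalized form of `g_i`; `𝔫(μ, v, ·)` is the normal
density with mean `μ` and variance `v`. -/
def approxKernel (p : ℝ → ℝ) (a : ℝ) (n : ℕ) {k : ℕ} (y : Fin k → ℝ) (i : Fin k) (x : ℝ) : ℝ :=
  p x * gaussianPDFReal (approxShift p a n y i * approxVar p a n y i + a)
    (approxVar p a n y i).toNNReal x

/-- `g_i = C_i p 𝔫(α_i β_i + a, β_i, ·)`, with `C_i` the normalizing constant. -/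
def approxDensity (p : ℝ → ℝ) (a : ℝ) (n : ℕ) {k : ℕ} (y : Fin k → ℝ) (i : Fin k) (x : ℝ) : ℝ :=
  (∫ u, approxKernel p a n y i u)⁻¹ * approxKernel p a n y i x

end Approximation

/-- The fast growth condition
`0 < liminf a_n / (s √n) ≤ limsup a_n / (s √n) < ∞`, where `s = s(t)` with `m(t) = a_n`. -/
def FastGrowth (p : ℝ → ℝ) (a : ℕ → ℝ) : Prop :=
  let r : ℕ → EReal := fun n =>
    ((a n / (Real.sqrt (tiltVar p (tiltParam p (a n))) * Real.sqrt n) : ℝ) : EReal)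
  0 < liminf r atTop ∧ limsup r atTop < ⊤

end

/-!
The idea is to follow the whole conditional law through a single exponential tilt. Let `t` be the
parameter with `m(t) = a_n`, let `s² = s²(t)`, and let `f` be the density of the standardized tilted
law (`stdTilt`). Tilting commutes with convolution (`IsLightTailed.sumDensity_stdTilt`), so that the
conditional density at `y` is

  `∏ p(y_i) e^{t y_i} / Φ(t)` times `f^{*(n-k)}((k a_n - ∑ y_i) / s) / f^{*n}(0)`.

A local limit theorem for `f`, uniform in `t`, turns the last quotient into `exp (-k² r² / 2)` up to
a factor `1 + o(1)`, where `r = a_n / (s √n)` stays between two positive constants by the growth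
condition. Here the displacement `k a_n` of the remaining sum is of the order `s √n` of its standard
deviation. With `k = 1` the marginals get the factor `exp (-r² / 2)` each, and since
`k² ≠ k` for `k ≥ 2`, the product of the marginals differs from the joint density by a factor that
stays away from `1`.

For the approximation by the `g_i`, completing the square shows that `g_i` is the tilted density of
parameter `α_i`, damped by a Gaussian factor which equals `exp (-r² / 2) (1 + o(1))` at `y_i` and is
negligible in the normalizing constant. As `a_n (α_i - t) = (i - 1) r² + o(1)` for `i = 1, …, k`,
changing the parameter from `t` to `α_i` multiplies `Φ` by `exp ((i - 1) r²) (1 + o(1))`. The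
product of the `g_i` therefore carries the factor `exp (-∑ (i - 1/2) r²) = exp (-k² r² / 2)`, as the
joint density does.

Two uniform facts about the tilted laws make this work.

* The tilted density has an exponential envelope `C / w * exp (-|x - x₀| / w)` with a constant `C`
  independent of `t` (`StandingAssumptions.exists_tiltEnvelope`). This only uses that `g` is convex
  and `q` bounded: `w` is the length of the set where `t x - g x` is within `1` of its maximum. It
  gives bounds of the density and of the third absolute moment of the standardized tilted law, hence
  the hypotheses of the uniform local limit theorem (`exists_forall_abs_sumDensity_sub_le`, proved
  by Fourier inversion), and `|μ₃| ≤ K s³`. The latter says that `1 / s` is Lipschitz, so that `s` is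
  asymptotically constant over changes `o(1 / s)` of the parameter.
* `m(t) → ∞` and `μ₃(t) / m(t) → 0` (`StandingAssumptions.tilt_limits`), which disposes of the
  correction term in `α_i`. In the rapidly varying case the scale `w` is bounded. In the regularly
  varying case `w² = O(x₀ / t)` and the tilted density is nearly symmetric about `x₀`: the odd part
  of the exponent is `O(t u³ / x₀²)` by the bound on `h''`, and the contribution of `q` is
  `O(1 / x₀)`.
-/

noncomputable section

/-! ### Characteristic functions of standardized laws -/

/-- A probability law on `ℝ` with density at most `K`, mean `0`, variance `1` and absolute third
moment at most `K`. The density bound is expressed as domination by `K` times Lebesgue measure. -/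
structure IsStdLaw (K : ℝ) (μ : Measure ℝ) : Prop where
  one_le : 1 ≤ K
  prob : IsProbabilityMeasure μ
  le_volume : μ ≤ ENNReal.ofReal K • (volume : Measure ℝ)
  integrable_cube : Integrable (fun x : ℝ => |x| ^ 3) μ
  mean : ∫ x, x ∂μ = 0
  second : ∫ x, x ^ 2 ∂μ = 1
  third : ∫ x, |x| ^ 3 ∂μ ≤ K

theorem norm_exp_mul_I_sub_taylor_two_le (x : ℝ) :
    ‖Complex.exp (x * Complex.I) - (1 + x * Complex.I - (x : ℂ) ^ 2 / 2)‖ ≤ 4 * |x| ^ 3 := by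
  rcases le_total |x| 1 with h | h
  · have hx : ‖(x * Complex.I : ℂ)‖ ≤ 1 := by simpa using h
    have := Complex.exp_bound hx (n := 3) (by norm_num)
    simp only [Finset.sum_range_succ, Finset.sum_range_zero, Nat.factorial] at this
    have e : Complex.exp (x * Complex.I) - (1 + x * Complex.I - (x : ℂ) ^ 2 / 2) =
        Complex.exp (x * Complex.I) - (0 + (x * Complex.I) ^ 0 / ((1 : ℕ) : ℂ) +
          (x * Complex.I) ^ 1 / (((0 + 1) * 1 : ℕ) : ℂ) +
          (x * Complex.I) ^ 2 / (((1 + 1) * ((0 + 1) * 1) : ℕ) : ℂ)) := by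
      push_cast
      linear_combination ((x : ℂ) ^ 2 / 2) * Complex.I_sq
    rw [e]
    refine this.trans ?_
    simp only [norm_mul, Complex.norm_real, Real.norm_eq_abs, Complex.norm_I, mul_one]
    push_cast
    nlinarith [pow_nonneg (abs_nonneg x) 3]
  · have h1 : ‖Complex.exp (x * Complex.I)‖ = 1 := Complex.norm_exp_ofReal_mul_I x
    have h2 : ‖(1 + x * Complex.I - (x : ℂ) ^ 2 / 2)‖ ≤ 1 + |x| + |x| ^ 2 / 2 := by
      refine (norm_sub_le _ _).trans (add_le_add ((norm_add_le _ _).trans ?_) ?_)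
      · simp
      · simp
    refine (norm_sub_le _ _).trans ?_
    rw [h1]
    have h3 : |x| ≤ |x| ^ 3 := le_self_pow₀ h (by norm_num)
    have h4 : |x| ^ 2 ≤ |x| ^ 3 := pow_le_pow_right₀ h (by norm_num)
    have h5 : 1 ≤ |x| ^ 3 := one_le_pow₀ h
    linarith

namespace IsStdLaw

variable {K : ℝ} {μ : Measure ℝ}

theorem integrable_sq (h : IsStdLaw K μ) : Integrable (fun x : ℝ => x ^ 2) μ := by
  have := h.prob
  refine ((integrable_const (1 : ℝ)).add h.integrable_cube).mono' (by fun_prop)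
    (Eventually.of_forall fun x => ?_)
  simp only [Real.norm_eq_abs, abs_pow, Pi.add_apply]
  rcases le_total |x| 1 with hx | hx
  · have := pow_le_one₀ (n := 2) (abs_nonneg x) hx
    have := pow_nonneg (abs_nonneg x) 3
    linarith
  · have := pow_le_pow_right₀ hx (show 2 ≤ 3 by norm_num)
    linarith

theorem integrable_id (h : IsStdLaw K μ) : Integrable (fun x : ℝ => x) μ := by
  have := h.prob
  refine ((integrable_const (1 : ℝ)).add h.integrable_sq).mono' (by fun_prop)
    (Eventually.of_forall fun x => ?_)
  simp only [Real.norm_eq_abs, Pi.add_apply]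
  rw [← sq_abs]
  nlinarith [sq_nonneg (|x| - 1), abs_nonneg x]

theorem integrable_exp_char (h : IsStdLaw K μ) (u : ℝ) :
    Integrable (fun x : ℝ => Complex.exp (u * x * Complex.I)) μ := by
  have := h.prob
  refine (integrable_const (1 : ℝ)).mono' (by fun_prop) (Eventually.of_forall fun x => ?_)
  rw [← Complex.ofReal_mul, Complex.norm_exp_ofReal_mul_I]

theorem norm_charFun_sub_le (h : IsStdLaw K μ) (u : ℝ) :
    ‖charFun μ u - (1 - (u : ℂ) ^ 2 / 2)‖ ≤ 4 * K * |u| ^ 3 := by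
  have := h.prob
  have e1 : ∫ x : ℝ, (1 + (u * x : ℝ) * Complex.I - ((u * x : ℝ) : ℂ) ^ 2 / 2) ∂μ =
      1 - (u : ℂ) ^ 2 / 2 := by
    have hi1 : Integrable (fun x : ℝ => ((u * x : ℝ) : ℂ) * Complex.I) μ :=
      ((h.integrable_id.const_mul u).ofReal).mul_const _
    have hi2 : Integrable (fun x : ℝ => ((u * x : ℝ) : ℂ) ^ 2 / 2) μ := by
      have := ((h.integrable_sq.const_mul (u ^ 2 / 2)).ofReal (𝕜 := ℂ))
      refine this.congr (Eventually.of_forall fun x => ?_)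
      simp; ring
    have hi3 : Integrable (fun x : ℝ => 1 + ((u * x : ℝ) : ℂ) * Complex.I) μ :=
      (integrable_const _).add hi1
    rw [integral_sub hi3 hi2, integral_add (integrable_const _) hi1]
    have a1 : ∫ x : ℝ, ((u * x : ℝ) : ℂ) * Complex.I ∂μ = 0 := by
      rw [integral_mul_const, integral_complex_ofReal, integral_const_mul, h.mean]; simp
    have a2 : ∫ x : ℝ, ((u * x : ℝ) : ℂ) ^ 2 / 2 ∂μ = (u : ℂ) ^ 2 / 2 := by
      have : ∀ x : ℝ, ((u * x : ℝ) : ℂ) ^ 2 / 2 = ((u ^ 2 / 2 * x ^ 2 : ℝ) : ℂ) := by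
        intro x; push_cast; ring
      simp_rw [this]
      rw [integral_complex_ofReal, integral_const_mul, h.second]; simp
    rw [a1, a2]; simp
  rw [charFun_apply_real, ← e1, ← integral_sub (h.integrable_exp_char u)]
  · refine (norm_integral_le_integral_norm _).trans ?_
    calc ∫ x : ℝ, ‖Complex.exp (u * x * Complex.I) -
          (1 + (u * x : ℝ) * Complex.I - ((u * x : ℝ) : ℂ) ^ 2 / 2)‖ ∂μ
        ≤ ∫ x : ℝ, (4 * |u| ^ 3) * |x| ^ 3 ∂μ := by
          refine integral_mono_of_nonneg (Eventually.of_forall fun x => norm_nonneg _)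
            (h.integrable_cube.const_mul _) (Eventually.of_forall fun x => ?_)
          have := norm_exp_mul_I_sub_taylor_two_le (u * x)
          rw [abs_mul, mul_pow] at this
          simp only [Complex.ofReal_mul] at this ⊢
          linarith
      _ ≤ 4 * K * |u| ^ 3 := by
          rw [integral_const_mul]
          have := mul_le_mul_of_nonneg_left h.third (show 0 ≤ 4 * |u| ^ 3 by positivity)
          linarith
  · have hi1 : Integrable (fun x : ℝ => ((u * x : ℝ) : ℂ) * Complex.I) μ :=
      ((h.integrable_id.const_mul u).ofReal).mul_const _
    have hi2 : Integrable (fun x : ℝ => ((u * x : ℝ) : ℂ) ^ 2 / 2) μ := by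
      have := ((h.integrable_sq.const_mul (u ^ 2 / 2)).ofReal (𝕜 := ℂ))
      refine this.congr (Eventually.of_forall fun x => ?_)
      simp; ring
    exact ((integrable_const _).add hi1).sub hi2

theorem norm_charFun_le_exp (h : IsStdLaw K μ) {u : ℝ} (hu : |u| ≤ 1 / (16 * K)) :
    ‖charFun μ u‖ ≤ Real.exp (-(u ^ 2 / 4)) := by
  have hK := h.one_le
  have h1 := h.norm_charFun_sub_le u
  have hu1 : |u| ≤ 1 := hu.trans (by rw [div_le_one (by positivity)]; linarith)
  have hu2 : u ^ 2 ≤ 1 := by rw [← sq_abs]; exact pow_le_one₀ (abs_nonneg u) hu1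
  have h2 : ‖(1 - (u : ℂ) ^ 2 / 2)‖ = 1 - u ^ 2 / 2 := by
    have : (1 - (u : ℂ) ^ 2 / 2) = ((1 - u ^ 2 / 2 : ℝ) : ℂ) := by push_cast; ring
    rw [this, Complex.norm_real, Real.norm_of_nonneg (by linarith)]
  have h3 : 4 * K * |u| ^ 3 ≤ u ^ 2 / 4 := by
    have : K * |u| ≤ 1 / 16 := by
      rw [le_div_iff₀ (by positivity)] at hu
      linarith
    rw [← sq_abs u]
    nlinarith [sq_nonneg (|u|)]
  have h4 : ‖charFun μ u‖ ≤ ‖charFun μ u - (1 - (u : ℂ) ^ 2 / 2)‖ + ‖(1 - (u : ℂ) ^ 2 / 2)‖ := by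
    have := norm_add_le (charFun μ u - (1 - (u : ℂ) ^ 2 / 2)) (1 - (u : ℂ) ^ 2 / 2)
    rwa [sub_add_cancel] at this
  have h5 := Real.add_one_le_exp (-(u ^ 2 / 4))
  linarith

theorem norm_charFun_sub_exp_le (h : IsStdLaw K μ) {u : ℝ} (hu : |u| ≤ 1) :
    ‖charFun μ u - Complex.exp (-((u : ℂ) ^ 2 / 2))‖ ≤ 5 * K * |u| ^ 3 := by
  have h1 := h.norm_charFun_sub_le u
  have hu2 : u ^ 2 ≤ 1 := by rw [← sq_abs]; exact pow_le_one₀ (abs_nonneg u) hu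
  have h2 : ‖(1 - (u : ℂ) ^ 2 / 2) - Complex.exp (-((u : ℂ) ^ 2 / 2))‖ ≤ |u| ^ 3 := by
    have : (1 - (u : ℂ) ^ 2 / 2) - Complex.exp (-((u : ℂ) ^ 2 / 2)) =
        ((-(Real.exp (-(u ^ 2 / 2)) - 1 - (-(u ^ 2 / 2))) : ℝ) : ℂ) := by push_cast; ring
    rw [this, Complex.norm_real, norm_neg, Real.norm_eq_abs]
    refine (Real.abs_exp_sub_one_sub_id_le ?_).trans ?_
    · rw [abs_neg, abs_of_nonneg (by positivity)]; linarith
    · have : (-(u ^ 2 / 2)) ^ 2 = |u| ^ 3 * (|u| / 4) := by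
        have : u ^ 2 = |u| ^ 2 := (sq_abs u).symm
        rw [this]; ring
      rw [this]
      have := pow_nonneg (abs_nonneg u) 3
      nlinarith [abs_nonneg u]
  have h3 := norm_add_le (charFun μ u - (1 - (u : ℂ) ^ 2 / 2))
    ((1 - (u : ℂ) ^ 2 / 2) - Complex.exp (-((u : ℂ) ^ 2 / 2)))
  rw [sub_add_sub_cancel] at h3
  have := mul_le_mul_of_nonneg_right h.one_le (pow_nonneg (abs_nonneg u) 3)
  linarith

/-- At most a quarter of the mass lies outside `[-2, 2]`, by Chebyshev's inequality. -/
theorem measureReal_two_le_abs (h : IsStdLaw K μ) : μ.real {x | 2 ≤ |x|} ≤ 1 / 4 := by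
  have := h.prob
  have h1 := mul_meas_ge_le_integral_of_nonneg (μ := μ) (f := fun x : ℝ => x ^ 2)
    (Eventually.of_forall fun x => sq_nonneg x) h.integrable_sq 4
  rw [h.second] at h1
  have : {x : ℝ | 2 ≤ |x|} = {x : ℝ | 4 ≤ x ^ 2} := by
    ext x
    simp only [mem_ofPred_eq]
    rw [← sq_abs]
    constructor
    · intro hx; nlinarith
    · intro hx; nlinarith [abs_nonneg x]
  rw [this]
  linarith

end IsStdLaw

/-- The set of points of `[-2, 2]` at which a cosine of frequency `u` is close to `1` is covered by
few short intervals, one for each maximum of the cosine. -/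
theorem volume_cos_near_one_le {u θ δ r : ℝ} (hδ : 0 < δ) (hu : δ ≤ u) (hθ : |θ| ≤ Real.pi)
    (hr : 0 < r) :
    volume {x : ℝ | |x| ≤ 2 ∧ 1 - Real.cos (u * x - θ) < 2 * r ^ 2 / Real.pi ^ 2} ≤
      ENNReal.ofReal (2 * r * (2 + 5 / δ)) := by
  have hu0 : 0 < u := hδ.trans_le hu
  have hpi := Real.pi_pos
  have hpi3 := Real.pi_gt_three
  set J : ℤ := ⌊u + 2⌋ with hJ
  have hsub : {x : ℝ | |x| ≤ 2 ∧ 1 - Real.cos (u * x - θ) < 2 * r ^ 2 / Real.pi ^ 2} ⊆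
      ⋃ j ∈ Finset.Icc (-J) J, Metric.ball ((θ + 2 * Real.pi * j) / u) (r / u) := by
    rintro x ⟨hx, hc⟩
    set y := u * x - θ with hy
    set j : ℤ := round (y / (2 * Real.pi)) with hj
    have h1 := abs_sub_round (y / (2 * Real.pi))
    rw [← hj] at h1
    have h2 : |y - 2 * Real.pi * j| ≤ Real.pi := by
      have : y - 2 * Real.pi * j = (2 * Real.pi) * (y / (2 * Real.pi) - j) := by
        field_simp
      rw [this, abs_mul, abs_of_pos (by positivity)]
      nlinarith
    have h3 : Real.cos (y - 2 * Real.pi * j) = Real.cos y := by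
      rw [show 2 * Real.pi * (j : ℝ) = j * (2 * Real.pi) by ring, Real.cos_sub_int_mul_two_pi]
    -- on `[-π, π]` one has `1 - cos v ≥ 2 v ^ 2 / π ^ 2`
    have h4 := Real.cos_le_one_sub_mul_cos_sq h2
    rw [h3] at h4
    have h5 : |y - 2 * Real.pi * j| < r := by
      have : 2 / Real.pi ^ 2 * (y - 2 * Real.pi * j) ^ 2 < 2 / Real.pi ^ 2 * r ^ 2 := by
        have : 2 * r ^ 2 / Real.pi ^ 2 = 2 / Real.pi ^ 2 * r ^ 2 := by ring
        linarith
      have := lt_of_mul_lt_mul_left this (by positivity)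
      exact abs_lt_of_sq_lt_sq this hr.le
    simp only [mem_iUnion, exists_prop, Finset.mem_Icc]
    refine ⟨j, ?_, ?_⟩
    · have h6 : |(j : ℝ)| ≤ u + 2 := by
        have : |y| ≤ 2 * u + Real.pi := by
          refine (abs_sub _ _).trans (add_le_add ?_ hθ)
          rw [abs_mul, abs_of_pos hu0]; nlinarith
        have h7 : |2 * Real.pi * (j : ℝ)| ≤ 2 * u + 2 * Real.pi := by
          have := abs_sub_abs_le_abs_sub (2 * Real.pi * (j : ℝ)) y
          have h8 : |2 * Real.pi * (j : ℝ) - y| ≤ Real.pi := by rwa [abs_sub_comm]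
          linarith
        rw [abs_mul, abs_of_pos (by positivity)] at h7
        nlinarith [abs_nonneg (j : ℝ)]
      rw [abs_le] at h6
      refine ⟨?_, Int.le_floor.2 h6.2⟩
      rw [neg_le]
      refine Int.le_floor.2 ?_
      push_cast; linarith
    · rw [Metric.mem_ball, Real.dist_eq]
      have : x - (θ + 2 * Real.pi * j) / u = (y - 2 * Real.pi * j) / u := by
        rw [hy]; field_simp; ring
      rw [this, abs_div, abs_of_pos hu0]
      gcongr
  refine (measure_mono hsub).trans ((measure_biUnion_finset_le _ _).trans ?_)
  simp only [Real.volume_ball, Finset.sum_const, Int.card_Icc, nsmul_eq_mul]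
  have hJ0 : (0 : ℤ) ≤ J := Int.floor_nonneg.2 (by linarith)
  have hJu : (J : ℝ) ≤ u + 2 := Int.floor_le _
  have hcard : (((J + 1 - -J).toNat : ℕ) : ℝ) ≤ 2 * u + 5 := by
    have : (((J + 1 - -J).toNat : ℕ) : ℝ) = (((J + 1 - -J).toNat : ℤ) : ℝ) := by norm_cast
    rw [this, Int.toNat_of_nonneg (by linarith)]
    push_cast; linarith
  rw [← ENNReal.ofReal_natCast, ← ENNReal.ofReal_mul (by positivity)]
  refine ENNReal.ofReal_le_ofReal ?_
  calc (((J + 1 - -J).toNat : ℕ) : ℝ) * (2 * (r / u)) ≤ (2 * u + 5) * (2 * (r / u)) := by gcongr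
    _ = 2 * r * (2 + 5 / u) := by field_simp
    _ ≤ 2 * r * (2 + 5 / δ) := by gcongr

/-- Away from the origin the characteristic function of a standardized law with bounded density is
bounded away from `1` in norm, uniformly over the class. -/
theorem exists_norm_charFun_le_of_le_abs (K : ℝ) {δ : ℝ} (hδ : 0 < δ) :
    ∃ ρ : ℝ, 0 ≤ ρ ∧ ρ < 1 ∧ ∀ μ : Measure ℝ, IsStdLaw K μ → ∀ u, δ ≤ |u| → ‖charFun μ u‖ ≤ ρ := by
  by_cases hK : 1 ≤ K
  swap
  · exact ⟨0, le_rfl, one_pos, fun μ h => absurd h.one_le hK⟩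
  have hpi := Real.pi_gt_three
  -- with this `r` the intervals of `volume_cos_near_one_le` have total mass at most `1 / 4`
  set r : ℝ := 1 / (8 * K * (2 + 5 / δ)) with hr
  have hr0 : 0 < r := by positivity
  have hr1 : r ≤ 1 := by
    rw [hr, div_le_one (by positivity)]
    have : 0 < 5 / δ := by positivity
    nlinarith
  set η : ℝ := 2 * r ^ 2 / Real.pi ^ 2 with hη
  have hη0 : 0 < η := by positivity
  have hη1 : η ≤ 1 := by
    rw [hη, div_le_one (by positivity)]
    nlinarith
  refine ⟨1 - η / 2, by linarith, by linarith, ?_⟩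
  have key : ∀ μ : Measure ℝ, IsStdLaw K μ → ∀ u, δ ≤ u → ‖charFun μ u‖ ≤ 1 - η / 2 := by
    intro μ h u hu
    have := h.prob
    set θ := (charFun μ u).arg with hθ
    -- rotating by the argument turns the modulus into an integral of cosines
    have e1 : ‖charFun μ u‖ = ∫ x : ℝ, Real.cos (u * x - θ) ∂μ := by
      have e2 : ((‖charFun μ u‖ : ℝ) : ℂ) =
          ∫ x : ℝ, Complex.exp ((u * x - θ : ℝ) * Complex.I) ∂μ := by
        have : ∀ x : ℝ, Complex.exp ((u * x - θ : ℝ) * Complex.I) =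
            Complex.exp (u * x * Complex.I) * Complex.exp (-(θ * Complex.I)) := by
          intro x; rw [← Complex.exp_add]; push_cast; ring_nf
        simp_rw [this]
        rw [integral_mul_const, ← charFun_apply_real]
        conv_rhs => rw [← Complex.norm_mul_exp_arg_mul_I (charFun μ u)]
        rw [mul_assoc, ← Complex.exp_add, ← hθ]
        simp
      have e3 := congrArg Complex.re e2
      rw [Complex.ofReal_re] at e3
      have hint : Integrable (fun x : ℝ => Complex.exp ((u * x - θ : ℝ) * Complex.I)) μ := by
        refine (integrable_const (1 : ℝ)).mono' (by fun_prop) (Eventually.of_forall fun x => ?_)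
        rw [Complex.norm_exp_ofReal_mul_I]
      rw [e3, ← RCLike.re_eq_complex_re, ← integral_re hint]
      refine integral_congr_ae (Eventually.of_forall fun x => ?_)
      simp only [RCLike.re_eq_complex_re]
      rw [Complex.exp_ofReal_mul_I_re]
    have hcosint : Integrable (fun x : ℝ => 1 - Real.cos (u * x - θ)) μ := by
      refine (integrable_const (2 : ℝ)).mono' (by fun_prop) (Eventually.of_forall fun x => ?_)
      rw [Real.norm_eq_abs, abs_le]
      constructor <;> linarith [Real.cos_le_one (u * x - θ), Real.neg_one_le_cos (u * x - θ)]
    have e4 := mul_meas_ge_le_integral_of_nonneg (μ := μ) (f := fun x => 1 - Real.cos (u * x - θ))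
      (Eventually.of_forall fun x => by simpa using Real.cos_le_one _) hcosint η
    have hci : Integrable (fun x : ℝ => Real.cos (u * x - θ)) μ := by
      refine (integrable_const (1 : ℝ)).mono' (by fun_prop) (Eventually.of_forall fun x => ?_)
      exact Real.abs_cos_le_one _
    rw [integral_sub (integrable_const _) hci, ← e1] at e4
    simp only [integral_const, probReal_univ, smul_eq_mul, mul_one] at e4
    -- at least half of the mass lies where the cosine is at most `1 - η`
    have hcov : (univ : Set ℝ) ⊆ {x | η ≤ 1 - Real.cos (u * x - θ)} ∪
        ({x | 2 ≤ |x|} ∪ {x | |x| ≤ 2 ∧ 1 - Real.cos (u * x - θ) < η}) := by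
      intro x _
      by_cases h1 : η ≤ 1 - Real.cos (u * x - θ)
      · exact Or.inl h1
      · rcases le_total 2 |x| with h2 | h2
        · exact Or.inr (Or.inl h2)
        · exact Or.inr (Or.inr ⟨h2, not_le.1 h1⟩)
    have hB : μ.real {x | |x| ≤ 2 ∧ 1 - Real.cos (u * x - θ) < η} ≤ 1 / 4 := by
      refine ENNReal.toReal_le_of_le_ofReal (by norm_num) ?_
      refine (h.le_volume _).trans ?_
      rw [Measure.smul_apply, smul_eq_mul]
      refine (mul_le_mul_right (volume_cos_near_one_le hδ hu
        (Complex.abs_arg_le_pi _) hr0) _).trans ?_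
      rw [← ENNReal.ofReal_mul (by linarith)]
      refine ENNReal.ofReal_le_ofReal (le_of_eq ?_)
      rw [hr]; field_simp; norm_num
    have hm := (measureReal_mono (μ := μ) hcov (measure_ne_top _ _)).trans
      (measureReal_union_le _ _)
    have hm2 := measureReal_union_le (μ := μ) {x : ℝ | 2 ≤ |x|}
      {x | |x| ≤ 2 ∧ 1 - Real.cos (u * x - θ) < η}
    rw [probReal_univ] at hm
    have hA := h.measureReal_two_le_abs
    nlinarith
  intro μ h u hu
  rcases le_total 0 u with h0 | h0
  · exact key μ h u (by rwa [abs_of_nonneg h0] at hu)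
  · have := key μ h (-u) (by rwa [abs_of_nonpos h0] at hu)
    rwa [charFun_neg, RCLike.norm_conj] at this

/-- The characteristic function of a law whose density is bounded by `K` is square integrable.
Its square modulus is the characteristic function of the symmetrized law, whose density is again
bounded by `K`; integrating it against a centred Gaussian density of variance `v` and exchanging
the integrals bounds the result by `2 π K`, and `v → ∞` gives the claim. -/
theorem IsStdLaw.lintegral_norm_charFun_sq_le {K : ℝ} {μ : Measure ℝ} (h : IsStdLaw K μ) :
    ∫⁻ u : ℝ, ENNReal.ofReal (‖charFun μ u‖ ^ 2) ≤ ENNReal.ofReal (2 * Real.pi * K) := by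
  have := h.prob
  have hK := h.one_le
  set ν : Measure ℝ := μ ∗ (μ.map (fun x => -x)) with hν
  have hprob' : IsProbabilityMeasure (μ.map (fun x : ℝ => -x)) :=
    Measure.isProbabilityMeasure_map (by fun_prop)
  have hνle : ν ≤ ENNReal.ofReal K • (volume : Measure ℝ) := by
    refine Measure.le_iff.2 fun s hs => ?_
    rw [hν, Measure.conv, Measure.map_apply (by fun_prop) hs,
      Measure.prod_apply_symm (measurable_add hs)]
    calc ∫⁻ y, μ ((fun x => (x, y)) ⁻¹' ((fun x : ℝ × ℝ => x.1 + x.2) ⁻¹' s))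
          ∂(μ.map (fun x : ℝ => -x))
        ≤ ∫⁻ y, (ENNReal.ofReal K • (volume : Measure ℝ)) s ∂(μ.map (fun x : ℝ => -x)) := by
          refine lintegral_mono fun y => (h.le_volume _).trans (le_of_eq ?_)
          simp only [Measure.smul_apply]
          congr 1
          exact measure_preimage_add_right volume y s
      _ = (ENNReal.ofReal K • (volume : Measure ℝ)) s := by simp
  have hcf : ∀ u, charFun ν u = ((‖charFun μ u‖ ^ 2 : ℝ) : ℂ) := by
    intro u
    rw [hν, charFun_conv]
    have : charFun (μ.map (fun x : ℝ => -x)) u = charFun μ (-u) := by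
      have := charFun_map_mul (μ := μ) (-1) u
      simpa using this
    rw [this, charFun_neg, Complex.mul_conj, Complex.normSq_eq_norm_sq]
  have hcont : Continuous fun u => ‖charFun μ u‖ ^ 2 := continuous_charFun.norm.pow 2
  have key : ∀ n : ℕ, ∫⁻ u : ℝ, ENNReal.ofReal (‖charFun μ u‖ ^ 2 *
      Real.exp (-(1 / (n + 1 : ℝ)) * u ^ 2)) ≤ ENNReal.ofReal (2 * Real.pi * K) := by
    intro n
    -- the density of this Gaussian law is proportional to `u ↦ exp (-u ^ 2 / (n + 1))`
    set v : NNReal := ⟨(n + 1) / 2, by positivity⟩ with hv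
    have hv0 : (v : ℝ) = (n + 1) / 2 := rfl
    have hvpos : 0 < (v : ℝ) := by rw [hv0]; positivity
    have hvne : v ≠ 0 := by
      intro h0; rw [h0] at hvpos; simp at hvpos
    have hνprob : IsProbabilityMeasure ν := by rw [hν]; infer_instance
    have hswap : ∫ u, charFun ν u ∂(gaussianReal 0 v) = ∫ x, charFun (gaussianReal 0 v) x ∂ν := by
      simp_rw [charFun_apply_real]
      rw [integral_integral_swap]
      · refine integral_congr_ae (Eventually.of_forall fun x =>
          integral_congr_ae (Eventually.of_forall fun u => ?_))
        simp only
        ring_nf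
      · refine (integrable_const (1 : ℝ)).mono' (by fun_prop) (Eventually.of_forall fun z => ?_)
        simp only [Function.uncurry]
        rw [← Complex.ofReal_mul, Complex.norm_exp_ofReal_mul_I]
    have h1 : ∫ x, charFun (gaussianReal 0 v) x ∂ν =
        ((∫ x : ℝ, Real.exp (-(v / 2 : ℝ) * x ^ 2) ∂ν : ℝ) : ℂ) := by
      rw [← integral_complex_ofReal]
      refine integral_congr_ae (Eventually.of_forall fun x => ?_)
      simp only [charFun_gaussianReal]
      push_cast
      congr 1
      ring
    have h2 : ∫ u, charFun ν u ∂(gaussianReal 0 v) =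
        ((∫ u : ℝ, ‖charFun μ u‖ ^ 2 ∂(gaussianReal 0 v) : ℝ) : ℂ) := by
      rw [← integral_complex_ofReal]
      exact integral_congr_ae (Eventually.of_forall fun u => hcf u)
    have h3 : ∫ u : ℝ, ‖charFun μ u‖ ^ 2 ∂(gaussianReal 0 v) =
        ∫ x : ℝ, Real.exp (-(v / 2 : ℝ) * x ^ 2) ∂ν := by
      rw [h1, h2] at hswap; exact_mod_cast hswap
    have hgi : Integrable (fun x : ℝ => Real.exp (-(v / 2 : ℝ) * x ^ 2)) :=
      integrable_exp_neg_mul_sq (by positivity)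
    have h4 : ∫ x : ℝ, Real.exp (-(v / 2 : ℝ) * x ^ 2) ∂ν ≤
        K * Real.sqrt (Real.pi / (v / 2 : ℝ)) := by
      refine (integral_mono_measure hνle (Eventually.of_forall fun x => (Real.exp_pos _).le)
        (hgi.smul_measure ENNReal.ofReal_ne_top)).trans (le_of_eq ?_)
      rw [integral_smul_measure, integral_gaussian, ENNReal.toReal_ofReal (by linarith),
        smul_eq_mul]
    rw [integral_gaussianReal_eq_integral_smul hvne] at h3
    have hpos : 0 < Real.sqrt (2 * Real.pi * v) := Real.sqrt_pos.2 (by positivity)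
    have h5 : ∀ u : ℝ, gaussianPDFReal 0 v u • ‖charFun μ u‖ ^ 2 =
        (Real.sqrt (2 * Real.pi * v))⁻¹ *
          (‖charFun μ u‖ ^ 2 * Real.exp (-(1 / (n + 1 : ℝ)) * u ^ 2)) := by
      intro u
      rw [gaussianPDFReal, smul_eq_mul]
      have : -(u - 0) ^ 2 / (2 * (v : ℝ)) = -(1 / (n + 1 : ℝ)) * u ^ 2 := by
        rw [hv0]; field_simp; ring
      rw [this]; ring
    simp_rw [h5] at h3
    rw [integral_const_mul] at h3
    have h6 : ∫ u : ℝ, ‖charFun μ u‖ ^ 2 * Real.exp (-(1 / (n + 1 : ℝ)) * u ^ 2) ≤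
        2 * Real.pi * K := by
      have h7 : Real.sqrt (2 * Real.pi * v) * Real.sqrt (Real.pi / (v / 2 : ℝ)) =
          2 * Real.pi := by
        rw [← Real.sqrt_mul (by positivity)]
        have : 2 * Real.pi * v * (Real.pi / (v / 2 : ℝ)) = (2 * Real.pi) ^ 2 := by
          field_simp
        rw [this, Real.sqrt_sq (by positivity)]
      have h8 := h3.trans_le h4
      rw [inv_mul_le_iff₀ hpos] at h8
      calc _ ≤ _ := h8
        _ = K * (Real.sqrt (2 * Real.pi * v) * Real.sqrt (Real.pi / (v / 2 : ℝ))) := by ring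
        _ = 2 * Real.pi * K := by rw [h7]; ring
    rw [← ofReal_integral_eq_lintegral_ofReal]
    · exact ENNReal.ofReal_le_ofReal h6
    · refine (integrable_exp_neg_mul_sq (b := 1 / (n + 1 : ℝ)) (by positivity)).mono' ?_
        (Eventually.of_forall fun u => ?_)
      · exact (hcont.mul (by fun_prop)).aestronglyMeasurable
      · rw [Real.norm_of_nonneg (by positivity)]
        have : ‖charFun μ u‖ ^ 2 ≤ 1 := pow_le_one₀ (norm_nonneg _) (norm_charFun_le_one u)
        have := mul_le_mul_of_nonneg_right this (Real.exp_pos (-(1 / (n + 1 : ℝ)) * u ^ 2)).le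
        linarith
    · exact Eventually.of_forall fun u => by positivity
  have hlim : ∀ u : ℝ, Tendsto (fun n : ℕ => ENNReal.ofReal (‖charFun μ u‖ ^ 2 *
      Real.exp (-(1 / (n + 1 : ℝ)) * u ^ 2))) atTop (𝓝 (ENNReal.ofReal (‖charFun μ u‖ ^ 2))) := by
    intro u
    refine ENNReal.tendsto_ofReal ?_
    have h0 : Tendsto (fun n : ℕ => (1 / (n + 1 : ℝ))) atTop (𝓝 0) :=
      tendsto_one_div_add_atTop_nhds_zero_nat
    have := ((h0.neg.mul_const (u ^ 2)).rexp).const_mul (‖charFun μ u‖ ^ 2)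
    simpa using this
  calc ∫⁻ u : ℝ, ENNReal.ofReal (‖charFun μ u‖ ^ 2)
      = ∫⁻ u : ℝ, liminf (fun n : ℕ => ENNReal.ofReal (‖charFun μ u‖ ^ 2 *
      Real.exp (-(1 / (n + 1 : ℝ)) * u ^ 2))) atTop :=
        lintegral_congr fun u => (hlim u).liminf_eq.symm
    _ ≤ liminf (fun n : ℕ => ∫⁻ u : ℝ, ENNReal.ofReal (‖charFun μ u‖ ^ 2 *
      Real.exp (-(1 / (n + 1 : ℝ)) * u ^ 2))) atTop :=
        lintegral_liminf_le fun n => by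
          have : Continuous fun u : ℝ => ‖charFun μ u‖ ^ 2 *
              Real.exp (-(1 / (n + 1 : ℝ)) * u ^ 2) := hcont.mul (by fun_prop)
          exact this.measurable.ennreal_ofReal
    _ ≤ ENNReal.ofReal (2 * Real.pi * K) :=
        liminf_le_of_le (by isBoundedDefault) fun b hb => by
          obtain ⟨n, hn⟩ := hb.exists
          exact hn.trans (key n)

theorem IsStdLaw.integrable_norm_charFun_sq {K : ℝ} {μ : Measure ℝ} (h : IsStdLaw K μ) :
    Integrable (fun u : ℝ => ‖charFun μ u‖ ^ 2) := by
  have := h.prob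
  refine ⟨(continuous_charFun.norm.pow 2).aestronglyMeasurable, ?_⟩
  rw [hasFiniteIntegral_iff_ofReal (Eventually.of_forall fun u => by positivity)]
  exact h.lintegral_norm_charFun_sq_le.trans_lt ENNReal.ofReal_lt_top

theorem IsStdLaw.integral_norm_charFun_sq_le {K : ℝ} {μ : Measure ℝ} (h : IsStdLaw K μ) :
    ∫ u : ℝ, ‖charFun μ u‖ ^ 2 ≤ 2 * Real.pi * K := by
  have hK := h.one_le
  rw [integral_eq_lintegral_of_nonneg_ae (Eventually.of_forall fun u => by positivity)
    h.integrable_norm_charFun_sq.aestronglyMeasurable]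
  exact ENNReal.toReal_le_of_le_ofReal (by positivity) h.lintegral_norm_charFun_sq_le

/-! ### Fourier inversion for convolution powers of a bounded density -/

theorem charFun_lawOf {F : ℝ → ℝ} (hF : Measurable F) (hF0 : ∀ x, 0 ≤ F x) (u : ℝ) :
    charFun (lawOf F) u = ∫ x : ℝ, Complex.exp (u * x * Complex.I) * F x := by
  rw [charFun_apply_real, lawOf, integral_withDensity_eq_integral_toReal_smul (by fun_prop)
    (Eventually.of_forall fun x => ENNReal.ofReal_lt_top)]
  refine integral_congr_ae (Eventually.of_forall fun x => ?_)
  simp only [ENNReal.toReal_ofReal (hF0 x), Complex.real_smul]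
  ring

theorem integrable_of_isFiniteMeasure_lawOf {F : ℝ → ℝ} (hF : Measurable F) (hF0 : ∀ x, 0 ≤ F x)
    [IsFiniteMeasure (lawOf F)] : Integrable F := by
  refine ⟨hF.aestronglyMeasurable, ?_⟩
  rw [hasFiniteIntegral_iff_ofReal (Eventually.of_forall hF0), ← setLIntegral_univ,
    ← withDensity_apply _ MeasurableSet.univ]
  exact measure_lt_top (lawOf F) _

open FourierTransform in
/-- Fourier inversion for a continuous density with integrable characteristic function. -/
theorem density_eq_integral_charFun {F : ℝ → ℝ} (hF : Continuous F) (hF0 : ∀ x, 0 ≤ F x)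
    [IsFiniteMeasure (lawOf F)] (hint : Integrable (charFun (lawOf F))) (x : ℝ) :
    (F x : ℂ) = (2 * Real.pi : ℂ)⁻¹ *
      ∫ u : ℝ, Complex.exp (-(u * x * Complex.I)) * charFun (lawOf F) u := by
  have hFi := integrable_of_isFiniteMeasure_lawOf hF.measurable hF0
  have hpi := Real.pi_pos
  have hft : ∀ w : ℝ, 𝓕 (fun x => (F x : ℂ)) w = charFun (lawOf F) (-(2 * Real.pi) * w) := by
    intro w
    rw [Real.fourier_real_eq_integral_exp_smul, charFun_lawOf hF.measurable hF0]
    refine integral_congr_ae (Eventually.of_forall fun y => ?_)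
    simp only [smul_eq_mul]
    congr 2
    push_cast
    ring
  have hint' : Integrable (𝓕 (fun x => (F x : ℂ))) := by
    have : 𝓕 (fun x => (F x : ℂ)) = fun w => charFun (lawOf F) (-(2 * Real.pi) * w) :=
      funext hft
    rw [this]
    exact hint.comp_mul_left' (by simp [hpi.ne'])
  have hinv := congrFun (Continuous.fourierInv_fourier_eq
    (f := fun x => (F x : ℂ)) (by fun_prop) hFi.ofReal hint') x
  rw [← hinv, Real.fourierInv_eq_fourier_neg, Real.fourier_real_eq_integral_exp_smul]
  simp_rw [hft]
  have hsub := Measure.integral_comp_mul_left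
    (fun u : ℝ => Complex.exp (-(u * x * Complex.I)) * charFun (lawOf F) u) (-(2 * Real.pi))
  rw [abs_inv, abs_neg, abs_of_pos (by positivity), Complex.real_smul] at hsub
  push_cast at hsub
  rw [← hsub]
  refine integral_congr_ae (Eventually.of_forall fun y => ?_)
  simp only [smul_eq_mul]
  congr 2
  push_cast
  ring

/-- The convolution of an integrable function and a bounded measurable one is continuous. -/
theorem continuous_integral_mul_sub {f S : ℝ → ℝ} {B : ℝ} (hf : Integrable f) (hS : Measurable S)
    (hB : ∀ x, |S x| ≤ B) : Continuous fun x => ∫ u, f u * S (x - u) := by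
  have hB0 : 0 ≤ B := (abs_nonneg _).trans (hB 0)
  have hSloc : LocallyIntegrable S volume := by
    refine (locallyIntegrable_const B).mono hS.aestronglyMeasurable
      (Eventually.of_forall fun x => ?_)
    rw [Real.norm_eq_abs, Real.norm_of_nonneg hB0]
    exact hB x
  refine continuous_of_uniform_approx_of_continuous fun V hV => ?_
  obtain ⟨ε, hε, hεV⟩ := Metric.mem_uniformity_dist.1 hV
  obtain ⟨w, hwc, hw, hwcont, hwi⟩ := hf.exists_hasCompactSupport_integral_sub_le
    (show 0 < ε / (2 * (B + 1)) by positivity)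
  refine ⟨fun x => ∫ u, w u * S (x - u), ?_, fun x => hεV ?_⟩
  · exact hwc.continuous_convolution_left (ContinuousLinearMap.mul ℝ ℝ) hwcont hSloc
  · have hprod : ∀ k : ℝ → ℝ, Integrable k → Integrable fun u => k u * S (x - u) := by
      intro k hk
      exact hk.mul_bdd (c := B) (hS.comp (by fun_prop)).aestronglyMeasurable
        (Eventually.of_forall fun u => hB _)
    rw [Real.dist_eq, ← integral_sub (hprod f hf) (hprod w hwi)]
    calc |∫ u, f u * S (x - u) - w u * S (x - u)|
        ≤ ∫ u, ‖f u - w u‖ * B := by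
          rw [← Real.norm_eq_abs]
          refine norm_integral_le_of_norm_le ((hf.sub hwi).norm.mul_const B)
            (Eventually.of_forall fun u => ?_)
          rw [← sub_mul, norm_mul]
          exact mul_le_mul_of_nonneg_left (hB _) (norm_nonneg _)
      _ ≤ ε / (2 * (B + 1)) * B := by
          rw [integral_mul_const]
          exact mul_le_mul_of_nonneg_right hw hB0
      _ < ε := by
          rw [div_mul_eq_mul_div, div_lt_iff₀ (by positivity)]
          nlinarith

section SumDensity

variable {f : ℝ → ℝ}

theorem isProbabilityMeasure_lawOf_sumDensity (hf : Measurable f) (hf0 : ∀ x, 0 ≤ f x)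
    [IsProbabilityMeasure (lawOf f)] (n : ℕ) :
    IsProbabilityMeasure (lawOf (sumDensity f (n + 1))) := by
  induction n with
  | zero => simpa [sumDensity]
  | succ n ih =>
    rw [← lawOf_sumDensity_conv hf hf0 n]
    infer_instance

theorem charFun_lawOf_sumDensity (hf : Measurable f) (hf0 : ∀ x, 0 ≤ f x)
    [IsProbabilityMeasure (lawOf f)] (n : ℕ) (u : ℝ) :
    charFun (lawOf (sumDensity f (n + 1))) u = charFun (lawOf f) u ^ (n + 1) := by
  induction n with
  | zero => simp [sumDensity]
  | succ n ih =>
    have := isProbabilityMeasure_lawOf_sumDensity hf hf0 n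
    rw [← lawOf_sumDensity_conv hf hf0 n, charFun_conv, ih]
    ring

theorem sumDensity_le (hf : Measurable f) (hf0 : ∀ x, 0 ≤ f x)
    [IsProbabilityMeasure (lawOf f)] {B : ℝ} (hB : ∀ x, f x ≤ B) (n : ℕ) (x : ℝ) :
    sumDensity f (n + 1) x ≤ B := by
  have hfi := integrable_of_isFiniteMeasure_lawOf hf hf0
  have hB0 : 0 ≤ B := (hf0 0).trans (hB 0)
  have h1 : ∫ u, f u = 1 := by
    rw [integral_eq_lintegral_of_nonneg_ae (Eventually.of_forall hf0) hf.aestronglyMeasurable,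
      ← setLIntegral_univ, ← withDensity_apply _ MeasurableSet.univ]
    have := measure_univ (μ := lawOf f)
    rw [lawOf] at this
    rw [this, ENNReal.toReal_one]
  induction n generalizing x with
  | zero => exact hB x
  | succ n ih =>
    simp only [sumDensity]
    calc ∫ u, f u * sumDensity f (n + 1) (x - u) ≤ ∫ u, f u * B := by
          refine integral_mono_of_nonneg (Eventually.of_forall fun u =>
            mul_nonneg (hf0 u) (sumDensity_nonneg hf0 _ _)) (hfi.mul_const B)
            (Eventually.of_forall fun u => mul_le_mul_of_nonneg_left (ih _) (hf0 u))
      _ = B := by rw [integral_mul_const, h1, one_mul]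

theorem continuous_sumDensity (hf : Measurable f) (hf0 : ∀ x, 0 ≤ f x)
    [IsProbabilityMeasure (lawOf f)] {B : ℝ} (hB : ∀ x, f x ≤ B) (n : ℕ) :
    Continuous (sumDensity f (n + 2)) := by
  refine continuous_integral_mul_sub (B := B) (integrable_of_isFiniteMeasure_lawOf hf hf0)
    (measurable_sumDensity hf (n + 1)) fun x => ?_
  rw [abs_of_nonneg (sumDensity_nonneg hf0 _ _)]
  exact sumDensity_le hf hf0 hB n x

end SumDensity

/-! ### A uniform local limit theorem -/

theorem norm_pow_sub_pow_le {a b : ℂ} {M : ℝ} (ha : ‖a‖ ≤ M) (hb : ‖b‖ ≤ M) (n : ℕ) :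
    ‖a ^ (n + 1) - b ^ (n + 1)‖ ≤ (n + 1) * M ^ n * ‖a - b‖ := by
  have hM : 0 ≤ M := (norm_nonneg a).trans ha
  induction n with
  | zero => simp
  | succ n ih =>
    have e : a ^ (n + 1 + 1) - b ^ (n + 1 + 1) =
        a * (a ^ (n + 1) - b ^ (n + 1)) + (a - b) * b ^ (n + 1) := by ring
    rw [e]
    refine (norm_add_le _ _).trans ?_
    rw [norm_mul, norm_mul, norm_pow]
    have h1 := mul_le_mul ha ih (norm_nonneg _) hM
    have h2 := mul_le_mul_of_nonneg_left (pow_le_pow_left₀ (norm_nonneg b) hb (n + 1))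
      (norm_nonneg (a - b))
    push_cast
    calc _ ≤ M * ((n + 1) * M ^ n * ‖a - b‖) + ‖a - b‖ * M ^ (n + 1) := add_le_add h1 h2
      _ = _ := by ring

theorem cube_le_two_mul_exp_sq (w : ℝ) : w ^ 3 ≤ 2 * Real.exp (w ^ 2) := by
  have h := Real.quadratic_le_exp_of_nonneg (sq_nonneg w)
  nlinarith [sq_nonneg (w ^ 2 - w), sq_nonneg (w - 1), sq_nonneg w, sq_nonneg (w ^ 2)]

/-- The integrand of the inversion formula for the difference between the law of the sum and the
Gaussian law: near the origin the third-order Taylor expansion applies, away from it both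
characteristic functions are geometrically small. -/
theorem IsStdLaw.norm_charFun_pow_sub_le {K r : ℝ} {μ : Measure ℝ} (h : IsStdLaw K μ)
    (hr : 0 < r) (hρ : ∀ u, 1 / (16 * K) ≤ |u| → ‖charFun μ u‖ ≤ r) {n : ℕ} (hn : 2 ≤ n)
    (u : ℝ) :
    ‖charFun μ u ^ n - Complex.exp (-((n : ℂ) * u ^ 2 / 2))‖ ≤
      640 * K / Real.sqrt n * Real.exp (-(n / 16 : ℝ) * u ^ 2) +
      r ^ n / r ^ 2 * ‖charFun μ u‖ ^ 2 +
      Real.exp (-(n * (1 / (16 * K)) ^ 2 / 4)) * Real.exp (-(1 / 4 : ℝ) * u ^ 2) := by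
  have hK := h.one_le
  have hn0 : (0 : ℝ) < n := by positivity
  have hn2 : (2 : ℝ) ≤ n := by exact_mod_cast hn
  have hs : 0 < Real.sqrt n := Real.sqrt_pos.2 hn0
  set δ : ℝ := 1 / (16 * K) with hδ
  have hδ0 : 0 < δ := by positivity
  have hδ1 : δ ≤ 1 := by rw [hδ, div_le_one (by positivity)]; linarith
  have nn1 : 0 ≤ 640 * K / Real.sqrt n * Real.exp (-(n / 16 : ℝ) * u ^ 2) := by positivity
  have nn2 : 0 ≤ r ^ n / r ^ 2 * ‖charFun μ u‖ ^ 2 := by positivity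
  have nn3 : 0 ≤ Real.exp (-(n * δ ^ 2 / 4)) * Real.exp (-(1 / 4 : ℝ) * u ^ 2) := by positivity
  have hexp : Complex.exp (-((n : ℂ) * u ^ 2 / 2)) = Complex.exp (-((u : ℂ) ^ 2 / 2)) ^ n := by
    rw [← Complex.exp_nat_mul]; ring_nf
  have hnexp : ‖Complex.exp (-((u : ℂ) ^ 2 / 2))‖ = Real.exp (-(u ^ 2 / 2)) := by
    have : Complex.exp (-((u : ℂ) ^ 2 / 2)) = ((Real.exp (-(u ^ 2 / 2)) : ℝ) : ℂ) := by
      push_cast; rfl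
    rw [this, Complex.norm_real, Real.norm_of_nonneg (Real.exp_pos _).le]
  rcases le_total |u| δ with hu | hu
  · have h1 := h.norm_charFun_sub_exp_le (hu.trans hδ1)
    have h2 := h.norm_charFun_le_exp hu
    have h3 : ‖Complex.exp (-((u : ℂ) ^ 2 / 2))‖ ≤ Real.exp (-(u ^ 2 / 4)) := by
      rw [hnexp]
      refine Real.exp_le_exp.2 ?_
      nlinarith [sq_nonneg u]
    obtain ⟨k, rfl⟩ : ∃ k, n = k + 1 := ⟨n - 1, by omega⟩
    have h4 := norm_pow_sub_pow_le h2 h3 k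
    rw [hexp]
    have h5 : Real.exp (-(u ^ 2 / 4)) ^ k ≤ Real.exp (-(((k + 1 : ℕ) : ℝ) / 8) * u ^ 2) := by
      rw [← Real.exp_nat_mul]
      refine Real.exp_le_exp.2 ?_
      push_cast at hn2 ⊢
      nlinarith [sq_nonneg u]
    -- half of the Gaussian decay is traded against the cubic factor
    have h6 : |u| ^ 3 ≤ 128 / Real.sqrt ((k + 1 : ℕ) : ℝ) ^ 3 *
        Real.exp (((k + 1 : ℕ) : ℝ) / 16 * u ^ 2) := by
      have := cube_le_two_mul_exp_sq (Real.sqrt ((k + 1 : ℕ) : ℝ) * |u| / 4)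
      have e : (Real.sqrt ((k + 1 : ℕ) : ℝ) * |u| / 4) ^ 2 = ((k + 1 : ℕ) : ℝ) / 16 * u ^ 2 := by
        rw [div_pow, mul_pow, Real.sq_sqrt hn0.le, sq_abs]; ring
      rw [e] at this
      rw [div_mul_eq_mul_div, le_div_iff₀ (by positivity)]
      nlinarith
    have h7 : ((k : ℝ) + 1) * Real.exp (-(u ^ 2 / 4)) ^ k *
        ‖charFun μ u - Complex.exp (-((u : ℂ) ^ 2 / 2))‖ ≤
        640 * K / Real.sqrt ((k + 1 : ℕ) : ℝ) *
          Real.exp (-(((k + 1 : ℕ) : ℝ) / 16 : ℝ) * u ^ 2) := by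
      calc _ ≤ ((k : ℝ) + 1) * Real.exp (-(((k + 1 : ℕ) : ℝ) / 8) * u ^ 2) *
            (5 * K * (128 / Real.sqrt ((k + 1 : ℕ) : ℝ) ^ 3 *
              Real.exp (((k + 1 : ℕ) : ℝ) / 16 * u ^ 2))) := by
            refine mul_le_mul (mul_le_mul_of_nonneg_left h5 (by positivity)) (h1.trans ?_)
              (norm_nonneg _) (by positivity)
            exact mul_le_mul_of_nonneg_left h6 (by positivity)
        _ = 640 * K * (((k : ℝ) + 1) / Real.sqrt ((k + 1 : ℕ) : ℝ) ^ 3) *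
            (Real.exp (-(((k + 1 : ℕ) : ℝ) / 8) * u ^ 2) *
              Real.exp (((k + 1 : ℕ) : ℝ) / 16 * u ^ 2)) := by ring
        _ = _ := by
          rw [← Real.exp_add]
          have e1 : ((k : ℝ) + 1) / Real.sqrt ((k + 1 : ℕ) : ℝ) ^ 3 =
              1 / Real.sqrt ((k + 1 : ℕ) : ℝ) := by
            have : ((k : ℝ) + 1) = Real.sqrt ((k + 1 : ℕ) : ℝ) ^ 2 := by
              rw [Real.sq_sqrt hn0.le]; push_cast; rfl
            rw [this]
            field_simp
          rw [e1]
          ring_nf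
    linarith
  · have h1 := hρ u hu
    have h2 : ‖charFun μ u ^ n‖ ≤ r ^ n / r ^ 2 * ‖charFun μ u‖ ^ 2 := by
      obtain ⟨k, rfl⟩ : ∃ k, n = k + 2 := ⟨n - 2, by omega⟩
      rw [norm_pow, pow_add, pow_add, mul_div_assoc, div_self (by positivity), mul_one]
      exact mul_le_mul_of_nonneg_right (pow_le_pow_left₀ (norm_nonneg _) h1 k) (by positivity)
    have h3 : ‖Complex.exp (-((n : ℂ) * u ^ 2 / 2))‖ ≤
        Real.exp (-(n * δ ^ 2 / 4)) * Real.exp (-(1 / 4 : ℝ) * u ^ 2) := by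
      rw [hexp, norm_pow, hnexp, ← Real.exp_nat_mul, ← Real.exp_add]
      refine Real.exp_le_exp.2 ?_
      have : δ ^ 2 ≤ u ^ 2 := by
        rw [← sq_abs u]; exact pow_le_pow_left₀ hδ0.le hu 2
      nlinarith [sq_nonneg u]
    have := norm_sub_le (charFun μ u ^ n) (Complex.exp (-((n : ℂ) * u ^ 2 / 2)))
    linarith

/-- **Uniform local limit theorem.** Over all densities bounded by `K` with mean `0`, variance `1`
and absolute third moment at most `K`, the density of the sum of `n` independent copies is
uniformly close to the Gaussian density, to a precision `o(1 / √n)`. -/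
theorem exists_forall_abs_sumDensity_sub_le (K : ℝ) {ε : ℝ} (hε : 0 < ε) :
    ∃ N : ℕ, ∀ f : ℝ → ℝ, Measurable f → (∀ x, 0 ≤ f x) → (∀ x, f x ≤ K) → IsStdLaw K (lawOf f) →
      ∀ n : ℕ, N ≤ n → ∀ y : ℝ, |Real.sqrt n * sumDensity f n y -
        (Real.sqrt (2 * Real.pi))⁻¹ * Real.exp (-(y ^ 2 / (2 * n)))| ≤ ε := by
  by_cases hK : 1 ≤ K
  swap
  · exact ⟨0, fun f _ _ _ h => absurd h.one_le hK⟩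
  have hpi := Real.pi_pos
  obtain ⟨ρ, hρ0, hρ1, hρ⟩ := exists_norm_charFun_le_of_le_abs K
    (show 0 < 1 / (16 * K) by positivity)
  set r := max ρ (1 / 2) with hr
  have hr0 : 0 < r := lt_of_lt_of_le (by norm_num) (le_max_right _ _)
  have hr1 : r < 1 := max_lt hρ1 (by norm_num)
  set b : ℕ → ℝ := fun n => Real.sqrt n * (640 * K / Real.sqrt n * Real.sqrt (Real.pi / (n / 16)) +
      r ^ n / r ^ 2 * (2 * Real.pi * K) +
      Real.exp (-(n * (1 / (16 * K)) ^ 2 / 4)) * Real.sqrt (Real.pi / (1 / 4))) with hb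
  have hgeo : ∀ s : ℝ, 0 ≤ s → s < 1 → Tendsto (fun n : ℕ => Real.sqrt n * s ^ n) atTop (𝓝 0) := by
    intro s hs0 hs1
    refine squeeze_zero (fun n => by positivity) (fun n => ?_)
      (tendsto_self_mul_const_pow_of_lt_one hs0 hs1)
    refine mul_le_mul_of_nonneg_right ?_ (by positivity)
    rw [Real.sqrt_le_left (by positivity)]
    rcases Nat.eq_zero_or_pos n with h | h
    · simp [h]
    · have : (1 : ℝ) ≤ n := by exact_mod_cast h
      nlinarith
  have hlim : Tendsto b atTop (𝓝 0) := by
    have t1 : Tendsto (fun n : ℕ => 640 * K * Real.sqrt (Real.pi / ((n : ℝ) / 16))) atTop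
        (𝓝 (640 * K * Real.sqrt 0)) := by
      refine (Tendsto.sqrt ?_).const_mul _
      refine Tendsto.const_div_atTop ?_ _
      exact (tendsto_natCast_atTop_atTop).atTop_div_const (by norm_num)
    have t2 := (hgeo r hr0.le hr1).mul_const (1 / r ^ 2 * (2 * Real.pi * K))
    have t3 := (hgeo (Real.exp (-((1 / (16 * K)) ^ 2 / 4))) (Real.exp_pos _).le
      (by rw [Real.exp_lt_one_iff]; simp only [Left.neg_neg_iff]; positivity)).mul_const
        (Real.sqrt (Real.pi / (1 / 4)))
    have := (t1.add t2).add t3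
    simp only [Real.sqrt_zero, mul_zero, zero_mul, add_zero] at this
    refine this.congr' ?_
    filter_upwards [eventually_gt_atTop 0] with n hn
    have hs : 0 < Real.sqrt n := Real.sqrt_pos.2 (by exact_mod_cast hn)
    rw [hb]
    simp only
    rw [← Real.exp_nat_mul]
    have : (n : ℝ) * -((1 / (16 * K)) ^ 2 / 4) = -(n * (1 / (16 * K)) ^ 2 / 4) := by ring
    rw [this]
    field_simp
  obtain ⟨N, hN⟩ := eventually_atTop.1 (hlim.eventually (eventually_le_nhds hε))
  refine ⟨max N 2, fun f hf hf0 hfK h n hn y => ?_⟩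
  have hn2 : 2 ≤ n := (le_max_right _ _).trans hn
  have hnN : N ≤ n := (le_max_left _ _).trans hn
  have hn0 : (0 : ℝ) < n := by positivity
  have hs : 0 < Real.sqrt n := Real.sqrt_pos.2 hn0
  refine le_trans ?_ (hN n hnN)
  have := h.prob
  set μ := lawOf f with hμ
  set D : ℝ → ℝ := fun u => 640 * K / Real.sqrt n * Real.exp (-(n / 16 : ℝ) * u ^ 2) +
      r ^ n / r ^ 2 * ‖charFun μ u‖ ^ 2 +
      Real.exp (-(n * (1 / (16 * K)) ^ 2 / 4)) * Real.exp (-(1 / 4 : ℝ) * u ^ 2) with hD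
  have hbound : ∀ u, ‖charFun μ u ^ n - Complex.exp (-((n : ℂ) * u ^ 2 / 2))‖ ≤ D u :=
    h.norm_charFun_pow_sub_le hr0 (fun u hu => (hρ μ h u hu).trans (le_max_left _ _)) hn2
  have i1 : Integrable fun u : ℝ => Real.exp (-(n / 16 : ℝ) * u ^ 2) :=
    integrable_exp_neg_mul_sq (by positivity)
  have i3 : Integrable fun u : ℝ => Real.exp (-(1 / 4 : ℝ) * u ^ 2) :=
    integrable_exp_neg_mul_sq (by positivity)
  have i2 := h.integrable_norm_charFun_sq
  have i12 := (i1.const_mul (640 * K / Real.sqrt n)).add (i2.const_mul (r ^ n / r ^ 2))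
  have hDi : Integrable D := i12.add (i3.const_mul _)
  have hDint : ∫ u, D u ≤ 640 * K / Real.sqrt n * Real.sqrt (Real.pi / (n / 16)) +
      r ^ n / r ^ 2 * (2 * Real.pi * K) +
      Real.exp (-(n * (1 / (16 * K)) ^ 2 / 4)) * Real.sqrt (Real.pi / (1 / 4)) := by
    have e : ∫ u, D u = 640 * K / Real.sqrt n * Real.sqrt (Real.pi / (n / 16)) +
      r ^ n / r ^ 2 * (∫ u, ‖charFun μ u‖ ^ 2) +
      Real.exp (-(n * (1 / (16 * K)) ^ 2 / 4)) * Real.sqrt (Real.pi / (1 / 4)) := by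
      rw [hD, integral_add (by exact i12) (i3.const_mul _),
        integral_add (i1.const_mul _) (i2.const_mul _), integral_const_mul, integral_const_mul,
        integral_const_mul, integral_gaussian, integral_gaussian]
    rw [e]
    have := mul_le_mul_of_nonneg_left h.integral_norm_charFun_sq_le
      (show 0 ≤ r ^ n / r ^ 2 by positivity)
    linarith
  -- both densities are represented by the inversion formula
  have hgi : Integrable fun u : ℝ => Complex.exp (-((n : ℂ) * u ^ 2 / 2)) := by
    have := (integrable_exp_neg_mul_sq (b := (n / 2 : ℝ)) (by positivity)).ofReal (𝕜 := ℂ)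
    refine this.congr (Eventually.of_forall fun u => ?_)
    simp only [Complex.coe_algebraMap]
    push_cast
    ring_nf
  have hdiff : Integrable fun u : ℝ => charFun μ u ^ n - Complex.exp (-((n : ℂ) * u ^ 2 / 2)) := by
    refine hDi.mono' ?_ (Eventually.of_forall hbound)
    exact ((continuous_charFun.pow n).sub (by fun_prop)).aestronglyMeasurable
  have hφi : Integrable fun u : ℝ => charFun μ u ^ n := by
    refine (hdiff.add hgi).congr (Eventually.of_forall fun u => ?_)
    simp
  obtain ⟨k, rfl⟩ : ∃ k, n = k + 2 := ⟨n - 2, by omega⟩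
  have hprob := isProbabilityMeasure_lawOf_sumDensity hf hf0 (k + 1)
  have hcf : charFun (lawOf (sumDensity f (k + 2))) = fun u => charFun μ u ^ (k + 2) :=
    funext fun u => charFun_lawOf_sumDensity hf hf0 (k + 1) u
  have inv1 := density_eq_integral_charFun (continuous_sumDensity hf hf0 hfK k)
    (sumDensity_nonneg hf0 _) (by rw [hcf]; exact hφi) y
  set v : NNReal := ((k + 2 : ℕ) : NNReal) with hv
  have hv0 : v ≠ 0 := by rw [hv]; positivity
  have hvr : (v : ℝ) = ((k + 2 : ℕ) : ℝ) := by rw [hv]; simp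
  have hlaw : lawOf (gaussianPDFReal 0 v) = gaussianReal 0 v := by
    rw [gaussianReal_of_var_ne_zero _ hv0]; rfl
  have hprob2 : IsFiniteMeasure (lawOf (gaussianPDFReal 0 v)) := by rw [hlaw]; infer_instance
  have hcf2 : charFun (lawOf (gaussianPDFReal 0 v)) =
      fun u : ℝ => Complex.exp (-(((k + 2 : ℕ) : ℂ) * u ^ 2 / 2)) := by
    funext u
    rw [hlaw, charFun_gaussianReal]
    have : ((v : ℝ) : ℂ) = ((k + 2 : ℕ) : ℂ) := by rw [hvr]; norm_cast
    rw [this]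
    simp
  have inv2 := density_eq_integral_charFun (F := gaussianPDFReal 0 v)
    (by unfold gaussianPDFReal; fun_prop)
    (gaussianPDFReal_nonneg 0 v) (by rw [hcf2]; exact hgi) y
  have hg : Real.sqrt ((k + 2 : ℕ) : ℝ) * gaussianPDFReal 0 v y =
      (Real.sqrt (2 * Real.pi))⁻¹ * Real.exp (-(y ^ 2 / (2 * ((k + 2 : ℕ) : ℝ)))) := by
    rw [gaussianPDFReal, hvr, Real.sqrt_mul (by positivity), mul_inv]
    have : -(y - 0) ^ 2 / (2 * ((k + 2 : ℕ) : ℝ)) = -(y ^ 2 / (2 * ((k + 2 : ℕ) : ℝ))) := by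
      ring
    rw [this]
    field_simp
  rw [← hg, ← mul_sub, abs_mul, abs_of_pos hs]
  refine mul_le_mul_of_nonneg_left ?_ hs.le
  refine le_trans ?_ hDint
  have e : ((sumDensity f (k + 2) y - gaussianPDFReal 0 v y : ℝ) : ℂ) = (2 * Real.pi : ℂ)⁻¹ *
      ∫ u : ℝ, Complex.exp (-(u * y * Complex.I)) *
        (charFun μ u ^ (k + 2) - Complex.exp (-(((k + 2 : ℕ) : ℂ) * u ^ 2 / 2))) := by
    push_cast
    rw [inv1, inv2, hcf, hcf2, ← mul_sub, ← integral_sub]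
    · simp only [mul_sub]
      push_cast
      rfl
    · refine hφi.bdd_mul (c := 1) (by fun_prop) (Eventually.of_forall fun u => ?_)
      rw [← Complex.ofReal_mul, ← neg_mul, ← Complex.ofReal_neg, Complex.norm_exp_ofReal_mul_I]
    · refine hgi.bdd_mul (c := 1) (by fun_prop) (Eventually.of_forall fun u => ?_)
      rw [← Complex.ofReal_mul, ← neg_mul, ← Complex.ofReal_neg, Complex.norm_exp_ofReal_mul_I]
  rw [← Real.norm_eq_abs, ← Complex.norm_real, e, norm_mul]
  have h2pi : ‖(2 * Real.pi : ℂ)⁻¹‖ ≤ 1 := by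
    rw [norm_inv, norm_mul, Complex.norm_real, Complex.norm_ofNat, Real.norm_of_nonneg hpi.le]
    refine inv_le_one_of_one_le₀ ?_
    linarith [Real.pi_gt_three]
  refine (mul_le_of_le_one_left (norm_nonneg _) h2pi).trans ?_
  refine norm_integral_le_of_norm_le hDi (Eventually.of_forall fun u => ?_)
  rw [norm_mul, ← Complex.ofReal_mul, ← neg_mul, ← Complex.ofReal_neg,
    Complex.norm_exp_ofReal_mul_I, one_mul]
  exact hbound u

/-! ### Exponential tilting of a density -/

/-- A bounded probability density with finite exponential moments of every order. -/
structure IsLightTailed (p : ℝ → ℝ) : Prop where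
  meas : Measurable p
  nonneg : ∀ x, 0 ≤ p x
  bdd : ∃ B, ∀ x, p x ≤ B
  integral_eq_one : ∫ x, p x = 1
  integrable_exp : ∀ t : ℝ, Integrable fun x => Real.exp (t * x) * p x

/-- The moment generating function of the density `p`. -/
def tiltMass (p : ℝ → ℝ) (t : ℝ) : ℝ := ∫ x, Real.exp (t * x) * p x

/-- The expectation of `φ` under the exponentially tilted law, of density proportional to
`x ↦ exp (t x) p x`. -/
def tiltExp (p : ℝ → ℝ) (t : ℝ) (φ : ℝ → ℝ) : ℝ :=
  (∫ x, φ x * (Real.exp (t * x) * p x)) / tiltMass p t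

theorem integral_exp_neg_abs_div {w : ℝ} (hw : 0 < w) :
    ∫ x : ℝ, Real.exp (-(|x| / w)) = 2 * w := by
  rw [integral_comp_abs (f := fun x => Real.exp (-(x / w)))]
  have : (fun x : ℝ => Real.exp (-(x / w))) = fun x => Real.exp (-(1 / w) * x) := by
    funext x; congr 1; ring
  rw [this, integral_exp_mul_Ioi (by simp only [Left.neg_neg_iff]; positivity)]
  simp

theorem integrable_exp_neg_abs_div {w : ℝ} (hw : 0 < w) :
    Integrable fun x : ℝ => Real.exp (-(|x| / w)) :=
  Integrable.of_integral_ne_zero (by rw [integral_exp_neg_abs_div hw]; positivity)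

theorem integral_lawOf {p : ℝ → ℝ} (hp : Measurable p) (hp0 : ∀ x, 0 ≤ p x) (φ : ℝ → ℝ) :
    ∫ x, φ x ∂(lawOf p) = ∫ x, φ x * p x := by
  rw [lawOf, integral_withDensity_eq_integral_toReal_smul (by fun_prop)
    (Eventually.of_forall fun x => ENNReal.ofReal_lt_top)]
  refine integral_congr_ae (Eventually.of_forall fun x => ?_)
  simp only [ENNReal.toReal_ofReal (hp0 x), smul_eq_mul]
  ring

theorem integrable_lawOf_iff {p : ℝ → ℝ} (hp : Measurable p) (hp0 : ∀ x, 0 ≤ p x) (φ : ℝ → ℝ) :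
    Integrable φ (lawOf p) ↔ Integrable fun x => φ x * p x := by
  rw [lawOf, integrable_withDensity_iff (by fun_prop)
    (Eventually.of_forall fun x => ENNReal.ofReal_lt_top)]
  simp only [ENNReal.toReal_ofReal (hp0 _)]

theorem isProbabilityMeasure_lawOf {p : ℝ → ℝ} (hp0 : ∀ x, 0 ≤ p x)
    (h1 : ∫ x, p x = 1) : IsProbabilityMeasure (lawOf p) := by
  have hi : Integrable p := Integrable.of_integral_ne_zero (by rw [h1]; exact one_ne_zero)
  refine ⟨?_⟩
  rw [lawOf, withDensity_apply _ MeasurableSet.univ, setLIntegral_univ,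
    ← ofReal_integral_eq_lintegral_ofReal hi (Eventually.of_forall hp0), h1, ENNReal.ofReal_one]

/-- Change of variables under an increasing affine map. -/
theorem integral_comp_add_mul {s : ℝ} (hs : 0 < s) (m : ℝ) (φ : ℝ → ℝ) :
    ∫ z, φ (m + s * z) = s⁻¹ * ∫ x, φ x := by
  have := Measure.integral_comp_mul_left (fun y => φ (m + y)) s
  rw [this, abs_of_pos (inv_pos.2 hs), smul_eq_mul, integral_add_left_eq_self]

namespace IsLightTailed

variable {p : ℝ → ℝ} (h : IsLightTailed p)
include h

theorem isProb : IsProbabilityMeasure (lawOf p) :=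
  isProbabilityMeasure_lawOf h.nonneg h.integral_eq_one

theorem integrableExpSet_eq : integrableExpSet id (lawOf p) = univ := by
  refine eq_univ_of_forall fun t => ?_
  rw [integrableExpSet, mem_ofPred_eq, integrable_lawOf_iff h.meas h.nonneg]
  exact h.integrable_exp t

theorem mem_interior (t : ℝ) : t ∈ interior (integrableExpSet id (lawOf p)) := by
  rw [h.integrableExpSet_eq, interior_univ]; exact mem_univ t

theorem mgf_eq (t : ℝ) : mgf id (lawOf p) t = tiltMass p t := by
  rw [mgf, integral_lawOf h.meas h.nonneg]; rfl

theorem tiltMass_pos (t : ℝ) : 0 < tiltMass p t := by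
  have := h.isProb
  rw [← h.mgf_eq]
  refine mgf_pos ?_
  rw [integrable_lawOf_iff h.meas h.nonneg]
  exact h.integrable_exp t

theorem cgf_eq (t : ℝ) : cgf id (lawOf p) t = Real.log (tiltMass p t) := by
  rw [cgf, h.mgf_eq]

theorem integrable_mul_tilt {φ : ℝ → ℝ} (hφ : Measurable φ) {A : ℝ}
    (hA : ∀ x, |φ x| ≤ A * (Real.exp x + Real.exp (-x))) (t : ℝ) :
    Integrable fun x => φ x * (Real.exp (t * x) * p x) := by
  have hm := h.meas
  refine (((h.integrable_exp (t + 1)).add (h.integrable_exp (t - 1))).const_mul A).mono'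
    (by fun_prop) (Eventually.of_forall fun x => ?_)
  have h0 : 0 ≤ Real.exp (t * x) * p x := mul_nonneg (Real.exp_pos _).le (h.nonneg x)
  rw [norm_mul, Real.norm_eq_abs, Real.norm_of_nonneg h0]
  refine (mul_le_mul_of_nonneg_right (hA x) h0).trans (le_of_eq ?_)
  have e1 : Real.exp ((t + 1) * x) = Real.exp x * Real.exp (t * x) := by
    rw [← Real.exp_add]; ring_nf
  have e2 : Real.exp ((t - 1) * x) = Real.exp (-x) * Real.exp (t * x) := by
    rw [← Real.exp_add]; ring_nf
  simp only [Pi.add_apply, e1, e2]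
  ring

omit h in
theorem abs_sub_pow_le (c x : ℝ) (n : ℕ) :
    |x - c| ^ n ≤ (n.factorial * Real.exp |c|) * (Real.exp x + Real.exp (-x)) := by
  have h1 := Real.pow_div_factorial_le_exp |x - c| (abs_nonneg _) n
  rw [div_le_iff₀ (by positivity)] at h1
  have h2 : Real.exp |x - c| ≤ Real.exp |c| * (Real.exp x + Real.exp (-x)) := by
    have : |x - c| ≤ |c| + |x| := by rw [add_comm]; exact abs_sub _ _
    refine (Real.exp_le_exp.2 this).trans ?_
    rw [Real.exp_add]
    refine mul_le_mul_of_nonneg_left ?_ (Real.exp_pos _).le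
    rcases le_total 0 x with hx | hx
    · rw [abs_of_nonneg hx]; linarith [Real.exp_pos (-x)]
    · rw [abs_of_nonpos hx]; linarith [Real.exp_pos x]
  have : (0 : ℝ) ≤ n.factorial := by positivity
  nlinarith

theorem integrable_sub_pow (c t : ℝ) (n : ℕ) :
    Integrable fun x => (x - c) ^ n * (Real.exp (t * x) * p x) :=
  h.integrable_mul_tilt (by fun_prop) (fun x => by rw [abs_pow]; exact abs_sub_pow_le c x n) t

theorem integrable_abs_sub_pow (c t : ℝ) (n : ℕ) :
    Integrable fun x => |x - c| ^ n * (Real.exp (t * x) * p x) :=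
  h.integrable_mul_tilt (by fun_prop)
    (fun x => by rw [abs_pow, abs_abs]; exact abs_sub_pow_le c x n) t

theorem tiltExp_mono {t : ℝ} {φ ψ : ℝ → ℝ}
    (hφ : Integrable fun x => φ x * (Real.exp (t * x) * p x))
    (hψ : Integrable fun x => ψ x * (Real.exp (t * x) * p x)) (hle : ∀ x, φ x ≤ ψ x) :
    tiltExp p t φ ≤ tiltExp p t ψ :=
  div_le_div_of_nonneg_right (integral_mono hφ hψ fun x => mul_le_mul_of_nonneg_right (hle x)
    (mul_nonneg (Real.exp_pos _).le (h.nonneg x))) (h.tiltMass_pos t).le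

theorem tiltExp_const (t c : ℝ) : tiltExp p t (fun _ => c) = c := by
  rw [tiltExp, integral_const_mul]
  exact mul_div_cancel_right₀ c (h.tiltMass_pos t).ne'

omit h in
theorem tiltExp_add {t : ℝ} {φ ψ : ℝ → ℝ}
    (hφ : Integrable fun x => φ x * (Real.exp (t * x) * p x))
    (hψ : Integrable fun x => ψ x * (Real.exp (t * x) * p x)) :
    tiltExp p t (fun x => φ x + ψ x) = tiltExp p t φ + tiltExp p t ψ := by
  rw [tiltExp, tiltExp, tiltExp, ← add_div, ← integral_add hφ hψ]
  simp only [add_mul]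

omit h in
theorem integrable_add_tilt {t : ℝ} {φ ψ : ℝ → ℝ}
    (hφ : Integrable fun x => φ x * (Real.exp (t * x) * p x))
    (hψ : Integrable fun x => ψ x * (Real.exp (t * x) * p x)) :
    Integrable fun x => (φ x + ψ x) * (Real.exp (t * x) * p x) := by
  simp only [add_mul]
  exact hφ.add hψ

omit h in
theorem integrable_const_mul_tilt {t : ℝ} {φ : ℝ → ℝ} (c : ℝ)
    (hφ : Integrable fun x => φ x * (Real.exp (t * x) * p x)) :
    Integrable fun x => (c * φ x) * (Real.exp (t * x) * p x) := by
  simp only [mul_assoc]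
  exact hφ.const_mul c

omit h in
theorem tiltExp_const_mul (t c : ℝ) (φ : ℝ → ℝ) :
    tiltExp p t (fun x => c * φ x) = c * tiltExp p t φ := by
  rw [tiltExp, tiltExp, ← mul_div_assoc, ← integral_const_mul]
  simp only [mul_assoc]

theorem abs_tiltExp_le (t : ℝ) (φ : ℝ → ℝ) :
    |tiltExp p t φ| ≤ tiltExp p t (fun x => |φ x|) := by
  rw [tiltExp, tiltExp, abs_div, abs_of_pos (h.tiltMass_pos t)]
  refine div_le_div_of_nonneg_right ?_ (h.tiltMass_pos t).le
  rw [← Real.norm_eq_abs]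
  refine (norm_integral_le_integral_norm _).trans (le_of_eq ?_)
  refine integral_congr_ae (Eventually.of_forall fun x => ?_)
  simp only [norm_mul, Real.norm_eq_abs, Real.abs_exp, abs_of_nonneg (h.nonneg x)]

theorem integral_pow_lawOf (t : ℝ) (n : ℕ) :
    ∫ x, id x ^ n * Real.exp (t * id x) ∂(lawOf p) = ∫ x, x ^ n * (Real.exp (t * x) * p x) := by
  rw [integral_lawOf h.meas h.nonneg]
  simp only [id, mul_assoc]

theorem tiltMean_eq (t : ℝ) : tiltMean p t = tiltExp p t (fun x => x) := by
  rw [tiltMean, logMgfDeriv, iteratedDeriv_one, deriv_cgf (h.mem_interior t), h.mgf_eq, tiltExp]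
  congr 1
  simpa using h.integral_pow_lawOf t 1

theorem tiltExp_sub_const (t c : ℝ) : tiltExp p t (fun x => x - c) = tiltMean p t - c := by
  have e1 := tiltExp_add (p := p) (t := t) (φ := fun x => x) (ψ := fun _ => -c)
    (by simpa using h.integrable_sub_pow 0 t 1) ((h.integrable_exp t).const_mul (-c))
  rw [h.tiltExp_const, ← h.tiltMean_eq] at e1
  rw [sub_eq_add_neg, ← e1]
  simp only [sub_eq_add_neg]

theorem tiltVar_eq (t : ℝ) : tiltVar p t = tiltExp p t (fun x => (x - tiltMean p t) ^ 2) := by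
  rw [tiltVar, logMgfDeriv, iteratedDeriv_two_cgf_eq_integral (h.mem_interior t), h.mgf_eq,
    tiltExp, integral_lawOf h.meas h.nonneg]
  simp only [id, mul_assoc, tiltMean, logMgfDeriv, iteratedDeriv_one]

theorem hasDerivAt_logMgfDeriv (j : ℕ) (t : ℝ) :
    HasDerivAt (logMgfDeriv p j) (logMgfDeriv p (j + 1) t) t := by
  have ha := (analyticOnNhd_cgf (X := id) (μ := lawOf p)).iterated_deriv j t (h.mem_interior t)
  rw [← iteratedDeriv_eq_iterate] at ha
  have := ha.differentiableAt.hasDerivAt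
  rw [← iteratedDeriv_succ] at this
  exact this

theorem hasDerivAt_log_tiltMass (t : ℝ) :
    HasDerivAt (fun t => Real.log (tiltMass p t)) (tiltMean p t) t := by
  have := h.hasDerivAt_logMgfDeriv 0 t
  refine this.congr_of_eventuallyEq (Eventually.of_forall fun u => ?_)
  simp only [logMgfDeriv, iteratedDeriv_zero, h.cgf_eq]

theorem hasDerivAt_tiltMean (t : ℝ) : HasDerivAt (tiltMean p) (tiltVar p t) t :=
  h.hasDerivAt_logMgfDeriv 1 t

theorem hasDerivAt_tiltVar (t : ℝ) : HasDerivAt (tiltVar p) (tiltThird p t) t :=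
  h.hasDerivAt_logMgfDeriv 2 t

theorem tiltThird_eq (t : ℝ) : tiltThird p t = tiltExp p t (fun x => (x - tiltMean p t) ^ 3) := by
  set M : ℕ → ℝ → ℝ := fun j t => ∫ x, id x ^ j * Real.exp (t * id x) ∂(lawOf p) with hM
  have hd : ∀ j, HasDerivAt (M j) (M (j + 1) t) t := fun j =>
    hasDerivAt_integral_pow_mul_exp_real (h.mem_interior t) j
  have hMeq : ∀ j, M j t = ∫ x, x ^ j * (Real.exp (t * x) * p x) :=
    fun j => h.integral_pow_lawOf t j
  have hM0 : M 0 t = tiltMass p t := by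
    rw [hMeq]; simp only [pow_zero, one_mul]; rfl
  have hM0' := h.tiltMass_pos t
  have hvar : tiltVar p = fun v => M 2 v / M 0 v - tiltMean p v ^ 2 := by
    funext v
    have h0 : M 0 v = mgf id (lawOf p) v := by
      rw [hM]; simp [mgf]
    rw [tiltVar, logMgfDeriv, iteratedDeriv_two_cgf (h.mem_interior v), tiltMean, logMgfDeriv,
      iteratedDeriv_one, h0]
  have hmean : tiltMean p t = M 1 t / M 0 t := by
    rw [h.tiltMean_eq, tiltExp, hM0, hMeq]
    simp only [pow_one]
  have h1 := ((hd 2).div (hd 0) (by rw [hM0]; exact hM0'.ne')).sub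
    ((h.hasDerivAt_tiltMean t).pow 2)
  have h2 := h.hasDerivAt_tiltVar t
  have h3 : tiltThird p t = (M 3 t * M 0 t - M 2 t * M 1 t) / M 0 t ^ 2 -
      2 * tiltMean p t * tiltVar p t := by
    have h4 : HasDerivAt (tiltVar p) ((M 3 t * M 0 t - M 2 t * M 1 t) / M 0 t ^ 2 -
      2 * tiltMean p t * tiltVar p t) t := by
      refine (h1.congr_of_eventuallyEq
        (Eventually.of_forall fun v => congrFun hvar v)).congr_deriv ?_
      simp
    exact h2.unique h4
  have h5 : tiltExp p t (fun x => (x - tiltMean p t) ^ 3) =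
      (M 3 t - 3 * tiltMean p t * M 2 t + 3 * tiltMean p t ^ 2 * M 1 t -
        tiltMean p t ^ 3 * M 0 t) / M 0 t := by
    rw [tiltExp, ← hM0]
    congr 1
    have i : ∀ n, Integrable fun x => x ^ n * (Real.exp (t * x) * p x) := fun n => by
      simpa using h.integrable_sub_pow 0 t n
    set c := tiltMean p t
    have e : ∀ x, (x - c) ^ 3 * (Real.exp (t * x) * p x) =
        x ^ 3 * (Real.exp (t * x) * p x) - 3 * c * (x ^ 2 * (Real.exp (t * x) * p x)) +
        3 * c ^ 2 * (x ^ 1 * (Real.exp (t * x) * p x)) -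
        c ^ 3 * (x ^ 0 * (Real.exp (t * x) * p x)) := fun x => by ring
    simp_rw [e]
    have i2 := (i 2).const_mul (3 * c)
    have i1 := (i 1).const_mul (3 * c ^ 2)
    have i0 := (i 0).const_mul (c ^ 3)
    have i32 : Integrable fun x => x ^ 3 * (Real.exp (t * x) * p x) -
        3 * c * (x ^ 2 * (Real.exp (t * x) * p x)) := (i 3).sub i2
    have i321 : Integrable fun x => x ^ 3 * (Real.exp (t * x) * p x) -
        3 * c * (x ^ 2 * (Real.exp (t * x) * p x)) +
        3 * c ^ 2 * (x ^ 1 * (Real.exp (t * x) * p x)) := i32.add i1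
    rw [integral_sub i321 i0, integral_add i32 i1, integral_sub (i 3) i2, integral_const_mul,
      integral_const_mul, integral_const_mul, ← hMeq, ← hMeq, ← hMeq, ← hMeq]
  rw [h3, h5, hvar, hmean, hM0]
  simp only [hmean, hM0]
  field_simp
  ring

end IsLightTailed

/-- The density of the standardized tilted law. -/
def stdTilt (p : ℝ → ℝ) (t z : ℝ) : ℝ :=
  Real.sqrt (tiltVar p t) * (Real.exp (t * (tiltMean p t + Real.sqrt (tiltVar p t) * z)) *
    p (tiltMean p t + Real.sqrt (tiltVar p t) * z)) / tiltMass p t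

namespace IsLightTailed

variable {p : ℝ → ℝ} (h : IsLightTailed p)
include h

theorem measurable_stdTilt (t : ℝ) : Measurable (stdTilt p t) := by
  have := h.meas
  unfold stdTilt
  fun_prop

theorem stdTilt_nonneg (t z : ℝ) : 0 ≤ stdTilt p t z :=
  div_nonneg (mul_nonneg (Real.sqrt_nonneg _) (mul_nonneg (Real.exp_pos _).le (h.nonneg _)))
    (h.tiltMass_pos t).le

omit h in
theorem integral_mul_stdTilt {t : ℝ} (hv : 0 < tiltVar p t) (φ : ℝ → ℝ) :
    ∫ z, φ z * stdTilt p t z =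
      tiltExp p t (fun x => φ ((x - tiltMean p t) / Real.sqrt (tiltVar p t))) := by
  set s := Real.sqrt (tiltVar p t) with hs
  have hs0 : 0 < s := Real.sqrt_pos.2 hv
  have := integral_comp_add_mul hs0 (tiltMean p t)
    (fun x => φ ((x - tiltMean p t) / s) * (s * (Real.exp (t * x) * p x) / tiltMass p t))
  have e : ∀ z, φ z * stdTilt p t z = φ ((tiltMean p t + s * z - tiltMean p t) / s) *
      (s * (Real.exp (t * (tiltMean p t + s * z)) * p (tiltMean p t + s * z)) / tiltMass p t) := by
    intro z
    rw [add_sub_cancel_left, mul_div_cancel_left₀ _ hs0.ne', stdTilt]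
  simp_rw [e]
  rw [this, tiltExp, ← integral_const_mul, ← integral_div]
  refine integral_congr_ae (Eventually.of_forall fun x => ?_)
  simp only
  field_simp

/-- Tilting and standardizing commute with taking convolution powers. -/
theorem sumDensity_stdTilt {t : ℝ} (hv : 0 < tiltVar p t) (n : ℕ) (z : ℝ) :
    sumDensity (stdTilt p t) (n + 1) z = Real.sqrt (tiltVar p t) *
      Real.exp (t * ((n + 1) * tiltMean p t + Real.sqrt (tiltVar p t) * z)) *
      sumDensity p (n + 1) ((n + 1) * tiltMean p t + Real.sqrt (tiltVar p t) * z) /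
      tiltMass p t ^ (n + 1) := by
  have hs0 : 0 < Real.sqrt (tiltVar p t) := Real.sqrt_pos.2 hv
  have hΦ := h.tiltMass_pos t
  set s := Real.sqrt (tiltVar p t) with hs
  set m := tiltMean p t with hm
  induction n generalizing z with
  | zero =>
    simp only [sumDensity, stdTilt]
    rw [← hs, ← hm]
    simp only [Nat.cast_zero, zero_add, one_mul, pow_one]
    ring
  | succ n ih =>
    simp only [sumDensity]
    set ψ : ℝ → ℝ := fun x => s ^ 2 * Real.exp (t * (((n + 1 : ℕ) + 1) * m + s * z)) /
      tiltMass p t ^ (n + 2) * (p x * sumDensity p (n + 1) (((n + 1 : ℕ) + 1) * m + s * z - x))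
      with hψ
    have e : ∀ u, stdTilt p t u * sumDensity (stdTilt p t) (n + 1) (z - u) = ψ (m + s * u) := by
      intro u
      rw [ih, stdTilt, ← hs, ← hm, hψ]
      simp only
      have e1 : ((n + 1 : ℕ) + 1 : ℝ) * m + s * z - (m + s * u) =
          ((n : ℝ) + 1) * m + s * (z - u) := by push_cast; ring
      have e2 : Real.exp (t * (((n + 1 : ℕ) + 1) * m + s * z)) =
          Real.exp (t * (m + s * u)) * Real.exp (t * (((n : ℝ) + 1) * m + s * (z - u))) := by
        rw [← Real.exp_add]; push_cast; ring_nf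
      rw [e1, e2, pow_succ (tiltMass p t) (n + 1)]
      field_simp
    refine (integral_congr_ae (Eventually.of_forall e)).trans
      ((integral_comp_add_mul hs0 m ψ).trans ?_)
    rw [hψ, integral_const_mul]
    field_simp

end IsLightTailed

/-- The tilted density at `t` is bounded by a two-sided exponential density of centre `c` and
scale `w`, up to the factor `C`. -/
structure TiltEnvelope (p : ℝ → ℝ) (t C c w : ℝ) : Prop where
  one_le : 1 ≤ C
  pos : 0 < w
  le : ∀ x, Real.exp (t * x) * p x ≤ C / w * Real.exp (-(|x - c| / w)) * tiltMass p t

namespace TiltEnvelope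

variable {p : ℝ → ℝ} {t C c w : ℝ} (e : TiltEnvelope p t C c w) (h : IsLightTailed p)
include e h

theorem tiltExp_abs_pow_le (n : ℕ) :
    tiltExp p t (fun x => |x - c| ^ n) ≤ 4 * C * n.factorial * (2 * w) ^ n := by
  have hw := e.pos
  have hC := e.one_le
  have hΦ := h.tiltMass_pos t
  rw [tiltExp, div_le_iff₀ hΦ]
  have hi : Integrable fun x : ℝ => Real.exp (-(|x - c| / (2 * w))) :=
    (integrable_exp_neg_abs_div (show 0 < 2 * w by positivity)).comp_sub_right c
  calc ∫ x, |x - c| ^ n * (Real.exp (t * x) * p x)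
      ≤ ∫ x, (C / w * tiltMass p t * (n.factorial * (2 * w) ^ n)) *
          Real.exp (-(|x - c| / (2 * w))) := by
        refine integral_mono (h.integrable_abs_sub_pow c t n) (hi.const_mul _) fun x => ?_
        have h1 := e.le x
        have h2 := Real.pow_div_factorial_le_exp (|x - c| / (2 * w)) (by positivity) n
        rw [div_le_iff₀ (by positivity), div_pow, div_le_iff₀ (by positivity)] at h2
        have h3 : Real.exp (-(|x - c| / w)) =
            Real.exp (-(|x - c| / (2 * w))) * Real.exp (-(|x - c| / (2 * w))) := by
          rw [← Real.exp_add]; congr 1; field_simp; ring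
        have h4 : Real.exp (|x - c| / (2 * w)) * Real.exp (-(|x - c| / (2 * w))) = 1 := by
          rw [← Real.exp_add, add_neg_cancel, Real.exp_zero]
        calc |x - c| ^ n * (Real.exp (t * x) * p x)
            ≤ (Real.exp (|x - c| / (2 * w)) * n.factorial * (2 * w) ^ n) *
              (C / w * Real.exp (-(|x - c| / w)) * tiltMass p t) :=
              mul_le_mul h2 h1 (mul_nonneg (Real.exp_pos _).le (h.nonneg x)) (by positivity)
          _ = (C / w * tiltMass p t * (n.factorial * (2 * w) ^ n)) *
              (Real.exp (|x - c| / (2 * w)) * Real.exp (-(|x - c| / (2 * w)))) *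
              Real.exp (-(|x - c| / (2 * w))) := by rw [h3]; ring
          _ = _ := by rw [h4, mul_one]
    _ = 4 * C * n.factorial * (2 * w) ^ n * tiltMass p t := by
        rw [integral_const_mul, integral_sub_right_eq_self
          (fun x => Real.exp (-(|x| / (2 * w)))) c, integral_exp_neg_abs_div (by positivity)]
        field_simp
        ring

theorem abs_tiltMean_sub_le : |tiltMean p t - c| ≤ 8 * C * w := by
  rw [← h.tiltExp_sub_const]
  refine (h.abs_tiltExp_le t _).trans ?_
  have := e.tiltExp_abs_pow_le h 1
  simp only [pow_one, Nat.factorial_one, Nat.cast_one] at this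
  linarith

theorem tiltVar_le : tiltVar p t ≤ 32 * C * w ^ 2 := by
  have h1 := e.tiltExp_abs_pow_le h 2
  simp only [sq_abs] at h1
  have e2 : tiltExp p t (fun x => (x - c) ^ 2) =
      tiltVar p t + (tiltMean p t - c) ^ 2 := by
    set m := tiltMean p t with hm
    have e3 : (fun x => (x - c) ^ 2) = fun x =>
        (x - m) ^ 2 + (2 * (m - c) * (x - m) + (m - c) ^ 2) := by
      funext x; ring
    have i1 : Integrable fun x => (2 * (m - c) * (x - m)) * (Real.exp (t * x) * p x) :=
      IsLightTailed.integrable_const_mul_tilt _ (by simpa using h.integrable_sub_pow m t 1)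
    have i0 : Integrable fun x => ((m - c) ^ 2) * (Real.exp (t * x) * p x) :=
      (h.integrable_exp t).const_mul _
    rw [e3, IsLightTailed.tiltExp_add (h.integrable_sub_pow m t 2)
      (IsLightTailed.integrable_add_tilt i1 i0), IsLightTailed.tiltExp_add i1 i0,
      h.tiltExp_const, IsLightTailed.tiltExp_const_mul, h.tiltVar_eq, ← hm, h.tiltExp_sub_const,
      ← hm]
    ring
  rw [e2] at h1
  have h2 : (Nat.factorial 2 : ℝ) = 2 := by norm_num [Nat.factorial]
  rw [h2] at h1
  nlinarith [sq_nonneg (tiltMean p t - c)]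

/-- A density bounded by `C / w` cannot have a standard deviation much smaller than `w`. -/
theorem le_tiltVar : w ^ 2 / (32 * C ^ 2) ≤ tiltVar p t := by
  have hw := e.pos
  have hC := e.one_le
  have hΦ := h.tiltMass_pos t
  set m := tiltMean p t with hm
  -- the ball of this radius about the mean has mass at most `1 / 2`
  set r : ℝ := w / (4 * C) with hr
  have hr0 : 0 < r := by positivity
  set B : Set ℝ := Metric.ball m r with hB
  have hBm : MeasurableSet B := Metric.isOpen_ball.measurableSet
  set ind : ℝ → ℝ := B.indicator (fun _ => (1 : ℝ)) with hind
  have hi : Integrable fun x => ind x * (Real.exp (t * x) * p x) := by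
    refine (h.integrable_exp t).bdd_mul (c := 1) ?_ (Eventually.of_forall fun x => ?_)
    · exact (measurable_const.indicator hBm).aestronglyMeasurable
    · rw [hind]
      exact (norm_indicator_le_norm_self _ x).trans (by simp)
  have hP : tiltExp p t ind ≤ 1 / 2 := by
    rw [tiltExp, div_le_iff₀ hΦ]
    have hbi : Integrable (B.indicator fun _ : ℝ => C / w * tiltMass p t) :=
      (integrable_indicator_iff hBm).2
        (integrableOn_const (by rw [hB, Real.volume_ball]; exact ENNReal.ofReal_ne_top))
    calc ∫ x, ind x * (Real.exp (t * x) * p x)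
        ≤ ∫ x, B.indicator (fun _ => C / w * tiltMass p t) x := by
          refine integral_mono hi hbi fun x => ?_
          by_cases hx : x ∈ B
          · simp only [hind, indicator_of_mem hx, one_mul]
            refine (e.le x).trans ?_
            have : Real.exp (-(|x - c| / w)) ≤ 1 := by
              rw [Real.exp_le_one_iff, neg_nonpos]; positivity
            have := mul_le_mul_of_nonneg_left this (show 0 ≤ C / w * tiltMass p t by positivity)
            linarith
          · simp only [hind, indicator_of_notMem hx, zero_mul, le_refl]
      _ = 1 / 2 * tiltMass p t := by
          rw [integral_indicator_const _ hBm, hB, Measure.real, Real.volume_ball,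
            ENNReal.toReal_ofReal (by positivity), smul_eq_mul, hr]
          field_simp
          norm_num
  have hle : tiltExp p t (fun x => r ^ 2 + (-r ^ 2) * ind x) ≤ tiltVar p t := by
    rw [h.tiltVar_eq, ← hm]
    refine h.tiltExp_mono ?_ (h.integrable_sub_pow m t 2) fun x => ?_
    · exact IsLightTailed.integrable_add_tilt ((h.integrable_exp t).const_mul (r ^ 2))
        (IsLightTailed.integrable_const_mul_tilt _ hi)
    · by_cases hx : x ∈ B
      · simp only [hind, indicator_of_mem hx]
        nlinarith [sq_nonneg (x - m)]
      · simp only [hind, indicator_of_notMem hx, mul_zero, add_zero]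
        rw [hB, Metric.mem_ball, not_lt, Real.dist_eq] at hx
        rw [← sq_abs (x - m)]
        exact pow_le_pow_left₀ hr0.le hx 2
  rw [IsLightTailed.tiltExp_add ((h.integrable_exp t).const_mul _)
    (IsLightTailed.integrable_const_mul_tilt _ hi), h.tiltExp_const,
    IsLightTailed.tiltExp_const_mul] at hle
  have : w ^ 2 / (32 * C ^ 2) = r ^ 2 / 2 := by rw [hr]; field_simp; norm_num
  rw [this]
  nlinarith [sq_nonneg r]

theorem tiltVar_pos : 0 < tiltVar p t := by
  have hw := e.pos
  have hC := e.one_le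
  exact lt_of_lt_of_le (by positivity) (e.le_tiltVar h)

theorem scale_le : w ≤ 6 * C * Real.sqrt (tiltVar p t) := by
  have hw := e.pos
  have hC := e.one_le
  have h1 := e.le_tiltVar h
  rw [div_le_iff₀ (by positivity)] at h1
  refine le_of_sq_le_sq ?_ (by positivity)
  rw [mul_pow, Real.sq_sqrt (e.tiltVar_pos h).le]
  have := mul_nonneg (e.tiltVar_pos h).le (sq_nonneg C)
  nlinarith

theorem sqrt_tiltVar_le : Real.sqrt (tiltVar p t) ≤ 6 * C * w := by
  have hw := e.pos
  have hC := e.one_le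
  rw [Real.sqrt_le_left (by positivity)]
  refine (e.tiltVar_le h).trans ?_
  have : C ≤ C ^ 2 := by nlinarith
  nlinarith [sq_nonneg w]

theorem tiltExp_abs_cube_le :
    tiltExp p t (fun x => |x - tiltMean p t| ^ 3) ≤ 2816 * C ^ 3 * w ^ 3 := by
  have hw := e.pos
  have hC := e.one_le
  set m := tiltMean p t with hm
  have h1 := e.tiltExp_abs_pow_le h 3
  have h2 := e.abs_tiltMean_sub_le h
  rw [← hm] at h2
  have i1 : Integrable fun x => (4 * |x - c| ^ 3) * (Real.exp (t * x) * p x) :=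
    IsLightTailed.integrable_const_mul_tilt _ (h.integrable_abs_sub_pow c t 3)
  have i0 : Integrable fun x => (4 * |m - c| ^ 3) * (Real.exp (t * x) * p x) :=
    (h.integrable_exp t).const_mul _
  have h3 : tiltExp p t (fun x => |x - m| ^ 3) ≤
      tiltExp p t (fun x => 4 * |x - c| ^ 3 + 4 * |m - c| ^ 3) := by
    refine h.tiltExp_mono (h.integrable_abs_sub_pow m t 3)
      (IsLightTailed.integrable_add_tilt i1 i0) fun x => ?_
    have hab : |x - m| ≤ |x - c| + |m - c| := by
      have := abs_sub (x - c) (m - c)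
      rwa [sub_sub_sub_cancel_right] at this
    have hA := abs_nonneg (x - c)
    have hB := abs_nonneg (m - c)
    refine (pow_le_pow_left₀ (abs_nonneg _) hab 3).trans ?_
    nlinarith [mul_nonneg (add_nonneg hA hB) (sq_nonneg (|x - c| - |m - c|))]
  rw [IsLightTailed.tiltExp_add i1 i0, h.tiltExp_const, IsLightTailed.tiltExp_const_mul] at h3
  have h4 : |m - c| ^ 3 ≤ (8 * C * w) ^ 3 := pow_le_pow_left₀ (abs_nonneg _) h2 3
  have h5 : (Nat.factorial 3 : ℝ) = 6 := by norm_num [Nat.factorial]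
  rw [h5] at h1
  have h6 : C ≤ C ^ 3 := le_self_pow₀ hC (by norm_num)
  have h7 : C * w ^ 3 ≤ C ^ 3 * w ^ 3 := mul_le_mul_of_nonneg_right h6 (by positivity)
  nlinarith

theorem tiltExp_abs_cube_le_sqrt :
    tiltExp p t (fun x => |x - tiltMean p t| ^ 3) ≤
      700000 * C ^ 6 * Real.sqrt (tiltVar p t) ^ 3 := by
  have hw := e.pos
  have hC := e.one_le
  have hs := Real.sqrt_nonneg (tiltVar p t)
  have h1 := pow_le_pow_left₀ hw.le (e.scale_le h) 3
  calc _ ≤ 2816 * C ^ 3 * w ^ 3 := e.tiltExp_abs_cube_le h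
    _ ≤ 2816 * C ^ 3 * (6 * C * Real.sqrt (tiltVar p t)) ^ 3 :=
      mul_le_mul_of_nonneg_left h1 (by positivity)
    _ = 608256 * (C ^ 6 * Real.sqrt (tiltVar p t) ^ 3) := by ring
    _ ≤ 700000 * (C ^ 6 * Real.sqrt (tiltVar p t) ^ 3) :=
      mul_le_mul_of_nonneg_right (by norm_num) (by positivity)
    _ = _ := by ring

theorem abs_tiltThird_le_cube : |tiltThird p t| ≤ 2816 * C ^ 3 * w ^ 3 := by
  rw [h.tiltThird_eq]
  refine (h.abs_tiltExp_le t _).trans ?_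
  simp only [abs_pow]
  exact e.tiltExp_abs_cube_le h

theorem abs_tiltThird_le_sqrt :
    |tiltThird p t| ≤ 700000 * C ^ 6 * Real.sqrt (tiltVar p t) ^ 3 := by
  rw [h.tiltThird_eq]
  refine (h.abs_tiltExp_le t _).trans ?_
  simp only [abs_pow]
  exact e.tiltExp_abs_cube_le_sqrt h

theorem stdTilt_le (z : ℝ) : stdTilt p t z ≤ 700000 * C ^ 6 := by
  have hw := e.pos
  have hC := e.one_le
  have hΦ := h.tiltMass_pos t
  rw [stdTilt, div_le_iff₀ hΦ]
  set x := tiltMean p t + Real.sqrt (tiltVar p t) * z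
  have h1 : Real.exp (t * x) * p x ≤ C / w * tiltMass p t := by
    refine (e.le x).trans ?_
    have : Real.exp (-(|x - c| / w)) ≤ 1 := by
      rw [Real.exp_le_one_iff, neg_nonpos]; positivity
    have := mul_le_mul_of_nonneg_left this (show 0 ≤ C / w * tiltMass p t by positivity)
    linarith
  have h2 := mul_le_mul (e.sqrt_tiltVar_le h) h1
    (mul_nonneg (Real.exp_pos _).le (h.nonneg x)) (by positivity)
  refine h2.trans ?_
  have h3 : 6 * C * w * (C / w * tiltMass p t) = 6 * C ^ 2 * tiltMass p t := by field_simp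
  rw [h3]
  refine mul_le_mul_of_nonneg_right ?_ hΦ.le
  have : C ^ 2 ≤ C ^ 6 := pow_le_pow_right₀ hC (by norm_num)
  nlinarith [pow_nonneg (zero_le_one.trans hC) 6]

/-- The standardized tilted law satisfies the hypotheses of the uniform local limit theorem, with a
constant that only depends on the constant `C` of the envelope. -/
theorem isStdLaw_stdTilt : IsStdLaw (700000 * C ^ 6) (lawOf (stdTilt p t)) := by
  have hC := e.one_le
  have hv := e.tiltVar_pos h
  have hs : 0 < Real.sqrt (tiltVar p t) := Real.sqrt_pos.2 hv
  have hfm := h.measurable_stdTilt t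
  have hf0 := h.stdTilt_nonneg t
  have hdens := fun φ => IsLightTailed.integral_mul_stdTilt (p := p) hv φ
  have h1 : ∫ z, stdTilt p t z = 1 := by
    have := hdens (fun _ => 1)
    simpa [h.tiltExp_const] using this
  have hle := e.stdTilt_le h
  have hthird : ∫ x, |x| ^ 3 * stdTilt p t x =
      tiltExp p t (fun x => |x - tiltMean p t| ^ 3) / Real.sqrt (tiltVar p t) ^ 3 := by
    rw [hdens (fun x => |x| ^ 3), div_eq_inv_mul, ← IsLightTailed.tiltExp_const_mul]
    congr 1
    funext x
    rw [abs_div, abs_of_pos hs, div_pow, div_eq_inv_mul]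
  refine ⟨?_, isProbabilityMeasure_lawOf hf0 h1, ?_, ?_, ?_, ?_, ?_⟩
  · have : 1 ≤ C ^ 6 := one_le_pow₀ hC
    linarith
  · refine Measure.le_iff.2 fun s hs => ?_
    rw [lawOf, withDensity_apply _ hs, Measure.smul_apply, smul_eq_mul, ← setLIntegral_const]
    exact lintegral_mono fun x => ENNReal.ofReal_le_ofReal (hle x)
  · rw [integrable_lawOf_iff hfm hf0]
    have hpos : 0 < ∫ x, |x| ^ 3 * stdTilt p t x := by
      rw [hthird]
      refine div_pos ?_ (by positivity)
      -- the third absolute moment dominates a positive combination of the variance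
      set s := Real.sqrt (tiltVar p t)
      have h2 : tiltExp p t (fun x => s / 2 * (x - tiltMean p t) ^ 2 + (-(s ^ 3 / 4))) ≤
          tiltExp p t (fun x => |x - tiltMean p t| ^ 3) := by
        refine h.tiltExp_mono ?_ (h.integrable_abs_sub_pow _ t 3) fun x => ?_
        · exact IsLightTailed.integrable_add_tilt (IsLightTailed.integrable_const_mul_tilt _
            (h.integrable_sub_pow (tiltMean p t) t 2)) ((h.integrable_exp t).const_mul _)
        · rw [← sq_abs (x - tiltMean p t)]
          set a := |x - tiltMean p t|
          have ha : 0 ≤ a := abs_nonneg _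
          rcases le_total a (s / 2) with h3 | h3
          · have : a ^ 2 ≤ (s / 2) ^ 2 := pow_le_pow_left₀ ha h3 2
            have := pow_nonneg ha 3
            nlinarith [pow_pos hs 3]
          · nlinarith [mul_nonneg (sq_nonneg a) (sub_nonneg.2 h3), pow_pos hs 3]
      rw [IsLightTailed.tiltExp_add
        (IsLightTailed.integrable_const_mul_tilt _ (h.integrable_sub_pow (tiltMean p t) t 2))
        ((h.integrable_exp t).const_mul _), h.tiltExp_const,
        IsLightTailed.tiltExp_const_mul, ← h.tiltVar_eq] at h2
      have h4 : tiltVar p t = s ^ 2 := (Real.sq_sqrt hv.le).symm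
      rw [h4] at h2
      nlinarith [pow_pos hs 3]
    exact Integrable.of_integral_ne_zero hpos.ne'
  · rw [integral_lawOf hfm hf0, hdens (fun x => x)]
    have : (fun x => (x - tiltMean p t) / Real.sqrt (tiltVar p t)) = fun x =>
        (Real.sqrt (tiltVar p t))⁻¹ * (x - tiltMean p t) := by
      funext x; rw [div_eq_inv_mul]
    rw [this, IsLightTailed.tiltExp_const_mul, h.tiltExp_sub_const, sub_self, mul_zero]
  · rw [integral_lawOf hfm hf0, hdens (fun x => x ^ 2)]
    have : (fun x => ((x - tiltMean p t) / Real.sqrt (tiltVar p t)) ^ 2) = fun x =>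
        (tiltVar p t)⁻¹ * (x - tiltMean p t) ^ 2 := by
      funext x; rw [div_pow, Real.sq_sqrt hv.le, div_eq_inv_mul]
    rw [this, IsLightTailed.tiltExp_const_mul, ← h.tiltVar_eq, inv_mul_cancel₀ hv.ne']
  · rw [integral_lawOf hfm hf0, hthird, div_le_iff₀ (by positivity)]
    exact e.tiltExp_abs_cube_le_sqrt h

end TiltEnvelope

/-! ### Tilted log-concave densities have exponential envelopes -/

/-- The level set `(a, b)` one unit below the maximum of a concave function controls the function
everywhere: it is at least the maximum minus one inside, and lies below a tent of width `b - a`. -/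
theorem ConcaveOn.exists_levelSet {F : ℝ → ℝ} (hF : ConcaveOn ℝ (Ici 0) F)
    (hc : ContinuousOn F (Ioi 0)) {x₀ : ℝ} (hx₀ : 0 < x₀) (hmax : ∀ x, 0 ≤ x → F x ≤ F x₀)
    (hdrop : ∃ y, x₀ < y ∧ F y ≤ F x₀ - 1) :
    ∃ a b, 0 ≤ a ∧ a < x₀ ∧ x₀ < b ∧ (∀ x ∈ Ioo a b, F x₀ - 1 ≤ F x) ∧
      (∀ x, 0 ≤ x → F x ≤ F x₀ + 1 - |x - x₀| / (b - a)) ∧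
      (∀ L, 0 < L → F (x₀ + L) ≤ F x₀ - 1 → b ≤ x₀ + L) ∧
      (∀ L, 0 < L → L < x₀ → F (x₀ - L) ≤ F x₀ - 1 → x₀ - L ≤ a) := by
  -- concavity along a segment issuing from the maximum
  have hseg : ∀ z, 0 ≤ z → ∀ l, 0 ≤ l → l ≤ 1 →
      (1 - l) * F x₀ + l * F z ≤ F (x₀ + l * (z - x₀)) := by
    intro z hz l hl0 hl1
    have := hF.2 (show x₀ ∈ Ici (0 : ℝ) from hx₀.le) (show z ∈ Ici (0 : ℝ) from hz)
      (sub_nonneg.2 hl1) hl0 (by ring)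
    simp only [smul_eq_mul] at this
    refine this.trans (le_of_eq ?_)
    congr 1
    ring
  obtain ⟨y, hy, hFy⟩ := hdrop
  obtain ⟨b, ⟨hb1, hb2⟩, hFb⟩ : ∃ b ∈ Icc x₀ y, F b = F x₀ - 1 := by
    have := intermediate_value_Icc' hy.le (hc.mono fun x hx => hx₀.trans_le hx.1)
    exact this ⟨hFy, by linarith⟩
  have hb : x₀ < b := lt_of_le_of_ne hb1 (by rintro rfl; linarith)
  have hbin : ∀ x, x₀ ≤ x → x ≤ b → F x₀ - 1 ≤ F x := by
    intro x h1 h2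
    have := hseg b (hx₀.le.trans hb1) ((x - x₀) / (b - x₀))
      (div_nonneg (by linarith) (by linarith)) ((div_le_one (by linarith)).2 (by linarith))
    rw [div_mul_cancel₀ _ (by linarith), add_sub_cancel, hFb] at this
    have h3 : (x - x₀) / (b - x₀) ≤ 1 := (div_le_one (by linarith)).2 (by linarith)
    nlinarith
  have hbL : ∀ L, 0 < L → F (x₀ + L) ≤ F x₀ - 1 → b ≤ x₀ + L := by
    intro L hL hFL
    by_contra hlt
    rw [not_le] at hlt
    have := hseg b (hx₀.le.trans hb1) (L / (b - x₀))
      (div_nonneg hL.le (by linarith)) ((div_le_one (by linarith)).2 (by linarith))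
    rw [div_mul_cancel₀ _ (by linarith), hFb] at this
    have h3 : L / (b - x₀) < 1 := (div_lt_one (by linarith)).2 (by linarith)
    nlinarith
  have hbout : ∀ x, b ≤ x → F x ≤ F x₀ - (x - x₀) / (b - x₀) := by
    intro x hx
    have hx0 : 0 < x - x₀ := by linarith
    have := hseg x (by linarith) ((b - x₀) / (x - x₀))
      (div_nonneg (by linarith) hx0.le) ((div_le_one hx0).2 (by linarith))
    rw [div_mul_cancel₀ _ hx0.ne', add_sub_cancel, hFb] at this
    have h4 : (b - x₀) / (x - x₀) * (F x₀ - F x) ≥ 1 := by linarith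
    rw [ge_iff_le, div_mul_eq_mul_div, le_div_iff₀ hx0] at h4
    have h5 : (x - x₀) / (b - x₀) ≤ F x₀ - F x := by
      rw [div_le_iff₀ (by linarith)]; linarith
    linarith
  -- on the left the function may stay above the level down to the endpoint `0`; then `a = 0`
  obtain ⟨a, ha0, ha, hain, haL, haout⟩ : ∃ a, 0 ≤ a ∧ a < x₀ ∧
      (∀ x, a < x → x ≤ x₀ → F x₀ - 1 ≤ F x) ∧
      (∀ L, 0 < L → L < x₀ → F (x₀ - L) ≤ F x₀ - 1 → x₀ - L ≤ a) ∧
      (∀ x, 0 ≤ x → x ≤ a → a = 0 ∨ F x ≤ F x₀ - (x₀ - x) / (x₀ - a)) := by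
    by_cases hex : ∃ z, 0 < z ∧ z < x₀ ∧ F z ≤ F x₀ - 1
    · obtain ⟨z, hz0, hzx, hFz⟩ := hex
      obtain ⟨a, ⟨ha1, ha2⟩, hFa⟩ : ∃ a ∈ Icc z x₀, F a = F x₀ - 1 := by
        have := intermediate_value_Icc hzx.le (hc.mono fun x hx => hz0.trans_le hx.1)
        exact this ⟨hFz, by linarith⟩
      have ha : a < x₀ := lt_of_le_of_ne ha2 (by rintro rfl; linarith)
      have ha0 : 0 < a := hz0.trans_le ha1
      refine ⟨a, ha0.le, ha, ?_, ?_, ?_⟩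
      · intro x h1 h2
        have := hseg a ha0.le ((x₀ - x) / (x₀ - a))
          (div_nonneg (by linarith) (by linarith)) ((div_le_one (by linarith)).2 (by linarith))
        have e : x₀ + (x₀ - x) / (x₀ - a) * (a - x₀) = x := by
          have : x₀ - a ≠ 0 := by linarith
          field_simp; ring
        rw [e, hFa] at this
        have h3 : (x₀ - x) / (x₀ - a) ≤ 1 := (div_le_one (by linarith)).2 (by linarith)
        nlinarith
      · intro L hL hLx hFL
        by_contra hlt
        rw [not_le] at hlt
        have := hseg a ha0.le (L / (x₀ - a))
          (div_nonneg hL.le (by linarith)) ((div_le_one (by linarith)).2 (by linarith))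
        have e : x₀ + L / (x₀ - a) * (a - x₀) = x₀ - L := by
          have : x₀ - a ≠ 0 := by linarith
          field_simp; ring
        rw [e, hFa] at this
        have h3 : L / (x₀ - a) < 1 := (div_lt_one (by linarith)).2 (by linarith)
        nlinarith
      · intro x hx0 hxa
        right
        have hx1 : 0 < x₀ - x := by linarith
        have := hseg x hx0 ((x₀ - a) / (x₀ - x))
          (div_nonneg (by linarith) hx1.le) ((div_le_one hx1).2 (by linarith))
        have e : x₀ + (x₀ - a) / (x₀ - x) * (x - x₀) = a := by
          field_simp; ring
        rw [e, hFa] at this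
        have h4 : (x₀ - a) / (x₀ - x) * (F x₀ - F x) ≥ 1 := by linarith
        rw [ge_iff_le, div_mul_eq_mul_div, le_div_iff₀ hx1] at h4
        have h5 : (x₀ - x) / (x₀ - a) ≤ F x₀ - F x := by
          rw [div_le_iff₀ (by linarith)]; linarith
        linarith
    · push Not at hex
      refine ⟨0, le_rfl, hx₀, ?_, ?_, fun x _ _ => Or.inl rfl⟩
      · intro x h1 h2
        rcases h2.lt_or_eq with h3 | h3
        · exact (hex x h1 h3).le
        · rw [h3]; linarith
      · intro L hL hLx hFL
        exact absurd hFL (not_le.2 (hex _ (by linarith) (by linarith)))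
  have hw : 0 < b - a := by linarith
  refine ⟨a, b, ha0, ha, hb, ?_, ?_, hbL, haL⟩
  · rintro x ⟨h1, h2⟩
    rcases le_total x x₀ with h | h
    · exact hain x h1 h
    · exact hbin x h h2.le
  · intro x hx
    rcases le_total b x with h1 | h1
    · rw [abs_of_nonneg (by linarith)]
      have h2 := hbout x h1
      have h3 : (x - x₀) / (b - a) ≤ (x - x₀) / (b - x₀) :=
        div_le_div_of_nonneg_left (by linarith) (by linarith) (by linarith)
      linarith
    · have hnear : |x - x₀| ≤ b - a → F x ≤ F x₀ + 1 - |x - x₀| / (b - a) := by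
        intro h2
        have : |x - x₀| / (b - a) ≤ 1 := (div_le_one hw).2 h2
        linarith [hmax x hx]
      rcases le_total a x with h2 | h2
      · exact hnear (abs_le.2 ⟨by linarith, by linarith⟩)
      · rcases haout x hx h2 with h3 | h3
        · exact hnear (abs_le.2 ⟨by linarith, by linarith⟩)
        · rw [abs_of_nonpos (by linarith), neg_sub]
          have h4 : (x₀ - x) / (b - a) ≤ (x₀ - x) / (x₀ - a) :=
            div_le_div_of_nonneg_left (by linarith) (by linarith) (by linarith)
          linarith

namespace StandingAssumptions

variable {g q : ℝ → ℝ} (hgq : StandingAssumptions g q)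
include hgq

theorem differentiableAt {x : ℝ} (hx : 0 < x) : DifferentiableAt ℝ g x := by
  have := hgq.g_diff 0 (by norm_num)
  rw [iteratedDeriv_zero] at this
  exact (this x hx).differentiableAt (Ioi_mem_nhds hx)

theorem differentiableAt_deriv {x : ℝ} (hx : 0 < x) : DifferentiableAt ℝ (deriv g) x := by
  have := hgq.g_diff 1 (by norm_num)
  rw [iteratedDeriv_one] at this
  exact (this x hx).differentiableAt (Ioi_mem_nhds hx)

theorem monotoneOn_deriv : MonotoneOn (deriv g) (Ioi 0) :=
  (hgq.g_convex.subset Ioi_subset_Ici_self (convex_Ioi 0)).monotoneOn_deriv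
    fun _ hx => hgq.differentiableAt hx

theorem add_deriv_mul_le {x y : ℝ} (hx : 0 < x) (hy : 0 ≤ y) :
    g x + deriv g x * (y - x) ≤ g y := by
  have hd := (hgq.differentiableAt hx).hasDerivAt
  rcases lt_trichotomy x y with h | h | h
  · have := hgq.g_convex.le_slope_of_hasDerivAt (mem_Ici.2 hx.le) (mem_Ici.2 hy) h hd
    rw [slope_def_field, le_div_iff₀ (by linarith)] at this
    linarith
  · rw [h]; simp
  · have := hgq.g_convex.slope_le_of_hasDerivAt (mem_Ici.2 hy) (mem_Ici.2 hx.le) h hd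
    rw [slope_def_field, div_le_iff₀ (by linarith)] at this
    linarith

theorem exists_le_deriv (T : ℝ) : ∃ x, 1 ≤ x ∧ T ≤ deriv g x := by
  by_contra! hlt
  have hbound : ∀ x, 1 ≤ x → g x ≤ g 1 + |T| * x := by
    intro x hx
    have h1 := hgq.add_deriv_mul_le (x := x) (by linarith) zero_le_one
    have h2 := hlt x hx
    have : deriv g x * (x - 1) ≤ |T| * (x - 1) :=
      mul_le_mul_of_nonneg_right (h2.le.trans (le_abs_self T)) (by linarith)
    nlinarith [abs_nonneg T]
  obtain ⟨x, hx1, hx2⟩ := ((hgq.g_superlinear.eventually_ge_atTop (|g 1| + |T| + 1)).and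
    (eventually_ge_atTop 1)).exists
  rw [le_div_iff₀ (by linarith)] at hx1
  have := hbound x hx2
  nlinarith [abs_nonneg (g 1), le_abs_self (g 1)]

/-- Beyond `deriv g 1` the generalized inverse of `deriv g` is a true right inverse. -/
theorem genInv_spec {t : ℝ} (ht : deriv g 1 < t) :
    1 ≤ genInv (deriv g) t ∧ deriv g (genInv (deriv g) t) = t := by
  set S : Set ℝ := {x : ℝ | 0 < x ∧ t ≤ deriv g x} with hS
  have hS1 : ∀ x ∈ S, 1 ≤ x := by
    rintro x ⟨h0, h1⟩
    by_contra! hx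
    have := hgq.monotoneOn_deriv (mem_Ioi.2 h0) (mem_Ioi.2 one_pos) hx.le
    linarith
  obtain ⟨y, hy1, hy2⟩ := hgq.exists_le_deriv t
  have hne : S.Nonempty := ⟨y, by linarith, hy2⟩
  have hbb : BddBelow S := ⟨1, hS1⟩
  have h1 : 1 ≤ genInv (deriv g) t := le_csInf hne hS1
  refine ⟨h1, le_antisymm ?_ ?_⟩
  · have hc := (hgq.differentiableAt_deriv (zero_lt_one.trans_le h1)).continuousAt
    have : Tendsto (deriv g) (𝓝[<] genInv (deriv g) t) (𝓝 (deriv g (genInv (deriv g) t))) :=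
      hc.mono_left nhdsWithin_le_nhds
    refine le_of_tendsto this ?_
    have h0 : ∀ᶠ x in 𝓝[<] genInv (deriv g) t, 0 < x :=
      nhdsWithin_le_nhds (lt_mem_nhds (zero_lt_one.trans_le h1))
    filter_upwards [h0, self_mem_nhdsWithin] with x hx0 hx
    by_contra! hlt
    exact absurd (csInf_le hbb (show x ∈ S from ⟨hx0, hlt.le⟩)) (not_le.2 hx)
  · have hmem : genInv (deriv g) t ∈ closure S := csInf_mem_closure hne hbb
    have hc := (hgq.differentiableAt_deriv (zero_lt_one.trans_le h1)).continuousAt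
    obtain ⟨u, hu, hlim⟩ := mem_closure_iff_seq_limit.1 hmem
    exact ge_of_tendsto (hc.tendsto.comp hlim) (Eventually.of_forall fun n => (hu n).2)

theorem genInv_le_iff {t x : ℝ} (ht : deriv g 1 < t) (hx : 0 < x) :
    genInv (deriv g) t ≤ x ↔ t ≤ deriv g x := by
  obtain ⟨h1, h2⟩ := hgq.genInv_spec ht
  constructor
  · intro h
    have := hgq.monotoneOn_deriv (mem_Ioi.2 (by linarith : 0 < genInv (deriv g) t))
      (mem_Ioi.2 hx) h
    linarith
  · intro h
    exact csInf_le ⟨0, fun y hy => hy.1.le⟩ ⟨hx, h⟩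

theorem tendsto_genInv : Tendsto (genInv (deriv g)) atTop atTop := by
  refine tendsto_atTop.2 fun b => ?_
  filter_upwards [eventually_gt_atTop (deriv g (max b 1)), eventually_gt_atTop (deriv g 1)]
    with t h1 h2
  by_contra! hlt
  have := (hgq.genInv_le_iff h2 (x := max b 1) (lt_max_of_lt_right one_pos)).1
    (hlt.le.trans (le_max_left _ _))
  linarith

theorem measurable_expDensity : Measurable (expDensity g q) := by
  classical
  have hq := hgq.q_meas
  have hG : Measurable ((Ioi (0 : ℝ)).piecewise g 0) :=
    ContinuousOn.measurable_piecewise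
      (fun x hx => (hgq.differentiableAt hx).continuousAt.continuousWithinAt)
      continuousOn_const measurableSet_Ioi
  have e : expDensity g q = fun x => if x ∈ Ioi (0 : ℝ) then
      Real.exp (-((Ioi (0 : ℝ)).piecewise g 0 x - q x)) else
      if x ∈ ({0} : Set ℝ) then Real.exp (-(g 0 - q 0)) else 0 := by
    funext x
    rw [expDensity]
    rcases lt_trichotomy x 0 with h | h | h
    · rw [if_neg (not_le.2 h), if_neg (show x ∉ Ioi (0 : ℝ) from not_lt.2 h.le),
        if_neg (by simpa using h.ne)]
    · subst h; simp
    · rw [if_pos h.le, if_pos (mem_Ioi.2 h), piecewise_eq_of_mem _ _ _ (mem_Ioi.2 h)]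
  rw [e]
  refine Measurable.ite measurableSet_Ioi (by fun_prop) ?_
  exact Measurable.ite (measurableSet_singleton 0) measurable_const measurable_const

omit hgq in
theorem expDensity_nonneg (x : ℝ) : 0 ≤ expDensity g q x := by
  rw [expDensity]; split_ifs
  · exact (Real.exp_pos _).le
  · exact le_rfl

theorem isLightTailed : IsLightTailed (expDensity g q) := by
  obtain ⟨M, hM⟩ := hgq.q_bdd
  have hM0 : 0 ≤ M := (abs_nonneg _).trans (hM 0 le_rfl)
  have hm := hgq.measurable_expDensity
  refine ⟨hm, expDensity_nonneg, ⟨Real.exp M, fun x => ?_⟩, hgq.integral_eq_one, fun t => ?_⟩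
  · rw [expDensity]; split_ifs with hx
    · refine Real.exp_le_exp.2 ?_
      have := (abs_le.1 (hM x hx)).2
      linarith [hgq.g_pos x hx]
    · exact (Real.exp_pos _).le
  · obtain ⟨X, hX⟩ := eventually_atTop.1 (hgq.g_superlinear.eventually_ge_atTop (|t| + 1))
    set X' := max X 1 with hX'
    have hX1 : 1 ≤ X' := le_max_right _ _
    have hdom := (integrable_exp_neg_abs_div one_pos).const_mul (Real.exp (M + (|t| + 1) * X'))
    refine hdom.mono' (by fun_prop) (Eventually.of_forall fun x => ?_)
    rw [Real.norm_of_nonneg (mul_nonneg (Real.exp_pos _).le (expDensity_nonneg x)), expDensity]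
    split_ifs with hx
    · rw [← Real.exp_add, ← Real.exp_add]
      refine Real.exp_le_exp.2 ?_
      have h1 := (abs_le.1 (hM x hx)).2
      have h2 : t * x ≤ |t| * x := mul_le_mul_of_nonneg_right (le_abs_self t) hx
      rw [abs_of_nonneg hx, div_one]
      have h5 : 0 ≤ (|t| + 1) * X' := by positivity
      rcases le_total X' x with h3 | h3
      · have h4 := hX x ((le_max_left _ _).trans h3)
        rw [le_div_iff₀ (by linarith)] at h4
        linarith
      · have h4 : (|t| + 1) * x ≤ (|t| + 1) * X' := mul_le_mul_of_nonneg_left h3 (by positivity)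
        linarith [hgq.g_pos x hx]
    · rw [mul_zero]; positivity

/-- For large `t` the tilted density has an exponential envelope centred at the maximum
`genInv (deriv g) t` of `t x - g x`; its scale is at most `2 L` as soon as `deriv g` increases by
`2 / L` over a distance `L / 2` on both sides of the maximum. -/
theorem exists_tiltEnvelope : ∃ C, 1 ≤ C ∧ ∀ t, deriv g 1 < t → ∃ w,
    TiltEnvelope (expDensity g q) t C (genInv (deriv g) t) w ∧
    ∀ L, 0 < L → L < genInv (deriv g) t → t + 2 / L ≤ deriv g (genInv (deriv g) t + L / 2) →
      deriv g (genInv (deriv g) t - L / 2) ≤ t - 2 / L → w ≤ 2 * L := by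
  obtain ⟨M, hM⟩ := hgq.q_bdd
  have hM0 : 0 ≤ M := (abs_nonneg _).trans (hM 0 le_rfl)
  refine ⟨Real.exp (2 * M + 2), Real.one_le_exp (by linarith), fun t ht => ?_⟩
  obtain ⟨hx1, hhx⟩ := hgq.genInv_spec ht
  set x₀ := genInv (deriv g) t with hx₀
  have hx0 : 0 < x₀ := by linarith
  set F : ℝ → ℝ := fun x => t * x - g x with hF
  have hFconc : ConcaveOn ℝ (Ici 0) F := by
    refine ConcaveOn.sub ⟨convex_Ici 0, fun x _ y _ a b _ _ _ => ?_⟩ hgq.g_convex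
    simp only [smul_eq_mul]
    exact le_of_eq (by ring)
  have hFcont : ContinuousOn F (Ioi 0) := fun x hx =>
    ((continuousAt_const.mul continuousAt_id).sub
      (hgq.differentiableAt hx).continuousAt).continuousWithinAt
  have hmax : ∀ x, 0 ≤ x → F x ≤ F x₀ := by
    intro x hx
    have := hgq.add_deriv_mul_le hx0 hx
    rw [hhx] at this
    simp only [hF]; linarith
  -- superlinear growth of `g` makes the level set bounded on the right
  have hdrop : ∃ y, x₀ < y ∧ F y ≤ F x₀ - 1 := by
    obtain ⟨y, hy1, hy2⟩ := ((hgq.g_superlinear.eventually_ge_atTop (|t| + |F x₀| + 1)).and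
      (eventually_gt_atTop x₀)).exists
    rw [le_div_iff₀ (by linarith)] at hy1
    refine ⟨y, hy2, ?_⟩
    have h1 : t * y ≤ |t| * y := mul_le_mul_of_nonneg_right (le_abs_self t) (by linarith)
    have h2 : |F x₀| * 1 ≤ |F x₀| * y := mul_le_mul_of_nonneg_left (by linarith) (abs_nonneg _)
    have h3 := neg_abs_le (F x₀)
    simp only [hF] at h2 h3 hy1 ⊢
    nlinarith
  obtain ⟨a, b, ha0, ha, hb, hin, hout, hbL, haL⟩ :=
    hFconc.exists_levelSet hFcont hx0 hmax hdrop
  have hw : 0 < b - a := by linarith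
  have hlt := hgq.isLightTailed
  -- the level set alone already gives a lower bound of the right order for `Φ`
  have hΦ : (b - a) * Real.exp (F x₀ - 1 - M) ≤ tiltMass (expDensity g q) t := by
    calc (b - a) * Real.exp (F x₀ - 1 - M)
        = ∫ x, (Ioo a b).indicator (fun _ => Real.exp (F x₀ - 1 - M)) x := by
          rw [integral_indicator_const _ measurableSet_Ioo, Measure.real, Real.volume_Ioo,
            ENNReal.toReal_ofReal hw.le, smul_eq_mul]
      _ ≤ _ := by
          refine integral_mono_of_nonneg (Eventually.of_forall fun x =>
            indicator_nonneg (fun _ _ => (Real.exp_pos _).le) x) (hlt.integrable_exp t)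
            (Eventually.of_forall fun x => ?_)
          by_cases hx : x ∈ Ioo a b
          · have hx0' : 0 ≤ x := ha0.trans hx.1.le
            simp only [indicator_of_mem hx]
            rw [expDensity, if_pos hx0', ← Real.exp_add]
            refine Real.exp_le_exp.2 ?_
            have h1 := hin x hx
            have h2 := (abs_le.1 (hM x hx0')).1
            simp only [hF] at h1 ⊢
            linarith
          · simp only [indicator_of_notMem hx]
            exact mul_nonneg (Real.exp_pos _).le (expDensity_nonneg x)
  refine ⟨b - a, ⟨Real.one_le_exp (by linarith), hw, fun x => ?_⟩, fun L hL hLx h1 h2 => ?_⟩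
  · have hnn : 0 ≤ Real.exp (2 * M + 2) / (b - a) * Real.exp (-(|x - x₀| / (b - a))) := by
      positivity
    refine le_trans ?_ (mul_le_mul_of_nonneg_left hΦ hnn)
    rw [expDensity]
    split_ifs with hx
    · have e : Real.exp (2 * M + 2) / (b - a) * Real.exp (-(|x - x₀| / (b - a))) *
          ((b - a) * Real.exp (F x₀ - 1 - M)) =
          Real.exp (2 * M + 2 + -(|x - x₀| / (b - a)) + (F x₀ - 1 - M)) := by
        rw [Real.exp_add (2 * M + 2 + -(|x - x₀| / (b - a))) (F x₀ - 1 - M),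
          Real.exp_add (2 * M + 2) (-(|x - x₀| / (b - a)))]
        field_simp
      rw [e, ← Real.exp_add]
      refine Real.exp_le_exp.2 ?_
      have h1 := hout x hx
      have h2 := (abs_le.1 (hM x hx)).2
      simp only [hF] at h1 ⊢
      linarith
    · rw [mul_zero]; positivity
  · have hr : b ≤ x₀ + L := by
      refine hbL L hL ?_
      have g1 := hgq.add_deriv_mul_le (x := x₀) (y := x₀ + L / 2) hx0 (by linarith)
      have g2 := hgq.add_deriv_mul_le (x := x₀ + L / 2) (y := x₀ + L) (by linarith) (by linarith)
      rw [hhx] at g1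
      have g3 := mul_le_mul_of_nonneg_right h1 (show 0 ≤ L / 2 by linarith)
      have g4 : (t + 2 / L) * (L / 2) = t * (L / 2) + 1 := by field_simp
      simp only [hF]
      nlinarith
    have hl : x₀ - L ≤ a := by
      refine haL L hL hLx ?_
      have g1 := hgq.add_deriv_mul_le (x := x₀) (y := x₀ - L / 2) hx0 (by linarith)
      have g2 := hgq.add_deriv_mul_le (x := x₀ - L / 2) (y := x₀ - L) (by linarith) (by linarith)
      rw [hhx] at g1
      have g3 := mul_le_mul_of_nonneg_right h2 (show 0 ≤ L / 2 by linarith)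
      have g4 : (t - 2 / L) * (L / 2) = t * (L / 2) - 1 := by field_simp
      simp only [hF]
      nlinarith
    linarith

end StandingAssumptions

/-! ### Regular variation -/

/-- A measurable regularly varying function of negative index is locally bounded at infinity
relative to its size. If the bound failed along `x n`, convergence in measure of
`f (e ^ v * x n) / f (x n)` and of the same ratio based at the offending points would give a
common value of `v` at which the two ratios contradict each other. -/
theorem IsRegularlyVarying.exists_forall_le_mul {f : ℝ → ℝ} {η : ℝ} (hf : IsRegularlyVarying f η)
    (hm : Measurable f) (hη : η < 0) :
    ∃ B X : ℝ, 0 < B ∧ 0 < X ∧ ∀ x, X ≤ x → ∀ l ∈ Icc (1 : ℝ) 2, f (l * x) ≤ B * f x := by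
  obtain ⟨⟨A, hA, -⟩, hlim⟩ := hf
  set δ : ℝ := Real.exp (2 * η) / 2 with hδ
  have hδ0 : 0 < δ := by positivity
  by_contra! hcon
  have hseq : ∀ n : ℕ, ∃ x, max A 1 + n ≤ x ∧ ∃ l ∈ Icc (1 : ℝ) 2, 2 / δ * f x < f (l * x) :=
    fun n => hcon (2 / δ) (max A 1 + n) (by positivity)
      (by have := le_max_right A 1; positivity)
  choose x hx l hl hbad using hseq
  have hx1 : ∀ n, 1 ≤ x n := fun n =>
    (le_max_right A 1).trans (le_trans (by linarith [Nat.cast_nonneg (α := ℝ) n]) (hx n))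
  have hxA : ∀ n, A ≤ x n := fun n =>
    (le_max_left A 1).trans (le_trans (by linarith [Nat.cast_nonneg (α := ℝ) n]) (hx n))
  have hxlim : Tendsto x atTop atTop :=
    tendsto_atTop_mono hx (tendsto_atTop_add_const_left _ _ tendsto_natCast_atTop_atTop)
  have hlx : ∀ n, x n ≤ l n * x n := fun n => by
    nlinarith [(hl n).1, hx1 n]
  have hlxlim : Tendsto (fun n => l n * x n) atTop atTop := tendsto_atTop_mono hlx hxlim
  set μ : Measure ℝ := volume.restrict (Icc 0 2) with hμ
  have hmeas : ∀ y : ℕ → ℝ, Tendsto y atTop atTop → TendstoInMeasure μ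
      (fun n v => f (Real.exp v * y n) / f (y n)) atTop (fun v => Real.exp v ^ η) := by
    intro y hy
    refine tendstoInMeasure_of_tendsto_ae (fun n => ?_) (Eventually.of_forall fun v =>
      (hlim (Real.exp v) (Real.exp_pos v)).comp hy)
    exact (by fun_prop : Measurable fun v => f (Real.exp v * y n) / f (y n)).aestronglyMeasurable
  have h1 := tendstoInMeasure_iff_dist.1 (hmeas x hxlim) 1 one_pos
  have h2 := tendstoInMeasure_iff_dist.1 (hmeas _ hlxlim) δ hδ0
  obtain ⟨n, hn1, hn2⟩ := ((h1.eventually (gt_mem_nhds (show (0 : ENNReal) < ENNReal.ofReal (1 / 2)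
    by simp))).and (h2.eventually (gt_mem_nhds (show (0 : ENNReal) < ENNReal.ofReal (1 / 2)
    by simp)))).exists
  set b := Real.log (l n) with hb
  have hb0 : 0 ≤ b := Real.log_nonneg (hl n).1
  have hb1 : b < 1 := by
    have : b ≤ Real.log 2 := Real.log_le_log (by linarith [(hl n).1]) (hl n).2
    linarith [Real.log_two_lt_d9]
  have hexpb : Real.exp b = l n := Real.exp_log (by linarith [(hl n).1])
  set S1 : Set ℝ := {v | 1 ≤ dist (f (Real.exp v * x n) / f (x n)) (Real.exp v ^ η)} with hS1
  set S2 : Set ℝ := {v | δ ≤ dist (f (Real.exp v * (l n * x n)) / f (l n * x n))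
    (Real.exp v ^ η)} with hS2
  have hcov : Icc b 2 ⊆ (S1 ∩ Icc 0 2) ∪ (fun v => v + -b) ⁻¹' (S2 ∩ Icc 0 2) := by
    intro v hv
    by_contra hnot
    rw [mem_union, not_or] at hnot
    have hv1 : v ∉ S1 := fun h => hnot.1 ⟨h, hb0.trans hv.1, hv.2⟩
    have hv2 : v + -b ∉ S2 := fun h => hnot.2 ⟨h, by linarith [hv.1], by linarith [hv.2]⟩
    rw [hS1, mem_ofPred_eq, not_le, Real.dist_eq, abs_lt] at hv1
    rw [hS2, mem_ofPred_eq, not_le, Real.dist_eq, abs_lt] at hv2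
    have hfx : 0 < f (x n) := hA _ (hxA n)
    have hflx : 0 < f (l n * x n) := hA _ ((hxA n).trans (hlx n))
    have e1 : Real.exp (v + -b) * (l n * x n) = Real.exp v * x n := by
      rw [Real.exp_add, Real.exp_neg, hexpb]
      have : l n ≠ 0 := by linarith [(hl n).1]
      field_simp
    rw [e1] at hv2
    have e2 : Real.exp v ^ η ≤ 1 := by
      rw [← Real.exp_mul, Real.exp_le_one_iff]
      nlinarith [hv.1]
    have e3 : 2 * δ ≤ Real.exp (v + -b) ^ η := by
      rw [← Real.exp_mul, hδ, mul_div_cancel₀ _ two_ne_zero]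
      refine Real.exp_le_exp.2 ?_
      nlinarith [hv.2]
    have h3 : f (Real.exp v * x n) < 2 * f (x n) := by
      rw [← div_lt_iff₀ hfx]; linarith
    have h4 : δ * f (l n * x n) < f (Real.exp v * x n) := by
      rw [← lt_div_iff₀ hflx]; linarith
    have h5 := mul_lt_mul_of_pos_left (hbad n) hδ0
    have h6 : δ * (2 / δ * f (x n)) = 2 * f (x n) := by field_simp
    linarith
  have hvol := (measure_mono hcov).trans (measure_union_le (μ := volume) _ _)
  rw [measure_preimage_add_right, Real.volume_Icc] at hvol
  rw [hμ, Measure.restrict_apply' measurableSet_Icc] at hn1 hn2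
  have hlt := hvol.trans_lt (ENNReal.add_lt_add hn1 hn2)
  rw [← ENNReal.ofReal_add (by norm_num) (by norm_num)] at hlt
  have := (ENNReal.ofReal_lt_ofReal_iff (by norm_num)).1 hlt
  linarith

/-- A measurable regularly varying function of index less than `-1` is eventually at most `1/x`. -/
theorem IsRegularlyVarying.eventually_le_inv {f : ℝ → ℝ} {η : ℝ} (hf : IsRegularlyVarying f η)
    (hm : Measurable f) (hη : η < -1) : ∀ᶠ x in atTop, f x ≤ 1 / x := by
  obtain ⟨B, X₁, hB, hX₁, hloc⟩ := hf.exists_forall_le_mul hm (by linarith)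
  obtain ⟨⟨A, hA, -⟩, hlim⟩ := hf
  set κ : ℝ := (2 * (2 : ℝ) ^ η + 1) / 2 with hκ
  have h2η : (2 : ℝ) * (2 : ℝ) ^ η < 1 := by
    have : (2 : ℝ) * (2 : ℝ) ^ η = (2 : ℝ) ^ (1 + η) := by
      rw [Real.rpow_add two_pos, Real.rpow_one]
    rw [this]
    exact Real.rpow_lt_one_of_one_lt_of_neg one_lt_two (by linarith)
  have h2η0 : 0 < (2 : ℝ) ^ η := Real.rpow_pos_of_pos two_pos η
  have hκ0 : 0 < κ := by positivity
  have hκ1 : κ < 1 := by linarith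
  obtain ⟨X₂, hX₂⟩ := eventually_atTop.1 ((hlim 2 two_pos).eventually
    (gt_mem_nhds (show (2 : ℝ) ^ η < κ / 2 by linarith)))
  set X := max (max X₁ X₂) (max A 1) with hX
  have hXX1 : X₁ ≤ X := (le_max_left _ _).trans (le_max_left _ _)
  have hXX2 : X₂ ≤ X := (le_max_right _ _).trans (le_max_left _ _)
  have hXA : A ≤ X := (le_max_left _ _).trans (le_max_right _ _)
  have hXp : 0 < X := lt_of_lt_of_le one_pos ((le_max_right A 1).trans (le_max_right _ _))
  -- `x f x` decreases by the factor `κ < 1` at each doubling of `x`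
  have hstep : ∀ x, X ≤ x → (2 * x) * f (2 * x) ≤ κ * (x * f x) := by
    intro x hx
    have hfx := hA x (hXA.trans hx)
    have h1 := hX₂ x (hXX2.trans hx)
    rw [div_lt_iff₀ hfx] at h1
    have hx0 : 0 < x := hXp.trans_le hx
    nlinarith
  have hbase : ∀ x, X ≤ x → x ≤ 2 * X → x * f x ≤ 2 * X * (B * f X) := by
    intro x h1 h2
    have h3 := hloc X hXX1 (x / X) ⟨(one_le_div hXp).2 h1, (div_le_iff₀ hXp).2 h2⟩
    rw [div_mul_cancel₀ _ hXp.ne'] at h3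
    exact mul_le_mul h2 h3 (hA x (hXA.trans h1)).le (by linarith)
  have hiter : ∀ k : ℕ, ∀ x, 2 ^ k * X ≤ x → x ≤ 2 ^ (k + 1) * X →
      x * f x ≤ κ ^ k * (2 * X * (B * f X)) := by
    intro k
    induction k with
    | zero => intro x h1 h2; simpa using hbase x (by simpa using h1) (by simpa using h2)
    | succ k ih =>
      intro x h1 h2
      have h3 := ih (x / 2) (by rw [pow_succ] at h1; linarith)
        (by rw [pow_succ] at h2; linarith)
      have h4 := hstep (x / 2) (by
        have : (1 : ℝ) ≤ 2 ^ k := one_le_pow₀ one_le_two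
        rw [pow_succ] at h1
        nlinarith)
      rw [mul_div_cancel₀ x two_ne_zero] at h4
      refine h4.trans ?_
      rw [pow_succ' κ k, mul_assoc]
      exact mul_le_mul_of_nonneg_left h3 hκ0.le
  have hC : Tendsto (fun k : ℕ => κ ^ k * (2 * X * (B * f X))) atTop (𝓝 0) := by
    simpa using (tendsto_pow_atTop_nhds_zero_of_lt_one hκ0.le hκ1).mul_const (2 * X * (B * f X))
  obtain ⟨K, hK⟩ := eventually_atTop.1 (hC.eventually (ge_mem_nhds one_pos))
  filter_upwards [eventually_ge_atTop (2 ^ K * X)] with x hx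
  have hx0 : 0 < x := lt_of_lt_of_le (by positivity) hx
  have hxX : 1 ≤ x / X := by
    rw [one_le_div hXp]
    have : (1 : ℝ) ≤ 2 ^ K := one_le_pow₀ one_le_two
    nlinarith
  obtain ⟨k, hk1, hk2⟩ := exists_nat_pow_near hxX one_lt_two
  rw [le_div_iff₀ hXp] at hk1
  rw [div_lt_iff₀ hXp] at hk2
  have hKk : K ≤ k := by
    by_contra! hlt
    have : (2 : ℝ) ^ (k + 1) ≤ 2 ^ K := pow_le_pow_right₀ one_le_two hlt
    nlinarith
  have := (hiter k x hk1 hk2.le).trans (hK k hKk)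
  rw [le_div_iff₀ hx0]
  linarith

/-! ### Functions in Karamata form -/

namespace HasKaramataForm

variable {f ε : ℝ → ℝ} {ρ A : ℝ} (hf : HasKaramataForm f ρ A ε)
include hf

theorem pos {x : ℝ} (hx : A ≤ x) : 0 < f x := by
  obtain ⟨hA, -, -, c, hc, hfx⟩ := hf
  rw [hfx x hx]
  have := Real.rpow_pos_of_pos (hA.trans_le hx) ρ
  positivity

theorem abs_log_sub_le {x y δ : ℝ} (hx : A ≤ x) (hxy : x ≤ y) (hδ : ∀ u ∈ Icc x y, |ε u| ≤ δ) :
    |Real.log (f y) - Real.log (f x) - ρ * Real.log (y / x)| ≤ δ * Real.log (y / x) := by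
  obtain ⟨hA, hcont, -, c, hc, hfx⟩ := hf
  have hx0 : 0 < x := hA.trans_le hx
  have hy0 : 0 < y := hx0.trans_le hxy
  have hci : ∀ a b, A ≤ a → A ≤ b → IntervalIntegrable (fun u => ε u / u) volume a b := by
    intro a b ha hb
    refine ContinuousOn.intervalIntegrable ?_
    have hsub : uIcc a b ⊆ Ici A := fun u hu => (le_inf ha hb).trans hu.1
    exact (hcont.mono hsub).div continuousOn_id fun u hu => (hA.trans_le (hsub hu)).ne'
  have hlog : ∀ z, A ≤ z → Real.log (f z) =
      ρ * Real.log z + (Real.log c + ∫ u in A..z, ε u / u) := by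
    intro z hz
    have hz0 : 0 < z := hA.trans_le hz
    rw [hfx z hz, Real.log_mul (Real.rpow_pos_of_pos hz0 ρ).ne' (by positivity),
      Real.log_mul hc.ne' (Real.exp_pos _).ne', Real.log_exp, Real.log_rpow hz0]
  have hI := intervalIntegral.integral_add_adjacent_intervals (hci A x le_rfl hx)
    (hci x y hx (hx.trans hxy))
  rw [hlog y (hx.trans hxy), hlog x hx, ← hI, Real.log_div hy0.ne' hx0.ne']
  have e : ρ * Real.log y + (Real.log c + ((∫ u in A..x, ε u / u) + ∫ u in x..y, ε u / u)) -
      (ρ * Real.log x + (Real.log c + ∫ u in A..x, ε u / u)) -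
      ρ * (Real.log y - Real.log x) = ∫ u in x..y, ε u / u := by ring
  rw [e, ← Real.log_div hy0.ne' hx0.ne', ← integral_inv_of_pos hx0 hy0,
    ← intervalIntegral.integral_const_mul, ← Real.norm_eq_abs]
  refine intervalIntegral.norm_integral_le_of_norm_le hxy
    (Eventually.of_forall fun u hu => ?_) ?_
  · have hu0 : 0 < u := hx0.trans hu.1
    rw [norm_div, Real.norm_eq_abs, Real.norm_of_nonneg hu0.le, div_eq_mul_inv]
    exact mul_le_mul_of_nonneg_right (hδ u ⟨hu.1.le, hu.2⟩) (by positivity)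
  · refine ContinuousOn.intervalIntegrable (ContinuousOn.mul continuousOn_const ?_)
    refine continuousOn_id.inv₀ fun u hu => ?_
    rw [uIcc_of_le hxy] at hu
    exact (hx0.trans_le hu.1).ne'

theorem hasDerivAt {x : ℝ} (hx : A < x) : HasDerivAt f (f x * (ρ + ε x) / x) x := by
  have hfp := hf.pos hx.le
  obtain ⟨hA, hcont, -, c, hc, hfx⟩ := hf
  have hx0 : 0 < x := hA.trans hx
  have hcq : ContinuousOn (fun u => ε u / u) (Ici A) :=
    hcont.div continuousOn_id fun u hu => (hA.trans_le hu).ne'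
  have hI : HasDerivAt (fun z => ∫ u in A..z, ε u / u) (ε x / x) x := by
    refine intervalIntegral.integral_hasDerivAt_right ?_ ?_ ?_
    · refine ContinuousOn.intervalIntegrable (hcq.mono fun u hu => ?_)
      rw [uIcc_of_le hx.le] at hu
      exact hu.1
    · exact (hcq.mono Ioi_subset_Ici_self).stronglyMeasurableAtFilter isOpen_Ioi x hx
    · exact (hcq x hx.le).continuousAt (Ici_mem_nhds hx)
  have h1 := (Real.hasDerivAt_rpow_const (p := ρ) (Or.inl hx0.ne')).mul (hI.exp.const_mul c)
  have h2 : HasDerivAt f _ x := h1.congr_of_eventuallyEq (by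
    filter_upwards [Ioi_mem_nhds hx] with z hz
    simp only [Pi.mul_apply, hfx z (le_of_lt hz)])
  convert h2 using 1
  rw [hfx x hx.le, Real.rpow_sub_one hx0.ne']
  field_simp

end HasKaramataForm

/-! ### The third cumulant is negligible compared with the mean -/

/-- Odd moments about the centre of a nearly symmetric tilted density are small. The
near-symmetry is only needed on half the distance to the origin: beyond it, `|u| ^ 3` is at least
`c ^ 3 / 8`, and the trivial bound is absorbed into the cubic term. -/
theorem IsLightTailed.abs_tiltExp_odd_pow_le {p : ℝ → ℝ} (h : IsLightTailed p) {t c D r : ℝ}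
    (hc : 0 < c) (hD : 0 ≤ D) (hr : 0 ≤ r)
    (hsym : ∀ u, |u| ≤ c / 2 →
      |Real.exp (t * (c + u)) * p (c + u) - Real.exp (t * (c - u)) * p (c - u)| ≤
        (D * |u| ^ 3 + r) *
          (Real.exp (t * (c + u)) * p (c + u) + Real.exp (t * (c - u)) * p (c - u)))
    {j : ℕ} (hj : Odd j) :
    |tiltExp p t (fun x => (x - c) ^ j)| ≤
      (D + 8 / c ^ 3) * tiltExp p t (fun x => |x - c| ^ (j + 3)) +
        r * tiltExp p t (fun x => |x - c| ^ j) := by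
  have hΦ := h.tiltMass_pos t
  set P : ℝ → ℝ := fun x => Real.exp (t * x) * p x with hP
  have hP0 : ∀ x, 0 ≤ P x := fun x => mul_nonneg (Real.exp_pos _).le (h.nonneg x)
  have hsymP : ∀ u, |P (c + u) - P (c - u)| ≤
      ((D + 8 / c ^ 3) * |u| ^ 3 + r) * (P (c + u) + P (c - u)) := by
    intro u
    have hS : 0 ≤ P (c + u) + P (c - u) := add_nonneg (hP0 _) (hP0 _)
    rcases le_total |u| (c / 2) with hu | hu
    · refine (hsym u hu).trans (mul_le_mul_of_nonneg_right ?_ hS)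
      have : 0 ≤ 8 / c ^ 3 * |u| ^ 3 := by positivity
      linarith
    · have h1 : 1 ≤ 8 / c ^ 3 * |u| ^ 3 := by
        have : (c / 2) ^ 3 ≤ |u| ^ 3 := pow_le_pow_left₀ (by positivity) hu 3
        rw [div_mul_eq_mul_div, one_le_div (by positivity)]
        nlinarith
      have h2 : |P (c + u) - P (c - u)| ≤ P (c + u) + P (c - u) := by
        rw [abs_le]; constructor <;> linarith [hP0 (c + u), hP0 (c - u)]
      refine h2.trans (le_mul_of_one_le_left hS ?_)
      have : 0 ≤ D * |u| ^ 3 := by positivity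
      linarith
  -- integrals about the centre, and their reflections
  have hshift : ∀ φ : ℝ → ℝ, ∫ x, φ (x - c) * P x = ∫ u, φ u * P (c + u) := by
    intro φ
    rw [← integral_add_left_eq_self (fun x => φ (x - c) * P x) c]
    simp only [add_sub_cancel_left]
  have hrefl : ∀ φ : ℝ → ℝ, ∫ x, φ (x - c) * P x = ∫ u, φ (-u) * P (c - u) := by
    intro φ
    rw [hshift, ← integral_neg_eq_self]
    simp only [← sub_eq_add_neg]
  have hishift : ∀ φ : ℝ → ℝ, Integrable (fun x => φ (x - c) * P x) →
      Integrable fun u => φ u * P (c + u) := by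
    intro φ hφ
    have := hφ.comp_add_left c
    simpa only [add_sub_cancel_left] using this
  have hirefl : ∀ φ : ℝ → ℝ, Integrable (fun x => φ (x - c) * P x) →
      Integrable fun u => φ (-u) * P (c - u) := by
    intro φ hφ
    have := (hishift φ hφ).comp_neg
    simpa only [← sub_eq_add_neg] using this
  have i1 := hishift (fun u => u ^ j) (h.integrable_sub_pow c t j)
  have i2 := hirefl (fun u => u ^ j) (h.integrable_sub_pow c t j)
  have a1 := hishift (fun u => |u| ^ (j + 3)) (h.integrable_abs_sub_pow c t (j + 3))
  have a2 := hirefl (fun u => |u| ^ (j + 3)) (h.integrable_abs_sub_pow c t (j + 3))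
  have b1 := hishift (fun u => |u| ^ j) (h.integrable_abs_sub_pow c t j)
  have b2 := hirefl (fun u => |u| ^ j) (h.integrable_abs_sub_pow c t j)
  simp only [abs_neg] at a2 b2
  simp only [hj.neg_pow] at i2
  have e1 : 2 * ∫ x, (x - c) ^ j * P x = ∫ u, u ^ j * (P (c + u) - P (c - u)) := by
    rw [two_mul]
    conv_lhs => rw [hshift (fun u => u ^ j)]
    conv_lhs => rhs; rw [← hshift (fun u => u ^ j), hrefl (fun u => u ^ j)]
    rw [← integral_add i1 (by simpa only [hj.neg_pow] using i2)]
    refine integral_congr_ae (Eventually.of_forall fun u => ?_)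
    simp only [hj.neg_pow]
    ring
  set E := D + 8 / c ^ 3 with hE
  have e2 : 2 * (E * (∫ x, |x - c| ^ (j + 3) * P x) + r * ∫ x, |x - c| ^ j * P x) =
      ∫ u, (E * (|u| ^ (j + 3) * P (c + u)) + E * (|u| ^ (j + 3) * P (c - u))) +
        (r * (|u| ^ j * P (c + u)) + r * (|u| ^ j * P (c - u))) := by
    have s1 : Integrable fun u =>
        E * (|u| ^ (j + 3) * P (c + u)) + E * (|u| ^ (j + 3) * P (c - u)) :=
      (a1.const_mul E).add (a2.const_mul E)
    have s2 : Integrable fun u => r * (|u| ^ j * P (c + u)) + r * (|u| ^ j * P (c - u)) :=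
      (b1.const_mul r).add (b2.const_mul r)
    rw [integral_add s1 s2, integral_add (a1.const_mul E) (a2.const_mul E),
      integral_add (b1.const_mul r) (b2.const_mul r), integral_const_mul, integral_const_mul,
      integral_const_mul, integral_const_mul, ← hshift (fun u => |u| ^ (j + 3)),
      ← hshift (fun u => |u| ^ j)]
    have r1 := hrefl (fun u => |u| ^ (j + 3))
    have r2 := hrefl (fun u => |u| ^ j)
    simp only [abs_neg] at r1 r2
    rw [← r1, ← r2]
    ring
  have hmain : |∫ x, (x - c) ^ j * P x| ≤
      E * (∫ x, |x - c| ^ (j + 3) * P x) + r * ∫ x, |x - c| ^ j * P x := by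
    have h1 : |2 * ∫ x, (x - c) ^ j * P x| ≤
        2 * (E * (∫ x, |x - c| ^ (j + 3) * P x) + r * ∫ x, |x - c| ^ j * P x) := by
      rw [e1, e2, ← Real.norm_eq_abs]
      refine norm_integral_le_of_norm_le (((a1.const_mul E).add (a2.const_mul E)).add
        ((b1.const_mul r).add (b2.const_mul r))) (Eventually.of_forall fun u => ?_)
      rw [norm_mul, Real.norm_eq_abs, Real.norm_eq_abs, abs_pow]
      refine (mul_le_mul_of_nonneg_left (hsymP u) (pow_nonneg (abs_nonneg u) j)).trans
        (le_of_eq ?_)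
      rw [pow_add]
      ring
    rw [abs_mul, abs_of_pos two_pos] at h1
    linarith
  rw [tiltExp, tiltExp, tiltExp, abs_div, abs_of_pos hΦ, div_le_iff₀ hΦ]
  refine hmain.trans (le_of_eq ?_)
  change _ = (E * ((∫ x, |x - c| ^ (j + 3) * P x) / tiltMass p t) +
    r * ((∫ x, |x - c| ^ j * P x) / tiltMass p t)) * tiltMass p t
  clear_value E
  rw [add_mul, mul_assoc E, mul_assoc r, div_mul_cancel₀ _ hΦ.ne', div_mul_cancel₀ _ hΦ.ne']

/-- The third cumulant of a nearly symmetric tilted density with an exponential envelope. -/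
theorem TiltEnvelope.abs_tiltThird_le {p : ℝ → ℝ} {t C c w : ℝ} (e : TiltEnvelope p t C c w)
    (h : IsLightTailed p) {D r : ℝ} (hD : 0 ≤ D) (hr : 0 ≤ r)
    (h1 : |tiltExp p t (fun x => (x - c) ^ 1)| ≤
      D * tiltExp p t (fun x => |x - c| ^ 4) + r * tiltExp p t (fun x => |x - c| ^ 1))
    (h3 : |tiltExp p t (fun x => (x - c) ^ 3)| ≤
      D * tiltExp p t (fun x => |x - c| ^ 6) + r * tiltExp p t (fun x => |x - c| ^ 3)) :
    |tiltThird p t| ≤ 600000 * C ^ 3 * (D * w ^ 6 + r * w ^ 3) := by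
  have hw := e.pos
  have hC := e.one_le
  set m := tiltMean p t with hm
  set d := m - c with hd
  have hdE : tiltExp p t (fun x => (x - c) ^ 1) = d := by
    simp only [pow_one]; rw [h.tiltExp_sub_const]
  have hdle : |d| ≤ 8 * C * w := e.abs_tiltMean_sub_le h
  have m1 := e.tiltExp_abs_pow_le h 1
  have m2 := e.tiltExp_abs_pow_le h 2
  have m3 := e.tiltExp_abs_pow_le h 3
  have m4 := e.tiltExp_abs_pow_le h 4
  have m6 := e.tiltExp_abs_pow_le h 6
  norm_num [Nat.factorial] at m1 m2 m3 m4 m6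
  rw [hdE] at h1
  simp only [pow_one] at h1
  have hexp : tiltThird p t = tiltExp p t (fun x => (x - c) ^ 3) +
      ((-3 * d) * tiltExp p t (fun x => (x - c) ^ 2) + 2 * d ^ 3) := by
    rw [h.tiltThird_eq, ← hm]
    have i2 := IsLightTailed.integrable_const_mul_tilt (-3 * d) (h.integrable_sub_pow c t 2)
    have i1 := IsLightTailed.integrable_const_mul_tilt (3 * d ^ 2) (h.integrable_sub_pow c t 1)
    have i0 : Integrable fun x => (-d ^ 3) * (Real.exp (t * x) * p x) :=
      (h.integrable_exp t).const_mul _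
    have e3 : (fun x => (x - m) ^ 3) = fun x => (x - c) ^ 3 +
        ((-3 * d) * (x - c) ^ 2 + ((3 * d ^ 2) * (x - c) ^ 1 + (-d ^ 3))) := by
      funext x; rw [hd]; ring
    rw [e3, IsLightTailed.tiltExp_add (h.integrable_sub_pow c t 3)
      (IsLightTailed.integrable_add_tilt i2 (IsLightTailed.integrable_add_tilt i1 i0)),
      IsLightTailed.tiltExp_add i2 (IsLightTailed.integrable_add_tilt i1 i0),
      IsLightTailed.tiltExp_add i1 i0, h.tiltExp_const, IsLightTailed.tiltExp_const_mul,
      IsLightTailed.tiltExp_const_mul, hdE]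
    ring
  have hA : |tiltExp p t (fun x => (x - c) ^ 2)| ≤ 32 * C * w ^ 2 := by
    refine (h.abs_tiltExp_le t _).trans ?_
    simp only [abs_pow, sq_abs]
    linarith
  have hB : |d| ≤ D * (1536 * C * w ^ 4) + r * (8 * C * w) := by
    refine h1.trans (add_le_add (mul_le_mul_of_nonneg_left ?_ hD)
      (mul_le_mul_of_nonneg_left ?_ hr)) <;> linarith
  have hT : |tiltExp p t (fun x => (x - c) ^ 3)| ≤
      D * (184320 * C * w ^ 6) + r * (192 * C * w ^ 3) := by
    refine h3.trans (add_le_add (mul_le_mul_of_nonneg_left ?_ hD)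
      (mul_le_mul_of_nonneg_left ?_ hr)) <;> linarith
  have hd2 : |d| ^ 2 ≤ (8 * C * w) ^ 2 := pow_le_pow_left₀ (abs_nonneg d) hdle 2
  have hmid : |(-3 * d) * tiltExp p t (fun x => (x - c) ^ 2) + 2 * d ^ 3| ≤
      |d| * (224 * C ^ 2 * w ^ 2) := by
    refine (abs_add_le _ _).trans ?_
    rw [abs_mul, abs_mul, abs_mul, abs_pow]
    norm_num
    have q1 := mul_le_mul_of_nonneg_left hA (show 0 ≤ 3 * |d| by positivity)
    have q2 := mul_le_mul_of_nonneg_left hd2 (show 0 ≤ 2 * |d| by positivity)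
    have q3 : |d| * (C * w ^ 2) ≤ |d| * (C ^ 2 * w ^ 2) := by
      refine mul_le_mul_of_nonneg_left (mul_le_mul_of_nonneg_right ?_ (by positivity))
        (abs_nonneg d)
      nlinarith
    nlinarith
  have hmid2 := hmid.trans (mul_le_mul_of_nonneg_right hB
    (show 0 ≤ 224 * C ^ 2 * w ^ 2 by positivity))
  rw [hexp]
  refine (abs_add_le _ _).trans ((add_le_add hT hmid2).trans ?_)
  have k1 : C ≤ C ^ 3 := le_self_pow₀ hC (by norm_num)
  have k2 : D * w ^ 6 * C ≤ D * w ^ 6 * C ^ 3 := mul_le_mul_of_nonneg_left k1 (by positivity)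
  have k3 : r * w ^ 3 * C ≤ r * w ^ 3 * C ^ 3 := mul_le_mul_of_nonneg_left k1 (by positivity)
  have k4 : 0 ≤ D * w ^ 6 * C ^ 3 := by positivity
  have k5 : 0 ≤ r * w ^ 3 * C ^ 3 := by positivity
  nlinarith

theorem abs_exp_sub_exp_le (a b : ℝ) :
    |Real.exp a - Real.exp b| ≤ |a - b| * (Real.exp a + Real.exp b) := by
  have key : ∀ a b : ℝ, b ≤ a → |Real.exp a - Real.exp b| ≤
      |a - b| * (Real.exp a + Real.exp b) := by
    intro a b hab
    rw [abs_of_nonneg (by linarith [Real.exp_le_exp.2 hab]), abs_of_nonneg (by linarith)]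
    have h1 : Real.exp b = Real.exp a * Real.exp (b - a) := by rw [← Real.exp_add]; ring_nf
    have h2 := Real.add_one_le_exp (b - a)
    have h3 := mul_le_mul_of_nonneg_left h2 (Real.exp_pos a).le
    rw [← h1] at h3
    nlinarith [mul_nonneg (show 0 ≤ a - b by linarith) (Real.exp_pos b).le]
  rcases le_total b a with h | h
  · exact key a b h
  · rw [abs_sub_comm, abs_sub_comm a b, add_comm]
    exact key b a h

/-- If the mean is at least of the order `x₀ t` and the third cumulant is `o(x₀ t)`, then the third
cumulant is negligible compared with the mean. -/
theorem tilt_limits_of_bounds {p x₀ κ : ℝ → ℝ} (hx : Tendsto x₀ atTop atTop)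
    (hm : ∀ᶠ t in atTop, x₀ t / 2 ≤ tiltMean p t)
    (h3 : ∀ᶠ t in atTop, |tiltThird p t| ≤ κ t * x₀ t) (hκ : Tendsto κ atTop (𝓝 0)) :
    Tendsto (tiltMean p) atTop atTop ∧
      Tendsto (fun t => tiltThird p t / tiltMean p t) atTop (𝓝 0) := by
  refine ⟨tendsto_atTop_mono' _ hm (hx.atTop_div_const two_pos), ?_⟩
  rw [tendsto_zero_iff_abs_tendsto_zero]
  refine squeeze_zero' (Eventually.of_forall fun t => abs_nonneg _) ?_
    (by simpa using hκ.const_mul 2)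
  filter_upwards [hm, h3, hx.eventually_gt_atTop 0] with t h1 h2 h4
  simp only [Function.comp_apply]
  have hm0 : 0 < tiltMean p t := by linarith
  rw [abs_div, abs_of_pos hm0, div_le_iff₀ hm0]
  have hκ0 : 0 ≤ κ t := by
    by_contra! hneg
    have := (abs_nonneg _).trans h2
    nlinarith
  nlinarith

namespace StandingAssumptions

variable {g q : ℝ → ℝ} (hgq : StandingAssumptions g q)
include hgq

/-- In the rapidly varying case `genInv (deriv g)` has increments tending to zero, so that the scale
of the envelope stays bounded, and the crude bound of the third cumulant by the cube of the scale
suffices. -/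
theorem tilt_limits_of_rapidCase (hr : RapidCase (deriv g) q) :
    Tendsto (tiltMean (expDensity g q)) atTop atTop ∧
      Tendsto (fun t => tiltThird (expDensity g q) t / tiltMean (expDensity g q) t) atTop
        (𝓝 0) := by
  obtain ⟨A, ε, hk, hε, -⟩ := hr
  obtain ⟨C, hC, henv⟩ := hgq.exists_tiltEnvelope
  have hlt := hgq.isLightTailed
  set ψ := genInv (deriv g) with hψ
  have hψlim : Tendsto ψ atTop atTop := hgq.tendsto_genInv
  have hA0 : 0 < A := hk.1
  have hε' : ∀ᶠ u in atTop, |ε u| ≤ 1 / 2 := by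
    have := (tendsto_zero_iff_abs_tendsto_zero _).1 hε
    exact this.eventually (ge_mem_nhds (by norm_num))
  obtain ⟨T₀, hT₀⟩ := eventually_atTop.1 hε'
  set T := max (max T₀ A) 1 with hT
  have hTT : T₀ ≤ T := (le_max_left _ _).trans (le_max_left _ _)
  have hTA : A ≤ T := (le_max_right _ _).trans (le_max_left _ _)
  have hT1 : 1 ≤ T := le_max_right _ _
  have hlog : ∀ x y, T ≤ x → x ≤ y →
      Real.log (ψ y) - Real.log (ψ x) ≤ 1 / 2 * Real.log (y / x) := by
    intro x y h1 h2
    have := hk.abs_log_sub_le (hTA.trans h1) h2 (δ := 1 / 2)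
      (fun u hu => hT₀ u (hTT.trans (h1.trans hu.1)))
    rw [zero_mul, sub_zero] at this
    exact (abs_le.1 this).2
  -- `ψ` grows at most like the square root
  have hgrow : ∀ t, T ≤ t → ψ t ≤ ψ T * Real.sqrt t := by
    intro t ht
    have hp1 := hk.pos (hTA.trans ht)
    have hp2 := hk.pos hTA
    have h1 := hlog T t le_rfl ht
    have h2 : Real.log (t / T) ≤ Real.log t :=
      Real.log_le_log (div_pos (by linarith) (by linarith)) (div_le_self (by linarith) hT1)
    have hsq : 0 < Real.sqrt t := Real.sqrt_pos.2 (by linarith)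
    rw [← Real.log_le_log_iff hp1 (mul_pos hp2 hsq), Real.log_mul hp2.ne' hsq.ne',
      Real.log_sqrt (by linarith)]
    linarith
  have hincr : ∀ᶠ t in atTop, ψ (t + 1) - ψ t ≤ 1 / 2 := by
    have hlim : Tendsto (fun t : ℝ => ψ T * (Real.sqrt t)⁻¹) atTop (𝓝 0) := by
      simpa using (tendsto_inv_atTop_zero.comp Real.tendsto_sqrt_atTop).const_mul (ψ T)
    filter_upwards [hlim.eventually (ge_mem_nhds (show (0 : ℝ) < 1 / 2 by norm_num)),
      eventually_ge_atTop T] with t h1 h2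
    have ht0 : 0 < t := by linarith
    have hp1 := hk.pos (hTA.trans h2)
    have hp2 := hk.pos (hTA.trans (h2.trans (by linarith : t ≤ t + 1)))
    have h3 := hlog t (t + 1) h2 (by linarith)
    have h4 : Real.log ((t + 1) / t) ≤ 1 / t := by
      have := Real.log_le_sub_one_of_pos (show 0 < (t + 1) / t by positivity)
      have e : (t + 1) / t - 1 = 1 / t := by field_simp; ring
      linarith
    have h5 : ψ (t + 1) ≤ ψ t * (1 + 1 / t) := by
      have h6 : ψ (t + 1) = Real.exp (Real.log (ψ (t + 1))) := (Real.exp_log hp2).symm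
      have h7 : Real.log (ψ (t + 1)) ≤ Real.log (ψ t) + 1 / (2 * t) := by
        have : 1 / (2 * t) = 1 / 2 * (1 / t) := by field_simp
        linarith
      have h8 : Real.exp (1 / (2 * t)) ≤ 1 + 1 / t := by
        have h9 : |1 / (2 * t)| ≤ 1 := by
          rw [abs_of_pos (by positivity), div_le_one (by positivity)]; linarith
        have h10 := (abs_le.1 (Real.abs_exp_sub_one_le h9)).2
        rw [abs_of_pos (by positivity)] at h10
        have : 2 * (1 / (2 * t)) = 1 / t := by field_simp
        linarith
      rw [h6]
      refine (Real.exp_le_exp.2 h7).trans ?_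
      rw [Real.exp_add, Real.exp_log hp1]
      exact mul_le_mul_of_nonneg_left h8 hp1.le
    have h6 := hgrow t h2
    have hsq : 0 < Real.sqrt t := Real.sqrt_pos.2 ht0
    have h7 : ψ t * (1 / t) ≤ ψ T * (Real.sqrt t)⁻¹ := by
      have e : ψ T * (Real.sqrt t)⁻¹ = ψ T * Real.sqrt t * (1 / t) := by
        nth_rewrite 3 [← Real.mul_self_sqrt ht0.le]
        field_simp
      rw [e]
      exact mul_le_mul_of_nonneg_right h6 (by positivity)
    nlinarith
  obtain ⟨T₁, hT₁⟩ := eventually_atTop.1 hincr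
  have hw : ∀ᶠ t in atTop, ∃ w, TiltEnvelope (expDensity g q) t C (ψ t) w ∧ w ≤ 4 := by
    filter_upwards [eventually_gt_atTop (deriv g 1 + 1), eventually_ge_atTop (T₁ + 1),
      hψlim.eventually_gt_atTop 2] with t h1 h2 h3
    obtain ⟨w, he, hwL⟩ := henv t (by linarith)
    refine ⟨w, he, ?_⟩
    have h4 := hT₁ t (by linarith)
    have h5 := hT₁ (t - 1) (by linarith)
    rw [sub_add_cancel] at h5
    have h6 := hwL 2 two_pos h3 (by
      norm_num
      rw [← hgq.genInv_le_iff (by linarith) (by linarith)]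
      linarith) (by
      norm_num
      by_contra! hlt'
      have := (hgq.genInv_le_iff (t := t - 1) (x := ψ t - 1) (by linarith) (by linarith)).2
        hlt'.le
      linarith)
    linarith
  refine tilt_limits_of_bounds (κ := fun t => 2816 * C ^ 3 * 64 * (ψ t)⁻¹) hψlim ?_ ?_ ?_
  · filter_upwards [hw, hψlim.eventually_ge_atTop (64 * C)] with t ⟨w, he, hw4⟩ h1
    have := (abs_le.1 (he.abs_tiltMean_sub_le hlt)).1
    nlinarith
  · filter_upwards [hw, hψlim.eventually_gt_atTop 0] with t ⟨w, he, hw4⟩ h1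
    refine (he.abs_tiltThird_le_cube hlt).trans ?_
    rw [mul_assoc _ (ψ t)⁻¹, inv_mul_cancel₀ h1.ne', mul_one]
    have : w ^ 3 ≤ 4 ^ 3 := pow_le_pow_left₀ he.pos.le hw4 3
    have := mul_le_mul_of_nonneg_left this (show 0 ≤ 2816 * C ^ 3 by positivity)
    linarith
  · simpa using (tendsto_inv_atTop_zero.comp hψlim).const_mul (2816 * C ^ 3 * 64)

end StandingAssumptions

/-! ### The regularly varying case -/

/-- First and second derivatives of a function in Karamata form with positive index are comparable,
on dyadic neighbourhoods of `z`, with `f z / z` and `f z / z ^ 2`. -/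
theorem HasKaramataForm.exists_deriv_bounds {f ε : ℝ → ℝ} {β A : ℝ}
    (hf : HasKaramataForm f β A ε) (hβ : 0 < β) (hε : Tendsto ε atTop (𝓝 0))
    (hε' : (fun x => x * |deriv ε x|) =O[atTop] (fun _ => (1 : ℝ))) :
    ∃ c₁ c₂ : ℝ, 0 < c₁ ∧ 0 < c₂ ∧ ∀ᶠ z in atTop, ∀ x ∈ Icc (z / 2) (3 * z / 2),
      c₁ * (f z / z) ≤ deriv f x ∧ DifferentiableAt ℝ (deriv f) x ∧
        |deriv (deriv f) x| ≤ c₂ * (f z / z ^ 2) := by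
  obtain ⟨B, hB⟩ := hε'.bound
  have hδ0 : 0 < min (β / 2) 1 := lt_min (by positivity) one_pos
  have hεs := ((tendsto_zero_iff_abs_tendsto_zero _).1 hε).eventually (ge_mem_nhds hδ0)
  obtain ⟨X₀, hX₀⟩ := eventually_atTop.1 (hB.and hεs)
  have hA := hf.1
  set X := max X₀ (A + 1) with hX
  have hXA : A < X := lt_of_lt_of_le (by linarith) (le_max_right _ _)
  have hXX : X₀ ≤ X := le_max_left _ _
  have hε1 : ∀ x, X ≤ x → |ε x| ≤ 1 :=
    fun x hx => ((hX₀ x (hXX.trans hx)).2).trans (min_le_right _ _)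
  have hε2 : ∀ x, X ≤ x → |ε x| ≤ β / 2 :=
    fun x hx => ((hX₀ x (hXX.trans hx)).2).trans (min_le_left _ _)
  -- the ratio of two values of `f` at points within a factor `2` lies in `[κ⁻¹, κ]`
  set κ := Real.exp ((β + 1) * Real.log 2) with hκ
  have hκ0 : 0 < κ := Real.exp_pos _
  have hlog2 : 0 < Real.log 2 := Real.log_pos one_lt_two
  have hratio : ∀ x y, X ≤ x → x ≤ y → y ≤ 2 * x → f x ≤ f y ∧ f y ≤ κ * f x := by
    intro x y h1 h2 h3
    have hx0 : 0 < x := by linarith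
    have hfx := hf.pos (hXA.le.trans h1)
    have hfy := hf.pos (hXA.le.trans (h1.trans h2))
    have hl0 : 0 ≤ Real.log (y / x) := Real.log_nonneg ((one_le_div hx0).2 h2)
    have hl1 : Real.log (y / x) ≤ Real.log 2 :=
      Real.log_le_log (div_pos (by linarith) hx0) ((div_le_iff₀ hx0).2 h3)
    have k1 := hf.abs_log_sub_le (hXA.le.trans h1) h2 (δ := 1) fun u hu => hε1 u (h1.trans hu.1)
    have k2 := hf.abs_log_sub_le (hXA.le.trans h1) h2 (δ := β / 2)
      fun u hu => hε2 u (h1.trans hu.1)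
    constructor
    · rw [← Real.log_le_log_iff hfx hfy]
      have := (abs_le.1 k2).1
      nlinarith
    · rw [← Real.log_le_log_iff hfy (mul_pos hκ0 hfx), Real.log_mul hκ0.ne' hfx.ne', hκ,
        Real.log_exp]
      have := (abs_le.1 k1).2
      nlinarith
  have hB0 : 0 ≤ B := by
    have := (hX₀ X hXX).1
    rw [norm_one, mul_one] at this
    exact (norm_nonneg _).trans this
  refine ⟨κ⁻¹ * (β / 3), κ * 4 * ((β + 1) ^ 2 + B + (β + 1)), by positivity, by positivity, ?_⟩
  filter_upwards [eventually_ge_atTop (2 * X)] with z hz x hx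
  have hxX : X ≤ x := by linarith [hx.1]
  have hzX : X ≤ z := by linarith
  have hx0 : 0 < x := by linarith
  have hz0 : 0 < z := by linarith
  have hxA : A < x := by linarith
  have hfz := hf.pos (hXA.le.trans hzX)
  have hfx := hf.pos hxA.le
  have hκ1 : 1 ≤ κ := Real.one_le_exp (by positivity)
  have hup : f x ≤ κ * f z := by
    rcases le_total x z with h | h
    · exact (hratio x z hxX h (by linarith [hx.1])).1.trans (le_mul_of_one_le_left hfz.le hκ1)
    · exact (hratio z x hzX h (by linarith [hx.2])).2
  have hlow : κ⁻¹ * f z ≤ f x := by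
    rw [inv_mul_le_iff₀ hκ0]
    rcases le_total x z with h | h
    · exact (hratio x z hxX h (by linarith [hx.1])).2
    · exact (hratio z x hzX h (by linarith [hx.2])).1.trans (le_mul_of_one_le_left hfx.le hκ1)
  have e1 := abs_le.1 (hε1 x hxX)
  have e2 := abs_le.1 (hε2 x hxX)
  have hd := hf.hasDerivAt hxA
  have hdd : HasDerivAt (deriv f)
      (f x / x ^ 2 * ((β + ε x) ^ 2 + x * deriv ε x - (β + ε x))) x := by
    have hεd := (hf.2.2.1 x hxA).1.hasDerivAt
    have h1 := (hd.mul (hεd.const_add β)).div (hasDerivAt_id x) hx0.ne'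
    have h2 : HasDerivAt (deriv f) _ x := h1.congr_of_eventuallyEq (by
      filter_upwards [Ioi_mem_nhds hxA] with y hy
      simp only [(hf.hasDerivAt hy).deriv, Pi.mul_apply, Pi.div_apply, id])
    convert h2 using 1
    simp only [id, Pi.mul_apply]
    field_simp
  refine ⟨?_, hdd.differentiableAt, ?_⟩
  · rw [hd.deriv]
    have h1 : κ⁻¹ * f z * (β / 2) ≤ f x * (β + ε x) :=
      mul_le_mul hlow (by linarith) (by positivity) hfx.le
    rw [le_div_iff₀ hx0]
    refine le_trans ?_ h1
    have h2 : x / z ≤ 3 / 2 := by rw [div_le_iff₀ hz0]; linarith [hx.2]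
    have h3 : κ⁻¹ * (β / 3) * (f z / z) * x = κ⁻¹ * f z * (β / 3) * (x / z) := by field_simp
    rw [h3]
    have h4 : 0 ≤ κ⁻¹ * f z * (β / 3) := by positivity
    nlinarith
  · rw [hdd.deriv, abs_mul, abs_of_pos (by positivity)]
    have h1 : |(β + ε x) ^ 2 + x * deriv ε x - (β + ε x)| ≤ (β + 1) ^ 2 + B + (β + 1) := by
      have k1 : |x * deriv ε x| ≤ B := by
        have := (hX₀ x (hXX.trans hxX)).1
        rw [norm_one, mul_one, Real.norm_eq_abs, abs_mul, abs_abs] at this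
        rwa [abs_mul]
      have k2 := abs_le.1 k1
      have k3 : (β + ε x) ^ 2 ≤ (β + 1) ^ 2 := by
        apply pow_le_pow_left₀ <;> linarith
      rw [abs_le]
      constructor <;> nlinarith [sq_nonneg (β + ε x)]
    have h2 : f x / x ^ 2 ≤ κ * 4 * (f z / z ^ 2) := by
      rw [div_le_iff₀ (by positivity)]
      have : z ^ 2 / 4 ≤ x ^ 2 := by nlinarith [hx.1]
      have k : 0 ≤ κ * 4 * (f z / z ^ 2) := by positivity
      calc f x ≤ κ * f z := hup
        _ = κ * 4 * (f z / z ^ 2) * (z ^ 2 / 4) := by field_simp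
        _ ≤ _ := mul_le_mul_of_nonneg_left this k
    calc f x / x ^ 2 * |(β + ε x) ^ 2 + x * deriv ε x - (β + ε x)|
        ≤ (κ * 4 * (f z / z ^ 2)) * ((β + 1) ^ 2 + B + (β + 1)) :=
          mul_le_mul h2 h1 (abs_nonneg _) (by positivity)
      _ = _ := by ring

/-- The odd part of a function about `z`, beyond its linear term, is controlled by a bound of the
third derivative. -/
theorem abs_sub_reflect_sub_le {f : ℝ → ℝ} {z D u : ℝ}
    (h1 : ∀ x, |x - z| ≤ |u| → DifferentiableAt ℝ f x)
    (h2 : ∀ x, |x - z| ≤ |u| → DifferentiableAt ℝ (deriv f) x)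
    (h3 : ∀ x, |x - z| ≤ |u| → DifferentiableAt ℝ (deriv (deriv f)) x)
    (hD : ∀ x, |x - z| ≤ |u| → |deriv (deriv (deriv f)) x| ≤ D) :
    |f (z + u) - f (z - u) - 2 * u * deriv f z| ≤ 2 * D * |u| ^ 3 := by
  have hu := abs_nonneg u
  have hD0 : 0 ≤ D := (abs_nonneg _).trans (hD z (by simp))
  set s : Set ℝ := Icc (-|u|) |u| with hs
  have hconv : Convex ℝ s := convex_Icc _ _
  have h0s : (0 : ℝ) ∈ s := ⟨by linarith, hu⟩
  have hus : u ∈ s := abs_le.1 le_rfl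
  have hp : ∀ v ∈ s, |z + v - z| ≤ |u| := fun v hv => by
    rw [add_sub_cancel_left]; exact abs_le.2 hv
  have hm : ∀ v ∈ s, |z - v - z| ≤ |u| := fun v hv => by
    rw [sub_sub_cancel_left, abs_neg]; exact abs_le.2 hv
  have dp : ∀ {F : ℝ → ℝ} {v : ℝ}, DifferentiableAt ℝ F (z + v) →
      HasDerivAt (fun v => F (z + v)) (deriv F (z + v)) v := fun hF => by
    simpa using hF.hasDerivAt.comp_const_add z _
  have dm : ∀ {F : ℝ → ℝ} {v : ℝ}, DifferentiableAt ℝ F (z - v) →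
      HasDerivAt (fun v => F (z - v)) (-deriv F (z - v)) v := fun hF => by
    simpa using hF.hasDerivAt.comp_const_sub z _
  have b2 : ∀ v ∈ s, |deriv (deriv f) (z + v) - deriv (deriv f) (z - v)| ≤ 2 * D * |u| := by
    intro v hv
    have := (convex_Icc (z - |u|) (z + |u|)).norm_image_sub_le_of_norm_deriv_le
      (f := deriv (deriv f)) (C := D) (x := z - v) (y := z + v)
      (fun x hx => h3 x (abs_le.2 ⟨by linarith [hx.1], by linarith [hx.2]⟩))
      (fun x hx => hD x (abs_le.2 ⟨by linarith [hx.1], by linarith [hx.2]⟩))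
      ⟨by linarith [hv.2], by linarith [hv.1]⟩ ⟨by linarith [hv.1], by linarith [hv.2]⟩
    rw [Real.norm_eq_abs, Real.norm_eq_abs] at this
    refine this.trans ?_
    have e : z + v - (z - v) = 2 * v := by ring
    rw [e, abs_mul, abs_two]
    have : |v| ≤ |u| := abs_le.2 hv
    nlinarith
  have b1 : ∀ v ∈ s, |deriv f (z + v) + deriv f (z - v) - 2 * deriv f z| ≤ 2 * D * |u| ^ 2 := by
    intro v hv
    have := hconv.norm_image_sub_le_of_norm_hasDerivWithin_le
      (f := fun v => deriv f (z + v) + deriv f (z - v)) (C := 2 * D * |u|) (x := 0) (y := v)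
      (fun w hw => ((dp (h2 _ (hp w hw))).add (dm (h2 _ (hm w hw)))).hasDerivWithinAt)
      (fun w hw => by
        rw [← sub_eq_add_neg]
        exact b2 w hw) h0s hv
    simp only [add_zero, sub_zero, Real.norm_eq_abs] at this
    have hv' : |v| ≤ |u| := abs_le.2 hv
    rw [two_mul (deriv f z)]
    refine this.trans ?_
    have : 0 ≤ 2 * D * |u| := by positivity
    nlinarith
  have := hconv.norm_image_sub_le_of_norm_hasDerivWithin_le
    (f := fun v => f (z + v) - f (z - v) - v * (2 * deriv f z)) (C := 2 * D * |u| ^ 2)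
    (x := 0) (y := u)
    (fun w hw => (((dp (h1 _ (hp w hw))).sub (dm (h1 _ (hm w hw)))).sub
      ((hasDerivAt_id w).mul_const _)).hasDerivWithinAt)
    (fun w hw => by
      rw [sub_neg_eq_add, one_mul]
      exact b1 w hw) h0s hus
  simp only [add_zero, sub_zero, sub_self, zero_mul, Real.norm_eq_abs] at this
  have e : f (z + u) - f (z - u) - 2 * u * deriv f z =
      f (z + u) - f (z - u) - u * (2 * deriv f z) := by ring
  rw [e]
  refine this.trans (le_of_eq (by ring))

namespace StandingAssumptions

variable {g q : ℝ → ℝ} (hgq : StandingAssumptions g q)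
include hgq

/-- Decay of `q` in the regularly varying case: the index of `|q|` is below
`β - 2 - 3 β / 2 - 3 / 2 < -1`. -/
theorem eventually_abs_le_inv {β θ : ℝ} (hβ : 0 < β) (hθ : θ ≤ β - 2)
    (hq : (∀ x, 0 ≤ x → q x = 0) ∨
      ∃ η : ℝ, η < θ - 3 * β / 2 - 3 / 2 ∧ IsRegularlyVarying (fun x => |q x|) η) :
    ∀ᶠ x in atTop, |q x| ≤ 1 / x := by
  rcases hq with hq | ⟨η, hη, hq⟩
  · filter_upwards [eventually_ge_atTop (0 : ℝ)] with x hx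
    rw [hq x hx, abs_zero]
    positivity
  · exact hq.eventually_le_inv hgq.q_meas.abs (by linarith)

/-- In the regularly varying case the tilted density is nearly symmetric about
`z = genInv (deriv g) t`, at the scale `√(z / t)` of the tilted law. This makes the third cumulant
negligible compared with the mean, although the cube of the scale need not be. -/
theorem tilt_limits_of_regularCase (hr : RegularCase (deriv g) q) :
    Tendsto (tiltMean (expDensity g q)) atTop atTop ∧
      Tendsto (fun t => tiltThird (expDensity g q) t / tiltMean (expDensity g q) t) atTop
        (𝓝 0) := by
  obtain ⟨β, θ, A, ε, hβ, hθ, hk, hε, hε', -, -, hq⟩ := hr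
  obtain ⟨C, hC, henv⟩ := hgq.exists_tiltEnvelope
  obtain ⟨c₁, c₂, hc₁, hc₂, hder⟩ := hk.exists_deriv_bounds hβ hε hε'
  obtain ⟨Q, hQ⟩ := eventually_atTop.1 (hgq.eventually_abs_le_inv hβ hθ hq)
  have hlt := hgq.isLightTailed
  set ψ := genInv (deriv g) with hψ
  have hψlim : Tendsto ψ atTop atTop := hgq.tendsto_genInv
  set c₃ := 16 / c₁ with hc₃
  have hc₃0 : 0 < c₃ := by positivity
  have hw : ∀ᶠ t in atTop, ∃ w, TiltEnvelope (expDensity g q) t C (ψ t) w ∧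
      w ^ 2 ≤ c₃ * (ψ t / t) := by
    filter_upwards [eventually_gt_atTop (deriv g 1), eventually_gt_atTop 0,
      hψlim.eventually hder, hψlim.eventually_gt_atTop 0,
      (tendsto_id.atTop_mul_atTop₀ hψlim).eventually_gt_atTop (4 / c₁)] with t h1 ht h2 hz h4
    obtain ⟨w, he, hwL⟩ := henv t h1
    refine ⟨w, he, ?_⟩
    have hhz : deriv g (ψ t) = t := (hgq.genInv_spec h1).2
    set z := ψ t with hzdef
    rw [hhz] at h2
    -- `deriv g` has slope at least `c₁ t / z` near `z`, so it changes by `2 / L` over `L / 2`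
    set L := Real.sqrt (4 * z / (c₁ * t)) with hL
    have hL2 : L ^ 2 = 4 * z / (c₁ * t) := Real.sq_sqrt (by positivity)
    have hL0 : 0 < L := Real.sqrt_pos.2 (by positivity)
    have hLz : L < z := by
      refine lt_of_pow_lt_pow_left₀ 2 hz.le ?_
      rw [hL2, div_lt_iff₀ (by positivity)]
      simp only [id] at h4
      rw [div_lt_iff₀ hc₁] at h4
      nlinarith
    have hkey : c₁ * (t / z) * (L / 2) = 2 / L := by
      have : L * L = 4 * z / (c₁ * t) := by rw [← sq, hL2]
      rw [eq_div_iff hL0.ne']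
      calc c₁ * (t / z) * (L / 2) * L = c₁ * (t / z) / 2 * (L * L) := by ring
        _ = 2 := by rw [this]; field_simp; norm_num
    have hmono : ∀ x y, z / 2 ≤ x → x ≤ y → y ≤ 3 * z / 2 →
        c₁ * (t / z) * (y - x) ≤ deriv g y - deriv g x := by
      intro x y hx hxy hy
      refine (convex_Icc (z / 2) (3 * z / 2)).mul_sub_le_image_sub_of_le_deriv
        (fun u hu => ((hgq.differentiableAt_deriv
          (by linarith [hu.1])).continuousAt).continuousWithinAt)
        (fun u hu => (hgq.differentiableAt_deriv
          (by rw [interior_Icc] at hu; linarith [hu.1])).differentiableWithinAt)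
        (fun u hu => (h2 u (interior_subset hu)).1) x ⟨hx, by linarith⟩ y ⟨by linarith, hy⟩ hxy
    have g1 := hmono z (z + L / 2) (by linarith) (by linarith) (by linarith)
    have g2 := hmono (z - L / 2) z (by linarith) (by linarith) (by linarith)
    rw [add_sub_cancel_left, hkey, hhz] at g1
    rw [sub_sub_cancel, hkey, hhz] at g2
    have hwle := hwL L hL0 hLz (by linarith) (by linarith)
    calc w ^ 2 ≤ (2 * L) ^ 2 := pow_le_pow_left₀ he.pos.le hwle 2
      _ = c₃ * (z / t) := by rw [mul_pow, hL2, hc₃]; field_simp; norm_num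
  refine tilt_limits_of_bounds
    (κ := fun t => 600000 * C ^ 3 * (c₃ ^ 3 * (2 * c₂ + 8) + 4 * c₃ + 4 * c₃ ^ 2) * t⁻¹)
    hψlim ?_ ?_ ?_
  · filter_upwards [hw, eventually_gt_atTop 0, hψlim.eventually_gt_atTop 0,
      (tendsto_id.atTop_mul_atTop₀ hψlim).eventually_ge_atTop ((16 * C) ^ 2 * c₃)]
      with t ⟨w, he, hw2⟩ ht hz hzt
    simp only [id] at hzt
    have h16 : 16 * C * w ≤ ψ t := by
      refine le_of_sq_le_sq ?_ hz.le
      calc (16 * C * w) ^ 2 = (16 * C) ^ 2 * w ^ 2 := by ring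
        _ ≤ (16 * C) ^ 2 * (c₃ * (ψ t / t)) := mul_le_mul_of_nonneg_left hw2 (by positivity)
        _ = ((16 * C) ^ 2 * c₃) * (ψ t / t) := by ring
        _ ≤ (t * ψ t) * (ψ t / t) := mul_le_mul_of_nonneg_right hzt (by positivity)
        _ = ψ t ^ 2 := by field_simp
    have := (abs_le.1 (he.abs_tiltMean_sub_le hlt)).1
    linarith
  · filter_upwards [hw, eventually_gt_atTop (deriv g 1), eventually_ge_atTop 1,
      hψlim.eventually hder, hψlim.eventually_ge_atTop 1, hψlim.eventually_ge_atTop (2 * Q)]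
      with t ⟨w, he, hw2⟩ h1 ht1 h2 hz1 hzQ
    have hhz : deriv g (ψ t) = t := (hgq.genInv_spec h1).2
    set z := ψ t with hzdef
    rw [hhz] at h2
    have hz : 0 < z := by linarith
    have ht : 0 < t := by linarith
    have hw0 := he.pos
    set D := c₂ * (t / z ^ 2) with hD
    have hD0 : 0 ≤ D := by positivity
    have hsym : ∀ u, |u| ≤ z / 2 →
        |Real.exp (t * (z + u)) * expDensity g q (z + u) -
          Real.exp (t * (z - u)) * expDensity g q (z - u)| ≤
        (2 * D * |u| ^ 3 + 4 / z) *
          (Real.exp (t * (z + u)) * expDensity g q (z + u) +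
            Real.exp (t * (z - u)) * expDensity g q (z - u)) := by
      intro u hu
      have hu' := abs_le.1 hu
      have hin : ∀ x, |x - z| ≤ |u| → x ∈ Icc (z / 2) (3 * z / 2) := fun x hx => by
        have := abs_le.1 (hx.trans hu)
        exact ⟨by linarith, by linarith⟩
      have hpos : ∀ x, |x - z| ≤ |u| → 0 < x := fun x hx => by linarith [(hin x hx).1]
      have hodd := abs_sub_reflect_sub_le (f := g) (z := z) (D := D) (u := u)
        (fun x hx => hgq.differentiableAt (hpos x hx))
        (fun x hx => hgq.differentiableAt_deriv (hpos x hx))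
        (fun x hx => (h2 x (hin x hx)).2.1) (fun x hx => (h2 x (hin x hx)).2.2)
      rw [hhz] at hodd
      have hqle : ∀ x, z / 2 ≤ x → |q x| ≤ 2 / z := by
        intro x hx
        refine (hQ x (by linarith)).trans ?_
        rw [div_le_div_iff₀ (by linarith) hz]
        linarith
      have q1 := abs_le.1 (hqle (z + u) (by linarith))
      have q2 := abs_le.1 (hqle (z - u) (by linarith))
      rw [expDensity, expDensity, if_pos (by linarith), if_pos (by linarith), ← Real.exp_add,
        ← Real.exp_add]
      refine (abs_exp_sub_exp_le _ _).trans (mul_le_mul_of_nonneg_right ?_ (by positivity))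
      have e4 : 4 / z = 2 / z + 2 / z := by ring
      have o := abs_le.1 hodd
      rw [abs_le, e4]
      constructor <;> linarith
    have k1 := hlt.abs_tiltExp_odd_pow_le hz (show 0 ≤ 2 * D by positivity)
      (show 0 ≤ 4 / z by positivity) hsym (j := 1) odd_one
    have k3 := hlt.abs_tiltExp_odd_pow_le hz (show 0 ≤ 2 * D by positivity)
      (show 0 ≤ 4 / z by positivity) hsym (j := 3) (by decide)
    have hthird := he.abs_tiltThird_le hlt (by positivity) (by positivity) k1 k3
    refine hthird.trans ?_
    have w4 : w ^ 4 ≤ c₃ ^ 2 * (z / t) ^ 2 := by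
      calc w ^ 4 = (w ^ 2) ^ 2 := by ring
        _ ≤ (c₃ * (z / t)) ^ 2 := pow_le_pow_left₀ (by positivity) hw2 2
        _ = _ := by ring
    have w6 : w ^ 6 ≤ c₃ ^ 3 * (z / t) ^ 3 := by
      calc w ^ 6 = (w ^ 2) ^ 3 := by ring
        _ ≤ (c₃ * (z / t)) ^ 3 := pow_le_pow_left₀ (by positivity) hw2 3
        _ = _ := by ring
    have w3 : w ^ 3 ≤ c₃ * (z / t) + c₃ ^ 2 * (z / t) ^ 2 := by
      have : w ^ 3 ≤ w ^ 2 + w ^ 4 := by nlinarith [sq_nonneg (w * (w - 1)), sq_nonneg w]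
      linarith
    have it : t⁻¹ ≤ 1 := inv_le_one_of_one_le₀ ht1
    have iz : z⁻¹ ≤ 1 := inv_le_one_of_one_le₀ hz1
    have it0 : 0 < t⁻¹ := by positivity
    have iz0 : 0 < z⁻¹ := by positivity
    have A1 : (2 * D + 8 / z ^ 3) * w ^ 6 ≤ c₃ ^ 3 * (2 * c₂ + 8) * (t⁻¹ * z) := by
      calc (2 * D + 8 / z ^ 3) * w ^ 6
          ≤ (2 * D + 8 / z ^ 3) * (c₃ ^ 3 * (z / t) ^ 3) :=
            mul_le_mul_of_nonneg_left w6 (by positivity)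
        _ = c₃ ^ 3 * (2 * c₂ * (t⁻¹ * z * t⁻¹) + 8 * (t⁻¹ * (t⁻¹ * t⁻¹))) := by
            rw [hD]; field_simp
        _ ≤ c₃ ^ 3 * (2 * c₂ * (t⁻¹ * z * 1) + 8 * (t⁻¹ * (z * 1))) := by
            gcongr
            linarith
        _ = _ := by ring
    have A2 : 4 / z * w ^ 3 ≤ (4 * c₃ + 4 * c₃ ^ 2) * (t⁻¹ * z) := by
      calc 4 / z * w ^ 3 ≤ 4 / z * (c₃ * (z / t) + c₃ ^ 2 * (z / t) ^ 2) :=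
            mul_le_mul_of_nonneg_left w3 (by positivity)
        _ = 4 * c₃ * (t⁻¹ * 1) + 4 * c₃ ^ 2 * (t⁻¹ * z * t⁻¹) := by field_simp
        _ ≤ 4 * c₃ * (t⁻¹ * z) + 4 * c₃ ^ 2 * (t⁻¹ * z * 1) := by gcongr
        _ = _ := by ring
    calc 600000 * C ^ 3 * ((2 * D + 8 / z ^ 3) * w ^ 6 + 4 / z * w ^ 3)
        ≤ 600000 * C ^ 3 * (c₃ ^ 3 * (2 * c₂ + 8) * (t⁻¹ * z) +
            (4 * c₃ + 4 * c₃ ^ 2) * (t⁻¹ * z)) := by gcongr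
      _ = _ := by ring
  · have := (tendsto_inv_atTop_zero (𝕜 := ℝ)).const_mul
      (600000 * C ^ 3 * (c₃ ^ 3 * (2 * c₂ + 8) + 4 * c₃ + 4 * c₃ ^ 2))
    rwa [mul_zero] at this

theorem tilt_limits : Tendsto (tiltMean (expDensity g q)) atTop atTop ∧
    Tendsto (fun t => tiltThird (expDensity g q) t / tiltMean (expDensity g q) t) atTop (𝓝 0) :=
  hgq.variation.elim hgq.tilt_limits_of_regularCase hgq.tilt_limits_of_rapidCase

end StandingAssumptions

/-! ### Densities whose tilted laws are uniformly close to normal -/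

/-- The properties of the tilted laws of `p` from which the limit theorems follow: for large
parameters the standardized tilted densities have bounded values and third moments, with a common
constant `K`; the mean tends to infinity and dominates the third cumulant. -/
structure HasStableTilts (p : ℝ → ℝ) (K : ℝ) : Prop where
  tail : IsLightTailed p
  pos : 0 < K
  tiltVar_pos : ∀ᶠ t in atTop, 0 < tiltVar p t
  third_le : ∀ᶠ t in atTop, |tiltThird p t| ≤ K * Real.sqrt (tiltVar p t) ^ 3
  stdTilt_le : ∀ᶠ t in atTop, ∀ z, stdTilt p t z ≤ K
  isStdLaw : ∀ᶠ t in atTop, IsStdLaw K (lawOf (stdTilt p t))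
  tendsto_mean : Tendsto (tiltMean p) atTop atTop
  tendsto_third : Tendsto (fun t => tiltThird p t / tiltMean p t) atTop (𝓝 0)

theorem StandingAssumptions.exists_hasStableTilts {g q : ℝ → ℝ} (hgq : StandingAssumptions g q) :
    ∃ K, HasStableTilts (expDensity g q) K := by
  obtain ⟨C, hC, henv⟩ := hgq.exists_tiltEnvelope
  have h := hgq.isLightTailed
  have hev : ∀ᶠ t in atTop, ∃ w, TiltEnvelope (expDensity g q) t C (genInv (deriv g) t) w := by
    filter_upwards [eventually_gt_atTop (deriv g 1)] with t ht
    obtain ⟨w, he, -⟩ := henv t ht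
    exact ⟨w, he⟩
  exact ⟨700000 * C ^ 6, h, by positivity, hev.mono fun t ⟨w, e⟩ => e.tiltVar_pos h,
    hev.mono fun t ⟨w, e⟩ => e.abs_tiltThird_le_sqrt h, hev.mono fun t ⟨w, e⟩ => e.stdTilt_le h,
    hev.mono fun t ⟨w, e⟩ => e.isStdLaw_stdTilt h, hgq.tilt_limits.1, hgq.tilt_limits.2⟩

theorem exists_mem_uIcc_sub_eq_mul {f f' : ℝ → ℝ} (hf : ∀ x, HasDerivAt f (f' x) x) (x y : ℝ) :
    ∃ ξ ∈ uIcc x y, f y - f x = f' ξ * (y - x) := by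
  have hc : Continuous f := continuous_iff_continuousAt.2 fun x => (hf x).continuousAt
  rcases lt_trichotomy x y with h | h | h
  · obtain ⟨ξ, hξ, he⟩ := exists_hasDerivAt_eq_slope f f' h hc.continuousOn fun u _ => hf u
    refine ⟨ξ, by rw [uIcc_of_le h.le]; exact Ioo_subset_Icc_self hξ, ?_⟩
    rw [he, div_mul_cancel₀ _ (by linarith)]
  · exact ⟨x, left_mem_uIcc, by simp [h]⟩
  · obtain ⟨ξ, hξ, he⟩ := exists_hasDerivAt_eq_slope f f' h hc.continuousOn fun u _ => hf u
    refine ⟨ξ, by rw [uIcc_of_ge h.le]; exact Ioo_subset_Icc_self hξ, ?_⟩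
    rw [he, ← neg_sub x y, mul_neg, div_mul_cancel₀ _ (by linarith)]
    ring

namespace IsLightTailed

variable {p : ℝ → ℝ} (h : IsLightTailed p)
include h

theorem tiltVar_nonneg (t : ℝ) : 0 ≤ tiltVar p t := by
  rw [h.tiltVar_eq, tiltExp]
  exact div_nonneg (integral_nonneg fun x => mul_nonneg (sq_nonneg _)
    (mul_nonneg (Real.exp_pos _).le (h.nonneg x))) (h.tiltMass_pos t).le

theorem monotone_tiltMean : Monotone (tiltMean p) :=
  monotone_of_hasDerivAt_nonneg h.hasDerivAt_tiltMean h.tiltVar_nonneg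

theorem continuous_tiltMean : Continuous (tiltMean p) :=
  continuous_iff_continuousAt.2 fun t => (h.hasDerivAt_tiltMean t).continuousAt

theorem tiltExp_sub_sq (t c : ℝ) :
    tiltExp p t (fun x => (x - c) ^ 2) = tiltVar p t + (tiltMean p t - c) ^ 2 := by
  set m := tiltMean p t with hm
  have i2 := h.integrable_sub_pow m t 2
  have i1 := integrable_const_mul_tilt (2 * (m - c)) (h.integrable_sub_pow m t 1)
  have i0 : Integrable fun x => (m - c) ^ 2 * (Real.exp (t * x) * p x) :=
    (h.integrable_exp t).const_mul _
  have e : (fun x => (x - c) ^ 2) = fun x => (x - m) ^ 2 +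
      ((2 * (m - c)) * (x - m) ^ 1 + (m - c) ^ 2) := by
    funext x; ring
  have e1 : tiltExp p t (fun x => (x - m) ^ 1) = 0 := by
    simp only [pow_one]; rw [h.tiltExp_sub_const, ← hm, sub_self]
  rw [e, tiltExp_add i2 (integrable_add_tilt i1 i0), tiltExp_add i1 i0, tiltExp_const_mul, e1,
    h.tiltExp_const, h.tiltVar_eq, ← hm]
  ring

end IsLightTailed

namespace HasStableTilts

variable {p : ℝ → ℝ} {K : ℝ} (h : HasStableTilts p K)
include h

/-- For large levels `b` the equation `m(t) = b` has a solution, so that `tiltParam` solves it. -/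
theorem eventually_tiltMean_tiltParam : ∀ᶠ b in atTop, tiltMean p (tiltParam p b) = b := by
  filter_upwards [eventually_ge_atTop (tiltMean p 0)] with b hb
  obtain ⟨T, hT⟩ := (h.tendsto_mean.eventually_ge_atTop b).exists
  exact Function.invFun_eq (mem_range_of_exists_le_of_exists_ge h.tail.continuous_tiltMean
    ⟨0, hb⟩ ⟨T, hT⟩)

theorem tendsto_tiltParam : Tendsto (tiltParam p) atTop atTop := by
  refine tendsto_atTop.2 fun T => ?_
  filter_upwards [h.eventually_tiltMean_tiltParam, eventually_gt_atTop (tiltMean p T)] with b h1 h2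
  by_contra! hlt
  have := h.tail.monotone_tiltMean hlt.le
  linarith

/-- `1 / s` is Lipschitz for large parameters, since its derivative is `-μ₃ / (2 s ^ 3)`. -/
theorem exists_abs_inv_sqrt_sub_le : ∃ T, (∀ t, T ≤ t → 0 < tiltVar p t) ∧
    ∀ t t', T ≤ t → T ≤ t' →
      |(Real.sqrt (tiltVar p t'))⁻¹ - (Real.sqrt (tiltVar p t))⁻¹| ≤ K * |t' - t| := by
  obtain ⟨T, hT⟩ := eventually_atTop.1 (h.tiltVar_pos.and h.third_le)
  refine ⟨T, fun t ht => (hT t ht).1, fun t t' ht ht' => ?_⟩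
  have := (convex_Ici T).norm_image_sub_le_of_norm_hasDerivWithin_le
    (f := fun t => (Real.sqrt (tiltVar p t))⁻¹) (C := K) (x := t) (y := t')
    (fun u hu => (((h.tail.hasDerivAt_tiltVar u).sqrt (hT u hu).1.ne').inv
      (Real.sqrt_pos.2 (hT u hu).1).ne').hasDerivWithinAt)
    (fun u hu => by
      obtain ⟨h1, h2⟩ := hT u hu
      have hs := Real.sqrt_pos.2 h1
      have hK := h.pos
      rw [norm_div, norm_neg, norm_div, Real.norm_eq_abs,
        Real.norm_of_nonneg (show 0 ≤ 2 * Real.sqrt (tiltVar p u) by positivity),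
        Real.norm_of_nonneg (show 0 ≤ Real.sqrt (tiltVar p u) ^ 2 by positivity), div_div,
        div_le_iff₀ (by positivity)]
      refine h2.trans ?_
      have : 0 ≤ K * Real.sqrt (tiltVar p u) ^ 3 := by positivity
      nlinarith) ht ht'
  simpa only [Real.norm_eq_abs] using this

/-- The variance is asymptotically constant over intervals of length `o(1 / s)`. -/
theorem tendsto_tiltVar_div {t t' : ℕ → ℝ} (ht : Tendsto t atTop atTop)
    (ht' : Tendsto t' atTop atTop)
    (hd : Tendsto (fun n => Real.sqrt (tiltVar p (t n)) * (t' n - t n)) atTop (𝓝 0)) :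
    Tendsto (fun n => tiltVar p (t' n) / tiltVar p (t n)) atTop (𝓝 1) := by
  obtain ⟨T, hT, hlip⟩ := h.exists_abs_inv_sqrt_sub_le
  have h1 : Tendsto (fun n => Real.sqrt (tiltVar p (t n)) / Real.sqrt (tiltVar p (t' n))) atTop
      (𝓝 1) := by
    rw [tendsto_iff_norm_sub_tendsto_zero]
    refine squeeze_zero' (Eventually.of_forall fun n => norm_nonneg _) ?_
      (by simpa using (tendsto_norm_zero.comp hd).const_mul K)
    filter_upwards [ht.eventually_ge_atTop T, ht'.eventually_ge_atTop T] with n k1 k2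
    have hs := Real.sqrt_pos.2 (hT _ k1)
    have e : Real.sqrt (tiltVar p (t n)) / Real.sqrt (tiltVar p (t' n)) - 1 =
        Real.sqrt (tiltVar p (t n)) * ((Real.sqrt (tiltVar p (t' n)))⁻¹ -
          (Real.sqrt (tiltVar p (t n)))⁻¹) := by
      rw [mul_sub, mul_inv_cancel₀ hs.ne']; rfl
    simp only [Real.norm_eq_abs]
    rw [e, abs_mul, abs_of_pos hs]
    have := mul_le_mul_of_nonneg_left (hlip _ _ k1 k2) hs.le
    linarith
  have h2 := (h1.inv₀ one_ne_zero).pow 2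
  rw [inv_one, one_pow] at h2
  refine h2.congr fun n => ?_
  rw [inv_div, div_pow, Real.sq_sqrt (h.tail.tiltVar_nonneg _),
    Real.sq_sqrt (h.tail.tiltVar_nonneg _)]

omit h in
theorem tendsto_of_mem_uIcc {t t' ξ s : ℕ → ℝ} (ht : Tendsto t atTop atTop)
    (ht' : Tendsto t' atTop atTop) (hξ : ∀ n, ξ n ∈ uIcc (t n) (t' n))
    (hd : Tendsto (fun n => s n * (t' n - t n)) atTop (𝓝 0)) :
    Tendsto ξ atTop atTop ∧ Tendsto (fun n => s n * (ξ n - t n)) atTop (𝓝 0) := by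
  constructor
  · refine tendsto_atTop.2 fun b => ?_
    filter_upwards [ht.eventually_ge_atTop b, ht'.eventually_ge_atTop b] with n h1 h2
    exact (le_inf h1 h2).trans (hξ n).1
  · rw [tendsto_zero_iff_norm_tendsto_zero] at hd ⊢
    refine squeeze_zero (fun n => norm_nonneg _) (fun n => ?_) hd
    rw [norm_mul, norm_mul]
    refine mul_le_mul_of_nonneg_left ?_ (norm_nonneg _)
    rw [Real.norm_eq_abs, Real.norm_eq_abs]
    exact abs_sub_left_of_mem_uIcc (hξ n)

/-- If the mean changes by `o(s)`, then the parameter changes by `o(1 / s)`. -/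
theorem tendsto_sqrt_mul_sub {t t' : ℕ → ℝ} (ht : Tendsto t atTop atTop)
    (ht' : Tendsto t' atTop atTop)
    (hd : Tendsto (fun n => (tiltMean p (t' n) - tiltMean p (t n)) / Real.sqrt (tiltVar p (t n)))
      atTop (𝓝 0)) :
    Tendsto (fun n => Real.sqrt (tiltVar p (t n)) * (t' n - t n)) atTop (𝓝 0) := by
  obtain ⟨T, hT, hlip⟩ := h.exists_abs_inv_sqrt_sub_le
  have hK := h.pos
  rw [Metric.tendsto_atTop]
  intro δ hδ
  -- if the parameter moved by more than `4 η / s`, the mean would have moved by more than `η s`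
  -- after the first `4 η / s`
  set η := min (δ / 8) (1 / (8 * K)) with hη
  have hη0 : 0 < η := lt_min (by positivity) (by positivity)
  have hη1 : 8 * η ≤ δ := by have := min_le_left (δ / 8) (1 / (8 * K)); linarith
  have hη2 : 8 * K * η ≤ 1 := by
    have := min_le_right (δ / 8) (1 / (8 * K))
    rw [← hη, le_div_iff₀ (by positivity)] at this
    linarith
  have hsmall := (tendsto_zero_iff_norm_tendsto_zero.1 hd).eventually (ge_mem_nhds hη0)
  obtain ⟨N, hN⟩ := eventually_atTop.1 ((hsmall.and (ht.eventually_ge_atTop T)).and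
    (ht'.eventually_ge_atTop T))
  refine ⟨N, fun n hn => ?_⟩
  obtain ⟨⟨k1, k2⟩, k3⟩ := hN n hn
  set x := t n with hx
  set x' := t' n with hx'
  set s := Real.sqrt (tiltVar p x) with hs
  have hs0 : 0 < s := Real.sqrt_pos.2 (hT _ k2)
  rw [Real.norm_eq_abs, abs_div, abs_of_pos hs0, div_le_iff₀ hs0] at k1
  rw [Real.dist_eq, sub_zero, abs_mul, abs_of_pos hs0]
  suffices hsuff : s * |x' - x| ≤ 4 * η by linarith
  by_contra! hlt
  have hd0 : 0 < |x' - x| := by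
    by_contra! hneg
    nlinarith
  set l := 4 * η / (s * |x' - x|) with hl
  have hl0 : 0 ≤ l := by positivity
  have hl1 : l ≤ 1 := (div_le_one (by positivity)).2 hlt.le
  set y := x + l * (x' - x) with hy
  have hyx : s * |y - x| = 4 * η := by
    rw [hy, add_sub_cancel_left, abs_mul, abs_of_nonneg hl0, hl]
    field_simp
  have hmem : y ∈ uIcc x x' := by
    rw [mem_uIcc]
    rcases le_total x x' with hle | hle
    · left; constructor <;> nlinarith
    · right; constructor <;> nlinarith
  have hmono : |tiltMean p y - tiltMean p x| ≤ |tiltMean p x' - tiltMean p x| := by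
    rcases le_total x x' with hle | hle
    · rw [uIcc_of_le hle] at hmem
      have m1 := h.tail.monotone_tiltMean hmem.1
      have m2 := h.tail.monotone_tiltMean hmem.2
      rw [abs_of_nonneg (by linarith), abs_of_nonneg (by linarith)]
      linarith
    · rw [uIcc_of_ge hle] at hmem
      have m1 := h.tail.monotone_tiltMean hmem.1
      have m2 := h.tail.monotone_tiltMean hmem.2
      rw [abs_of_nonpos (by linarith), abs_of_nonpos (by linarith)]
      linarith
  obtain ⟨ξ, hξ, he⟩ := exists_mem_uIcc_sub_eq_mul h.tail.hasDerivAt_tiltMean x y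
  have hyT : T ≤ y := (le_inf k2 k3).trans hmem.1
  have hξT : T ≤ ξ := (le_inf k2 hyT).trans hξ.1
  have hξs : 0 < Real.sqrt (tiltVar p ξ) := Real.sqrt_pos.2 (hT _ hξT)
  have hξx : s * |ξ - x| ≤ 4 * η := by
    rw [← hyx]
    exact mul_le_mul_of_nonneg_left (abs_sub_left_of_mem_uIcc hξ) hs0.le
  have hinv : (Real.sqrt (tiltVar p ξ))⁻¹ ≤ s⁻¹ * (3 / 2) := by
    have h1 := (abs_le.1 (hlip x ξ k2 hξT)).2
    have h2 : K * |ξ - x| ≤ s⁻¹ * (1 / 2) := by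
      rw [inv_mul_eq_div, le_div_iff₀ hs0]
      nlinarith
    linarith
  have hlow : 2 / 3 * s ≤ Real.sqrt (tiltVar p ξ) := by
    rw [inv_mul_eq_div, le_div_iff₀ hs0, inv_mul_le_iff₀ hξs] at hinv
    linarith
  have hv : 4 / 9 * s ^ 2 ≤ tiltVar p ξ := by
    rw [← Real.sq_sqrt (h.tail.tiltVar_nonneg ξ)]
    nlinarith
  have hfin : tiltVar p ξ * |y - x| ≤ η * s := by
    have := hmono.trans k1
    rwa [he, abs_mul, abs_of_nonneg (h.tail.tiltVar_nonneg ξ)] at this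
  have h5 : 4 / 9 * s ^ 2 * |y - x| ≤ η * s :=
    (mul_le_mul_of_nonneg_right hv (abs_nonneg _)).trans hfin
  have h6 : 4 / 9 * s ^ 2 * |y - x| = 16 / 9 * η * s := by
    calc 4 / 9 * s ^ 2 * |y - x| = 4 / 9 * s * (s * |y - x|) := by ring
      _ = _ := by rw [hyx]; ring
  have : 0 < η * s := by positivity
  linarith

end HasStableTilts

theorem tendsto_mul_zero_of_isBigO_one {r b : ℕ → ℝ}
    (hr : r =O[atTop] fun _ => (1 : ℝ)) (hb : Tendsto b atTop (𝓝 0)) :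
    Tendsto (fun n => r n * b n) atTop (𝓝 0) := by
  have := hr.mul_isLittleO ((Asymptotics.isLittleO_one_iff ℝ).2 hb)
  simpa using this

namespace HasStableTilts

variable {p : ℝ → ℝ} {K : ℝ} (h : HasStableTilts p K)
include h

/-- Linearization of the mean function over intervals of length `o(1 / s)`. -/
theorem exists_tiltMean_sub_eq {t t' : ℕ → ℝ} (ht : Tendsto t atTop atTop)
    (ht' : Tendsto t' atTop atTop)
    (hd : Tendsto (fun n => Real.sqrt (tiltVar p (t n)) * (t' n - t n)) atTop (𝓝 0)) :
    ∃ γ : ℕ → ℝ, Tendsto γ atTop (𝓝 1) ∧ ∀ᶠ n in atTop,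
      tiltMean p (t' n) - tiltMean p (t n) = γ n * (tiltVar p (t n) * (t' n - t n)) := by
  choose ξ hξ he using fun n => exists_mem_uIcc_sub_eq_mul h.tail.hasDerivAt_tiltMean (t n) (t' n)
  obtain ⟨h1, h2⟩ := tendsto_of_mem_uIcc ht ht' hξ hd
  refine ⟨_, h.tendsto_tiltVar_div ht h1 h2, ?_⟩
  filter_upwards [ht.eventually h.tiltVar_pos] with n hn
  rw [he, ← mul_assoc, div_mul_cancel₀ _ hn.ne']

/-- Linearization of `log Φ` over intervals of length `o(1 / s)`: the quadratic remainder is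
`o(1)`. -/
theorem tendsto_log_tiltMass_sub {t t' : ℕ → ℝ} (ht : Tendsto t atTop atTop)
    (ht' : Tendsto t' atTop atTop)
    (hd : Tendsto (fun n => Real.sqrt (tiltVar p (t n)) * (t' n - t n)) atTop (𝓝 0)) :
    Tendsto (fun n => Real.log (tiltMass p (t' n)) - Real.log (tiltMass p (t n)) -
      tiltMean p (t n) * (t' n - t n)) atTop (𝓝 0) := by
  choose ξ hξ he using fun n =>
    exists_mem_uIcc_sub_eq_mul h.tail.hasDerivAt_log_tiltMass (t n) (t' n)
  obtain ⟨h1, h2⟩ := tendsto_of_mem_uIcc ht ht' hξ hd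
  obtain ⟨γ, hγ, hγe⟩ := h.exists_tiltMean_sub_eq ht h1 h2
  have hlim := (hγ.mul h2).mul hd
  rw [mul_zero] at hlim
  refine hlim.congr' ?_
  filter_upwards [hγe] with n hn
  rw [he]
  have hs := Real.mul_self_sqrt (h.tail.tiltVar_nonneg (t n))
  have : γ n * (Real.sqrt (tiltVar p (t n)) * (ξ n - t n)) *
      (Real.sqrt (tiltVar p (t n)) * (t' n - t n)) =
      γ n * ((Real.sqrt (tiltVar p (t n)) * Real.sqrt (tiltVar p (t n))) * (ξ n - t n)) *
      (t' n - t n) := by ring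
  rw [this, hs, ← hn]
  ring

/-- The uniform local limit theorem along a sequence of tilted laws. -/
theorem tendsto_sqrt_mul_sumDensity_sub {t : ℕ → ℝ} (ht : Tendsto t atTop atTop) {N : ℕ → ℕ}
    (hN : Tendsto N atTop atTop) (z : ℕ → ℝ) :
    Tendsto (fun n => Real.sqrt (N n) * sumDensity (stdTilt p (t n)) (N n) (z n) -
      (Real.sqrt (2 * Real.pi))⁻¹ * Real.exp (-(z n ^ 2 / (2 * N n)))) atTop (𝓝 0) := by
  rw [Metric.tendsto_nhds]
  intro δ hδ
  obtain ⟨N₀, hN₀⟩ := exists_forall_abs_sumDensity_sub_le K (half_pos hδ)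
  filter_upwards [ht.eventually h.stdTilt_le, ht.eventually h.isStdLaw, hN.eventually_ge_atTop N₀]
    with n h1 h2 h3
  rw [Real.dist_eq, sub_zero]
  exact (hN₀ _ (h.tail.measurable_stdTilt _) (h.tail.stdTilt_nonneg _) h1 h2 _ h3 _).trans_lt
    (half_lt_self hδ)

end HasStableTilts

/-! ### The damped moment generating function -/

/-- Multiplying the density by the Gaussian factor `exp (-(x - c) ^ 2 / (2 b))` hardly changes the
moment generating function when `b` is large compared with the second moment about `c`. -/
theorem IsLightTailed.integral_gaussian_mul_bounds {p : ℝ → ℝ} (h : IsLightTailed p) (t c : ℝ)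
    {b : ℝ} (hb : 0 < b) :
    tiltMass p t * (1 - (tiltVar p t + (tiltMean p t - c) ^ 2) / (2 * b)) ≤
        ∫ x, Real.exp (-((x - c) ^ 2 / (2 * b))) * (Real.exp (t * x) * p x) ∧
      ∫ x, Real.exp (-((x - c) ^ 2 / (2 * b))) * (Real.exp (t * x) * p x) ≤ tiltMass p t := by
  have hΦ := h.tiltMass_pos t
  have hw0 : ∀ x, 0 ≤ Real.exp (t * x) * p x := fun x => mul_nonneg (Real.exp_pos _).le (h.nonneg x)
  have hle : ∀ x, Real.exp (-((x - c) ^ 2 / (2 * b))) ≤ 1 := fun x =>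
    Real.exp_le_one_iff.2 (neg_nonpos.2 (by positivity))
  have hi : Integrable fun x => Real.exp (-((x - c) ^ 2 / (2 * b))) * (Real.exp (t * x) * p x) := by
    have hm := h.meas
    refine (h.integrable_exp t).mono' (by fun_prop) (Eventually.of_forall fun x => ?_)
    rw [Real.norm_of_nonneg (mul_nonneg (Real.exp_pos _).le (hw0 x))]
    exact mul_le_of_le_one_left (hw0 x) (hle x)
  constructor
  · have h2 := h.integrable_sub_pow c t 2
    have e : tiltMass p t * (1 - (tiltVar p t + (tiltMean p t - c) ^ 2) / (2 * b)) =
        ∫ x, (Real.exp (t * x) * p x - (2 * b)⁻¹ * ((x - c) ^ 2 * (Real.exp (t * x) * p x))) := by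
      rw [integral_sub (h.integrable_exp t) (h2.const_mul _), integral_const_mul,
        ← h.tiltExp_sub_sq, tiltExp]
      change _ = tiltMass p t - _
      generalize (∫ x, (x - c) ^ 2 * (Real.exp (t * x) * p x)) = J
      field_simp
    rw [e]
    refine integral_mono ((h.integrable_exp t).sub (h2.const_mul _)) hi fun x => ?_
    have h3 := Real.add_one_le_exp (-((x - c) ^ 2 / (2 * b)))
    have h4 := mul_le_mul_of_nonneg_right h3 (hw0 x)
    refine le_trans (le_of_eq ?_) h4
    field_simp
    ring
  · exact integral_mono hi (h.integrable_exp t) fun x => mul_le_of_le_one_left (hw0 x) (hle x)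

/-- Completing the square, `g_i` is proportional to the tilted density of parameter `α_i` damped by
the Gaussian factor of centre `a` and variance `β_i`. -/
theorem approxDensity_eq (p : ℝ → ℝ) (a : ℝ) (n : ℕ) {k : ℕ} (y : Fin k → ℝ) (i : Fin k)
    (hβ : 0 < approxVar p a n y i) (x : ℝ) :
    approxDensity p a n y i x =
      Real.exp (-((x - a) ^ 2 / (2 * approxVar p a n y i))) *
        (Real.exp (approxShift p a n y i * x) * p x) /
      ∫ u, Real.exp (-((u - a) ^ 2 / (2 * approxVar p a n y i))) *
        (Real.exp (approxShift p a n y i * u) * p u) := by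
  set b := approxVar p a n y i with hb
  set α := approxShift p a n y i with hα
  set c := (Real.sqrt (2 * Real.pi * b))⁻¹ * Real.exp (-(α * a + α ^ 2 * b / 2)) with hc
  have hc0 : c ≠ 0 := by
    have := Real.pi_pos
    positivity
  have e : ∀ u, approxKernel p a n y i u =
      c * (Real.exp (-((u - a) ^ 2 / (2 * b))) * (Real.exp (α * u) * p u)) := by
    intro u
    rw [approxKernel, gaussianPDFReal, ← hb, ← hα, Real.coe_toNNReal _ hβ.le, hc]
    have : Real.exp (-(u - (α * b + a)) ^ 2 / (2 * b)) = Real.exp (-(α * a + α ^ 2 * b / 2)) *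
        (Real.exp (-((u - a) ^ 2 / (2 * b))) * Real.exp (α * u)) := by
      rw [← Real.exp_add, ← Real.exp_add]
      congr 1
      field_simp
      ring
    rw [this]
    ring
  simp only [approxDensity, e]
  rw [integral_const_mul, mul_inv]
  generalize (∫ u, Real.exp (-((u - a) ^ 2 / (2 * b))) * (Real.exp (α * u) * p u)) = J
  field_simp

/-! ### Asymptotics under fast growth of the conditioning level -/

/-- The ratio `a_n / (s √n)`, where `s = s(t)` with `m(t) = a_n`. -/
def growthRatio (p : ℝ → ℝ) (a : ℕ → ℝ) (n : ℕ) : ℝ :=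
  a n / (Real.sqrt (tiltVar p (tiltParam p (a n))) * Real.sqrt n)

theorem FastGrowth.exists_bounds {p : ℝ → ℝ} {a : ℕ → ℝ} (hf : FastGrowth p a) :
    ∃ c₁ c₂ : ℝ, 0 < c₁ ∧ ∀ᶠ n in atTop, c₁ ≤ growthRatio p a n ∧ growthRatio p a n ≤ c₂ := by
  obtain ⟨h1, h2⟩ := hf
  obtain ⟨c₁, hc0, hc₁⟩ := EReal.lt_iff_exists_real_btwn.1 h1
  obtain ⟨c₂, hc₂, -⟩ := EReal.lt_iff_exists_real_btwn.1 h2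
  refine ⟨c₁, c₂, by exact_mod_cast hc0, ?_⟩
  filter_upwards [eventually_lt_of_lt_liminf hc₁, eventually_lt_of_limsup_lt hc₂] with n k1 k2
  exact ⟨(EReal.coe_lt_coe_iff.1 k1).le, (EReal.coe_lt_coe_iff.1 k2).le⟩

theorem tendsto_natCast_div_sub (j : ℝ) :
    Tendsto (fun n : ℕ => (n : ℝ) / (n - j)) atTop (𝓝 1) := by
  have h1 : Tendsto (fun n : ℕ => j * (n : ℝ)⁻¹) atTop (𝓝 0) := by
    simpa using tendsto_inv_atTop_nhds_zero_nat.const_mul j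
  have h2 := (h1.const_sub 1).inv₀ (by norm_num)
  rw [sub_zero, inv_one] at h2
  refine h2.congr' ?_
  filter_upwards [eventually_gt_atTop 0] with n hn
  have : (n : ℝ) ≠ 0 := by positivity
  rw [← inv_div, sub_div, div_self this, div_eq_mul_inv]

/-- A sequence of levels `a` tending to infinity, with `a_n / (s √n)` bounded away from zero and
infinity. -/
structure IsFastSequence (p : ℝ → ℝ) (a : ℕ → ℝ) (c₁ c₂ : ℝ) : Prop where
  tendsto : Tendsto a atTop atTop
  pos : 0 < c₁
  bounds : ∀ᶠ n in atTop, c₁ ≤ growthRatio p a n ∧ growthRatio p a n ≤ c₂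

namespace IsFastSequence

variable {p : ℝ → ℝ} {K : ℝ} {a : ℕ → ℝ} {c₁ c₂ : ℝ} (f : IsFastSequence p a c₁ c₂)
include f

theorem isBigO_growthRatio : (fun n => growthRatio p a n) =O[atTop] fun _ => (1 : ℝ) := by
  refine Asymptotics.IsBigO.of_bound c₂ ?_
  filter_upwards [f.bounds] with n hn
  rw [norm_one, mul_one, Real.norm_of_nonneg (f.pos.le.trans hn.1)]
  exact hn.2

theorem isBigO_sq_growthRatio : (fun n => growthRatio p a n ^ 2) =O[atTop] fun _ => (1 : ℝ) := by
  simpa using f.isBigO_growthRatio.pow 2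

theorem tendsto_inv_sqrt_mul : Tendsto (fun n => (Real.sqrt (tiltVar p (tiltParam p (a n))) *
    Real.sqrt n)⁻¹) atTop (𝓝 0) := by
  have := tendsto_mul_zero_of_isBigO_one f.isBigO_growthRatio
    (tendsto_inv_atTop_zero.comp f.tendsto)
  refine this.congr' ?_
  filter_upwards [f.tendsto.eventually_gt_atTop 0] with n hn
  simp only [Function.comp_apply, growthRatio]
  rw [div_mul_eq_mul_div, mul_inv_cancel₀ hn.ne', one_div]

theorem tendsto_sqrt_div : Tendsto (fun n => Real.sqrt (tiltVar p (tiltParam p (a n))) / a n) atTop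
    (𝓝 0) := by
  have hlim : Tendsto (fun n : ℕ => c₁⁻¹ * (Real.sqrt n)⁻¹) atTop (𝓝 0) := by
    simpa using ((tendsto_inv_atTop_zero.comp Real.tendsto_sqrt_atTop).comp
      tendsto_natCast_atTop_atTop).const_mul c₁⁻¹
  refine squeeze_zero' ?_ ?_ hlim
  · filter_upwards [f.tendsto.eventually_gt_atTop 0] with n hn
    positivity
  · filter_upwards [f.tendsto.eventually_gt_atTop 0, f.bounds, eventually_gt_atTop 0]
      with n hn hb hn0
    have hc := f.pos
    have hq : 0 < Real.sqrt n := Real.sqrt_pos.2 (by exact_mod_cast hn0)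
    have hr : 0 < growthRatio p a n := hc.trans_le hb.1
    have hs : 0 < Real.sqrt (tiltVar p (tiltParam p (a n))) := by
      refine lt_of_le_of_ne (Real.sqrt_nonneg _) fun h0 => ?_
      rw [growthRatio, ← h0, zero_mul, div_zero] at hr
      exact hr.false
    have e : Real.sqrt (tiltVar p (tiltParam p (a n))) / a n =
        (growthRatio p a n)⁻¹ * (Real.sqrt n)⁻¹ := by
      rw [growthRatio]; field_simp
    rw [e]
    exact mul_le_mul_of_nonneg_right (inv_anti₀ hc hb.1) (by positivity)

theorem tendsto_tiltParam (h : HasStableTilts p K) :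
    Tendsto (fun n => tiltParam p (a n)) atTop atTop := h.tendsto_tiltParam.comp f.tendsto

/-- The conditional density, expressed through the tilted law of mean `a_n`. The Gaussian factor
comes from the displacement `k a_n` of the remaining sum, of order `√n s`. -/
theorem exists_condDensity_eq (h : HasStableTilts p K) {k : ℕ} (y : Fin k → ℝ) :
    ∃ ρ : ℕ → ℝ, Tendsto ρ atTop (𝓝 1) ∧ ∀ᶠ n in atTop, condDensity p n k (n * a n) y =
      (∏ i, p (y i) * (Real.exp (tiltParam p (a n) * y i) / tiltMass p (tiltParam p (a n)))) *
        Real.exp (-((k : ℝ) ^ 2 * growthRatio p a n ^ 2 / 2)) * ρ n := by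
  set t : ℕ → ℝ := fun n => tiltParam p (a n) with ht
  set r : ℕ → ℝ := growthRatio p a with hr
  set s : ℕ → ℝ := fun n => Real.sqrt (tiltVar p (t n)) with hs
  set Y := ∑ i, y i with hY
  set z : ℕ → ℝ := fun n => (k * a n - Y) / s n with hz
  set c₀ := (Real.sqrt (2 * Real.pi))⁻¹ with hc₀
  have hc₀0 : 0 < c₀ := inv_pos.2 (Real.sqrt_pos.2 (by positivity))
  have htlim : Tendsto t atTop atTop := f.tendsto_tiltParam h
  have hU := h.tendsto_sqrt_mul_sumDensity_sub htlim (tendsto_sub_atTop_nat k) z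
  have hV := h.tendsto_sqrt_mul_sumDensity_sub htlim tendsto_id (fun _ => 0)
  simp only [id, ne_eq, OfNat.ofNat_ne_zero, not_false_eq_true, zero_pow, zero_div, neg_zero,
    Real.exp_zero, mul_one] at hV
  rw [← hc₀] at hU hV
  set U : ℕ → ℝ := fun n => Real.sqrt ((n - k : ℕ) : ℝ) * sumDensity (stdTilt p (t n)) (n - k) (z n)
    with hUdef
  set V : ℕ → ℝ := fun n => Real.sqrt n * sumDensity (stdTilt p (t n)) n 0 with hVdef
  have hV' : Tendsto V atTop (𝓝 c₀) := by simpa using hV.add_const c₀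
  -- the error in the Gaussian exponent
  set X : ℕ → ℝ := fun n => z n ^ 2 / (2 * ((n - k : ℕ) : ℝ)) - (k : ℝ) ^ 2 * r n ^ 2 / 2 with hX
  have hq := tendsto_natCast_div_sub (k : ℝ)
  have hXlim : Tendsto X atTop (𝓝 0) := by
    have hb : Tendsto (fun n => Y * (s n * Real.sqrt n)⁻¹) atTop (𝓝 0) := by
      simpa using f.tendsto_inv_sqrt_mul.const_mul Y
    have h1 := tendsto_mul_zero_of_isBigO_one f.isBigO_sq_growthRatio
      (show Tendsto (fun n : ℕ => (n : ℝ) / (n - k) - 1) atTop (𝓝 0) by simpa using hq.sub_const 1)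
    have h2 := tendsto_mul_zero_of_isBigO_one f.isBigO_growthRatio
      (show Tendsto (fun n : ℕ => Y * (s n * Real.sqrt n)⁻¹ * ((n : ℝ) / (n - k))) atTop (𝓝 0) by
        simpa using hb.mul hq)
    have h3 : Tendsto (fun n : ℕ => (Y * (s n * Real.sqrt n)⁻¹) ^ 2 * ((n : ℝ) / (n - k))) atTop
        (𝓝 0) := by simpa using (hb.pow 2).mul hq
    have h4 := ((h1.const_mul ((k : ℝ) ^ 2 / 2)).sub (h2.const_mul (k : ℝ))).add
      (h3.const_mul (1 / 2))
    simp only [mul_zero, sub_zero, add_zero] at h4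
    refine h4.congr' ?_
    filter_upwards [eventually_gt_atTop k, htlim.eventually h.tiltVar_pos] with n hn hv
    have hn0 : (0 : ℝ) < n := by exact_mod_cast (Nat.zero_le k).trans_lt hn
    have hnk : (0 : ℝ) < n - k := by
      have : (k : ℝ) < n := by exact_mod_cast hn
      linarith
    have hs0 : 0 < s n := Real.sqrt_pos.2 hv
    have hsq : 0 < Real.sqrt (n : ℝ) := Real.sqrt_pos.2 hn0
    have e : z n ^ 2 / (2 * ((n - k : ℕ) : ℝ)) =
        1 / 2 * (k * r n - Y * (s n * Real.sqrt n)⁻¹) ^ 2 * (n / (n - k)) := by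
      have e1 : (k : ℝ) * r n - Y * (s n * Real.sqrt n)⁻¹ = z n / Real.sqrt n := by
        simp only [hz, hr, growthRatio]
        change (k : ℝ) * (a n / (s n * Real.sqrt n)) - _ = _
        field_simp
      rw [e1, div_pow (z n) (Real.sqrt n), Real.sq_sqrt hn0.le, Nat.cast_sub hn.le]
      field_simp
    simp only [hX]
    rw [e]
    ring
  have hEO : (fun n => Real.exp ((k : ℝ) ^ 2 * r n ^ 2 / 2)) =O[atTop] fun _ => (1 : ℝ) := by
    refine Asymptotics.IsBigO.of_bound (Real.exp ((k : ℝ) ^ 2 * c₂ ^ 2 / 2)) ?_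
    filter_upwards [f.bounds] with n hn
    rw [norm_one, mul_one, Real.norm_of_nonneg (Real.exp_pos _).le]
    refine Real.exp_le_exp.2 ?_
    have : r n ^ 2 ≤ c₂ ^ 2 := pow_le_pow_left₀ (f.pos.le.trans hn.1) hn.2 2
    have := mul_le_mul_of_nonneg_left this (sq_nonneg (k : ℝ))
    linarith
  have hU' : Tendsto (fun n => Real.exp ((k : ℝ) ^ 2 * r n ^ 2 / 2) * U n) atTop (𝓝 c₀) := by
    have h1 := tendsto_mul_zero_of_isBigO_one hEO hU
    have h2 : Tendsto (fun n => c₀ * Real.exp (-X n)) atTop (𝓝 c₀) := by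
      have := (Real.continuous_exp.tendsto _).comp hXlim.neg
      simpa using this.const_mul c₀
    have h3 := h1.add h2
    rw [zero_add] at h3
    refine h3.congr fun n => ?_
    have : Real.exp (-X n) = Real.exp ((k : ℝ) ^ 2 * r n ^ 2 / 2) *
        Real.exp (-(z n ^ 2 / (2 * ((n - k : ℕ) : ℝ)))) := by
      rw [← Real.exp_add]; simp only [hX]; ring_nf
    rw [this]
    ring
  have hQ : Tendsto (fun n : ℕ => Real.sqrt ((n : ℝ) / (n - k))) atTop (𝓝 1) := by
    have := (Real.continuous_sqrt.tendsto 1).comp hq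
    rwa [Real.sqrt_one] at this
  refine ⟨fun n => Real.exp ((k : ℝ) ^ 2 * r n ^ 2 / 2) * U n / V n *
    Real.sqrt ((n : ℝ) / (n - k)), ?_, ?_⟩
  · have := (hU'.div hV' hc₀0.ne').mul hQ
    rwa [div_self hc₀0.ne', one_mul] at this
  · filter_upwards [eventually_gt_atTop k, htlim.eventually h.tiltVar_pos,
      f.tendsto.eventually h.eventually_tiltMean_tiltParam, hV'.eventually (lt_mem_nhds hc₀0)]
      with n hn hv hm hVpos
    have hn0 : (0 : ℝ) < n := by exact_mod_cast (Nat.zero_le k).trans_lt hn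
    have hnk : (0 : ℝ) < n - k := by
      have : (k : ℝ) < n := by exact_mod_cast hn
      linarith
    have hs0 : 0 < s n := Real.sqrt_pos.2 hv
    have hΦ := h.tail.tiltMass_pos (t n)
    have hmt : tiltMean p (t n) = a n := hm
    obtain ⟨l, rfl⟩ : ∃ l, n = k + (l + 1) := ⟨n - k - 1, by omega⟩
    set n := k + (l + 1) with hndef
    have hnk' : n - k = l + 1 := by omega
    have hcast : ((l : ℝ) + 1) = n - k := by rw [hndef]; push_cast; ring
    have s1 := h.tail.sumDensity_stdTilt hv l (z n)
    have s2 := h.tail.sumDensity_stdTilt hv (k + l) 0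
    -- both sums are evaluated at the points that belong to the value `n a_n` of the whole sum
    have a1 : ((l : ℝ) + 1) * tiltMean p (t n) + Real.sqrt (tiltVar p (t n)) * z n =
        n * a n - Y := by
      change _ + s n * ((k * a n - Y) / s n) = _
      rw [mul_div_cancel₀ _ hs0.ne', hmt, hcast]
      ring
    have a2 : (((k + l : ℕ) : ℝ) + 1) * tiltMean p (t n) + Real.sqrt (tiltVar p (t n)) * 0 =
        n * a n := by
      rw [hmt, hndef]; push_cast; ring
    rw [a1] at s1
    rw [a2] at s2
    have hn1 : k + l + 1 = n := by omega
    rw [hn1] at s2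
    rw [← hnk'] at s1
    have hsn : 0 < Real.sqrt (n : ℝ) := Real.sqrt_pos.2 hn0
    have hsk : 0 < Real.sqrt ((n : ℝ) - k) := Real.sqrt_pos.2 hnk
    have hF : sumDensity (stdTilt p (t n)) n 0 ≠ 0 := by
      intro h0
      simp only [hVdef, h0, mul_zero] at hVpos
      exact hVpos.false
    have hp : sumDensity p n (n * a n) ≠ 0 := by
      intro h0
      rw [h0, mul_zero, zero_div] at s2
      exact hF s2
    have hprod : ∏ i, p (y i) * (Real.exp (t n * y i) / tiltMass p (t n)) =
        (∏ i, p (y i)) * (Real.exp (t n * Y) / tiltMass p (t n) ^ k) := by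
      rw [Finset.prod_mul_distrib, Finset.prod_div_distrib, ← Real.exp_sum, ← Finset.mul_sum,
        Finset.prod_const, Finset.card_univ, Fintype.card_fin]
    have hUV : U n / V n * Real.sqrt ((n : ℝ) / (n - k)) =
        sumDensity (stdTilt p (t n)) (n - k) (z n) / sumDensity (stdTilt p (t n)) n 0 := by
      simp only [hUdef, hVdef]
      rw [Nat.cast_sub hn.le, Real.sqrt_div hn0.le]
      field_simp
    have hexp : Real.exp (-((k : ℝ) ^ 2 * r n ^ 2 / 2)) * Real.exp ((k : ℝ) ^ 2 * r n ^ 2 / 2) =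
        1 := by rw [← Real.exp_add, neg_add_cancel, Real.exp_zero]
    have hpow : tiltMass p (t n) ^ n = tiltMass p (t n) ^ k * tiltMass p (t n) ^ (n - k) := by
      rw [← pow_add]; congr 1; omega
    have hexp2 : Real.exp (t n * (n * a n)) =
        Real.exp (t n * (n * a n - Y)) * Real.exp (t n * Y) := by
      rw [← Real.exp_add]; ring_nf
    change _ = (∏ i, p (y i) * (Real.exp (t n * y i) / tiltMass p (t n))) * _ * _
    calc condDensity p n k (n * a n) y
        = (∏ i, p (y i)) * (Real.exp (t n * Y) / tiltMass p (t n) ^ k) *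
          (sumDensity (stdTilt p (t n)) (n - k) (z n) / sumDensity (stdTilt p (t n)) n 0) := by
          rw [s1, s2, condDensity, jointDensity, hpow, hexp2, ← hY]
          change _ = _ * (s n * _ * _ / _ / (s n * _ * _ / _))
          field_simp
      _ = (∏ i, p (y i)) * (Real.exp (t n * Y) / tiltMass p (t n) ^ k) *
          (Real.exp (-((k : ℝ) ^ 2 * r n ^ 2 / 2)) * Real.exp ((k : ℝ) ^ 2 * r n ^ 2 / 2)) *
          (U n / V n * Real.sqrt ((n : ℝ) / (n - k))) := by rw [hexp, mul_one, hUV]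
      _ = _ := by rw [hprod]; ring

end IsFastSequence

namespace IsFastSequence

variable {p : ℝ → ℝ} {K : ℝ} {a : ℕ → ℝ} {c₁ c₂ : ℝ} (f : IsFastSequence p a c₁ c₂)
include f

section RemainingMean

variable {k : ℕ} (y : Fin k → ℝ) (i : Fin k)

theorem tendsto_remMean_div :
    Tendsto (fun n => remMean (a n) n y i / a n) atTop (𝓝 1) := by
  set Y := ∑ j ∈ Finset.Iio i, y j with hY
  have h1 : Tendsto (fun n : ℕ => Y * ((n : ℝ)⁻¹ * (a n)⁻¹)) atTop (𝓝 0) := by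
    simpa using (tendsto_inv_atTop_nhds_zero_nat.mul
      (tendsto_inv_atTop_zero.comp f.tendsto)).const_mul Y
  have h2 := (tendsto_natCast_div_sub ((i : ℕ) : ℝ)).mul (h1.const_sub 1)
  rw [sub_zero, mul_one] at h2
  refine h2.congr' ?_
  filter_upwards [eventually_gt_atTop 0, f.tendsto.eventually_gt_atTop 0] with n hn ha
  have hn0 : (n : ℝ) ≠ 0 := by positivity
  rw [remMean, ← hY]
  field_simp

theorem tendsto_remMean : Tendsto (fun n => remMean (a n) n y i) atTop atTop := by
  refine ((f.tendsto_remMean_div y i).pos_mul_atTop one_pos f.tendsto).congr' ?_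
  filter_upwards [f.tendsto.eventually_gt_atTop 0] with n ha
  rw [div_mul_cancel₀ _ ha.ne']

theorem tendsto_remParam (h : HasStableTilts p K) :
    Tendsto (fun n => remParam p (a n) n y i) atTop atTop :=
  h.tendsto_tiltParam.comp (f.tendsto_remMean y i)

omit f in
theorem eventually_remMean_sub : ∀ᶠ n : ℕ in atTop, remMean (a n) n y i - a n =
    ((i : ℕ) * a n - ∑ j ∈ Finset.Iio i, y j) / (n - (i : ℕ)) := by
  filter_upwards [eventually_gt_atTop (i : ℕ)] with n hn
  have : (0 : ℝ) < n - (i : ℕ) := by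
    have : ((i : ℕ) : ℝ) < n := by exact_mod_cast hn
    linarith
  rw [remMean]
  field_simp
  ring

theorem tendsto_sqrt_mul_remParam_sub (h : HasStableTilts p K) :
    Tendsto (fun n => Real.sqrt (tiltVar p (tiltParam p (a n))) *
      (remParam p (a n) n y i - tiltParam p (a n))) atTop (𝓝 0) := by
  set Y := ∑ j ∈ Finset.Iio i, y j with hY
  refine h.tendsto_sqrt_mul_sub (f.tendsto_tiltParam h) (f.tendsto_remParam y i h) ?_
  have hq := tendsto_natCast_div_sub ((i : ℕ) : ℝ)
  have hn' : Tendsto (fun n : ℕ => (Real.sqrt n)⁻¹) atTop (𝓝 0) :=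
    (tendsto_inv_atTop_zero.comp Real.tendsto_sqrt_atTop).comp tendsto_natCast_atTop_atTop
  have hw : Tendsto (fun n : ℕ => (Real.sqrt n)⁻¹ * ((n : ℝ) / (n - (i : ℕ)))) atTop (𝓝 0) := by
    simpa using hn'.mul hq
  have h1 := tendsto_mul_zero_of_isBigO_one f.isBigO_growthRatio hw
  have h2 := (f.tendsto_inv_sqrt_mul.const_mul Y).mul hw
  have h3 := (h1.const_mul ((i : ℕ) : ℝ)).sub h2
  simp only [mul_zero, sub_zero] at h3
  refine h3.congr' ?_
  filter_upwards [eventually_gt_atTop (i : ℕ), eventually_remMean_sub (a := a) y i,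
    f.tendsto.eventually h.eventually_tiltMean_tiltParam,
    (f.tendsto_remMean y i).eventually h.eventually_tiltMean_tiltParam,
    (f.tendsto_tiltParam h).eventually h.tiltVar_pos] with n hn k1 k2 k3 k4
  have hn0 : (0 : ℝ) < n := by exact_mod_cast (Nat.zero_le _).trans_lt hn
  have hni : (0 : ℝ) < n - (i : ℕ) := by
    have : ((i : ℕ) : ℝ) < n := by exact_mod_cast hn
    linarith
  have hs := Real.sqrt_pos.2 k4
  have hsq := Real.sqrt_pos.2 hn0
  rw [remParam, k3, k2, k1, growthRatio, ← hY]
  field_simp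
  rw [Real.sq_sqrt hn0.le]

theorem tendsto_tiltVar_remParam_div (h : HasStableTilts p K) :
    Tendsto (fun n => tiltVar p (remParam p (a n) n y i) / tiltVar p (tiltParam p (a n))) atTop
      (𝓝 1) :=
  h.tendsto_tiltVar_div (f.tendsto_tiltParam h) (f.tendsto_remParam y i h)
    (f.tendsto_sqrt_mul_remParam_sub y i h)

/-- `a (t_i - t) = i r² + o(1)`, with `t = t_(n)` and `r` the growth ratio. -/
theorem tendsto_mul_remParam_sub (h : HasStableTilts p K) :
    Tendsto (fun n => a n * (remParam p (a n) n y i - tiltParam p (a n)) -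
      (i : ℕ) * growthRatio p a n ^ 2) atTop (𝓝 0) := by
  set Y := ∑ j ∈ Finset.Iio i, y j with hY
  obtain ⟨γ, hγ, hγe⟩ := h.exists_tiltMean_sub_eq (f.tendsto_tiltParam h)
    (f.tendsto_remParam y i h) (f.tendsto_sqrt_mul_remParam_sub y i h)
  have hG : Tendsto (fun n : ℕ => (γ n)⁻¹ * ((n : ℝ) / (n - (i : ℕ)))) atTop (𝓝 1) := by
    simpa using (hγ.inv₀ one_ne_zero).mul (tendsto_natCast_div_sub ((i : ℕ) : ℝ))
  have h1 : Tendsto (fun n : ℕ => (i : ℕ) * ((γ n)⁻¹ * ((n : ℝ) / (n - (i : ℕ))) - 1) -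
      Y * ((a n)⁻¹ * ((γ n)⁻¹ * ((n : ℝ) / (n - (i : ℕ)))))) atTop (𝓝 0) := by
    have k1 := (hG.sub_const 1).const_mul ((i : ℕ) : ℝ)
    have k2 := ((tendsto_inv_atTop_zero.comp f.tendsto).mul hG).const_mul Y
    simpa using k1.sub k2
  have h2 := tendsto_mul_zero_of_isBigO_one f.isBigO_sq_growthRatio h1
  refine h2.congr' ?_
  filter_upwards [eventually_gt_atTop (i : ℕ), eventually_remMean_sub (a := a) y i,
    f.tendsto.eventually h.eventually_tiltMean_tiltParam,
    (f.tendsto_remMean y i).eventually h.eventually_tiltMean_tiltParam,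
    (f.tendsto_tiltParam h).eventually h.tiltVar_pos, hγe,
    hγ.eventually (lt_mem_nhds one_half_lt_one),
    f.tendsto.eventually_gt_atTop 0]
    with n hn k1 k2 k3 k4 k5 k6 k7
  have hn0 : (0 : ℝ) < n := by exact_mod_cast (Nat.zero_le _).trans_lt hn
  have hni : (0 : ℝ) < n - (i : ℕ) := by
    have : ((i : ℕ) : ℝ) < n := by exact_mod_cast hn
    linarith
  have hγ0 : 0 < γ n := by linarith
  have hr : growthRatio p a n ^ 2 = a n ^ 2 / (tiltVar p (tiltParam p (a n)) * n) := by
    rw [growthRatio, div_pow, mul_pow, Real.sq_sqrt k4.le, Real.sq_sqrt hn0.le]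
  have hd : remParam p (a n) n y i - tiltParam p (a n) =
      (γ n)⁻¹ * (((i : ℕ) * a n - Y) / (n - (i : ℕ))) / tiltVar p (tiltParam p (a n)) := by
    rw [← k1, eq_div_iff k4.ne', ← div_eq_inv_mul, eq_div_iff hγ0.ne']
    rw [k2, show tiltMean p (remParam p (a n) n y i) = remMean (a n) n y i from k3] at k5
    rw [k5]
    ring
  rw [hd, hr]
  field_simp
  ring

/-- `a (α_i - t_i) = o(1)`, because the third cumulant is negligible compared with the mean. -/
theorem tendsto_mul_approxShift_sub_remParam (h : HasStableTilts p K) :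
    Tendsto (fun n => a n * (approxShift p (a n) n y i - remParam p (a n) n y i)) atTop (𝓝 0) := by
  have hthird : Tendsto (fun n => tiltThird p (remParam p (a n) n y i) / remMean (a n) n y i) atTop
      (𝓝 0) := by
    refine (h.tendsto_third.comp (f.tendsto_remParam y i h)).congr' ?_
    filter_upwards [(f.tendsto_remMean y i).eventually h.eventually_tiltMean_tiltParam] with n hn
    simp only [Function.comp_apply]
    rw [show tiltMean p (remParam p (a n) n y i) = remMean (a n) n y i from hn]
  have h1 := (((hthird.mul (f.tendsto_remMean_div y i)).mul
    (tendsto_natCast_div_sub ((i : ℕ) : ℝ))).mul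
    ((f.tendsto_tiltVar_remParam_div y i h).inv₀ one_ne_zero)).const_mul (1 / 2)
  simp only [zero_mul, mul_zero] at h1
  have h2 := tendsto_mul_zero_of_isBigO_one f.isBigO_sq_growthRatio h1
  refine h2.congr' ?_
  filter_upwards [eventually_gt_atTop (i : ℕ), (f.tendsto_tiltParam h).eventually h.tiltVar_pos,
    (f.tendsto_remParam y i h).eventually h.tiltVar_pos,
    (f.tendsto_remMean y i).eventually_gt_atTop 0, f.tendsto.eventually_gt_atTop 0]
    with n hn k1 k2 k3 k4
  have hn0 : (0 : ℝ) < n := by exact_mod_cast (Nat.zero_le _).trans_lt hn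
  have hni : (0 : ℝ) < n - (i : ℕ) := by
    have : ((i : ℕ) : ℝ) < n := by exact_mod_cast hn
    linarith
  have hr : growthRatio p a n ^ 2 = a n ^ 2 / (tiltVar p (tiltParam p (a n)) * n) := by
    rw [growthRatio, div_pow, mul_pow, Real.sq_sqrt k1.le, Real.sq_sqrt hn0.le]
  rw [hr, approxShift, add_sub_cancel_left]
  field_simp

/-- `a (α_i - t) = i r² + o(1)`. -/
theorem tendsto_mul_approxShift_sub (h : HasStableTilts p K) :
    Tendsto (fun n => a n * (approxShift p (a n) n y i - tiltParam p (a n)) -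
      (i : ℕ) * growthRatio p a n ^ 2) atTop (𝓝 0) := by
  have := (f.tendsto_mul_approxShift_sub_remParam y i h).add (f.tendsto_mul_remParam_sub y i h)
  rw [add_zero] at this
  refine this.congr fun n => ?_
  ring

theorem isBigO_mul_approxShift_sub (h : HasStableTilts p K) :
    (fun n => a n * (approxShift p (a n) n y i - tiltParam p (a n))) =O[atTop]
      fun _ => (1 : ℝ) := by
  have h1 := ((f.tendsto_mul_approxShift_sub y i h).isBigO_one ℝ).add
    (f.isBigO_sq_growthRatio.const_mul_left ((i : ℕ) : ℝ))
  simpa using h1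

theorem tendsto_approxShift_sub (h : HasStableTilts p K) :
    Tendsto (fun n => approxShift p (a n) n y i - tiltParam p (a n)) atTop (𝓝 0) := by
  refine (tendsto_mul_zero_of_isBigO_one (f.isBigO_mul_approxShift_sub y i h)
    (tendsto_inv_atTop_zero.comp f.tendsto)).congr' ?_
  filter_upwards [f.tendsto.eventually_gt_atTop 0] with n hn
  simp only [Function.comp_apply]
  field_simp

theorem tendsto_sqrt_mul_approxShift_sub (h : HasStableTilts p K) :
    Tendsto (fun n => Real.sqrt (tiltVar p (tiltParam p (a n))) *
      (approxShift p (a n) n y i - tiltParam p (a n))) atTop (𝓝 0) := by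
  refine (tendsto_mul_zero_of_isBigO_one (f.isBigO_mul_approxShift_sub y i h)
    f.tendsto_sqrt_div).congr' ?_
  filter_upwards [f.tendsto.eventually_gt_atTop 0] with n hn
  field_simp

theorem tendsto_approxShift (h : HasStableTilts p K) :
    Tendsto (fun n => approxShift p (a n) n y i) atTop atTop := by
  refine ((f.tendsto_tiltParam h).atTop_add (f.tendsto_approxShift_sub y i h)).congr fun n => ?_
  ring

theorem eventually_approxVar_pos (h : HasStableTilts p K) :
    ∀ᶠ n in atTop, 0 < approxVar p (a n) n y i := by
  filter_upwards [eventually_gt_atTop (i : ℕ), (f.tendsto_remParam y i h).eventually h.tiltVar_pos]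
    with n hn k2
  have : ((i : ℕ) : ℝ) < n := by exact_mod_cast hn
  exact mul_pos (by linarith) k2

theorem tendsto_mul_tiltVar_div_approxVar (h : HasStableTilts p K) :
    Tendsto (fun n : ℕ => n * tiltVar p (tiltParam p (a n)) / approxVar p (a n) n y i) atTop
      (𝓝 1) := by
  have := (tendsto_natCast_div_sub ((i : ℕ) : ℝ)).mul
    ((f.tendsto_tiltVar_remParam_div y i h).inv₀ one_ne_zero)
  rw [inv_one, one_mul] at this
  refine this.congr fun n => ?_
  rw [inv_div, div_mul_div_comm, approxVar]

/-- The Gaussian factor of `g_i` is asymptotically constant, equal to `exp (-r² / 2)`. -/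
theorem tendsto_sub_sq_div_approxVar (h : HasStableTilts p K) (x : ℝ) :
    Tendsto (fun n => (x - a n) ^ 2 / (2 * approxVar p (a n) n y i) - growthRatio p a n ^ 2 / 2)
      atTop (𝓝 0) := by
  have h1 : Tendsto (fun n => (x * (a n)⁻¹ - 1) ^ 2) atTop (𝓝 1) := by
    simpa using (((tendsto_inv_atTop_zero.comp f.tendsto).const_mul x).sub_const 1).pow 2
  have h2 := (((f.tendsto_mul_tiltVar_div_approxVar y i h).mul h1).sub_const 1).const_mul (1 / 2)
  rw [one_mul, sub_self, mul_zero] at h2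
  refine (tendsto_mul_zero_of_isBigO_one f.isBigO_sq_growthRatio h2).congr' ?_
  filter_upwards [eventually_gt_atTop 0, (f.tendsto_tiltParam h).eventually h.tiltVar_pos,
    f.eventually_approxVar_pos y i h, f.tendsto.eventually_gt_atTop 0] with n hn k1 k2 k3
  have hn0 : (0 : ℝ) < n := by exact_mod_cast hn
  have hr : growthRatio p a n ^ 2 = a n ^ 2 / (tiltVar p (tiltParam p (a n)) * n) := by
    rw [growthRatio, div_pow, mul_pow, Real.sq_sqrt k1.le, Real.sq_sqrt hn0.le]
  rw [hr]
  field_simp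

/-- The Gaussian factor does not affect the normalization of `g_i`, since the standard deviation
of the tilted law is negligible compared with `√β_i`. -/
theorem tendsto_tiltMass_div_integral (h : HasStableTilts p K) :
    Tendsto (fun n => tiltMass p (approxShift p (a n) n y i) /
      ∫ u, Real.exp (-((u - a n) ^ 2 / (2 * approxVar p (a n) n y i))) *
        (Real.exp (approxShift p (a n) n y i * u) * p u)) atTop (𝓝 1) := by
  set α : ℕ → ℝ := fun n => approxShift p (a n) n y i with hα
  set b : ℕ → ℝ := fun n => approxVar p (a n) n y i with hb
  set t : ℕ → ℝ := fun n => tiltParam p (a n) with ht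
  set J : ℕ → ℝ := fun n => ∫ u, Real.exp (-((u - a n) ^ 2 / (2 * b n))) *
    (Real.exp (α n * u) * p u) with hJ
  have hlt := f.tendsto_tiltParam h
  have hla := f.tendsto_approxShift y i h
  have hsd := f.tendsto_sqrt_mul_approxShift_sub y i h
  obtain ⟨γ, hγ, hγe⟩ := h.exists_tiltMean_sub_eq hlt hla hsd
  have hvb : Tendsto (fun n => tiltVar p (t n) / b n) atTop (𝓝 0) := by
    have := tendsto_inv_atTop_nhds_zero_nat.mul (f.tendsto_mul_tiltVar_div_approxVar y i h)
    rw [zero_mul] at this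
    refine this.congr' ?_
    filter_upwards [eventually_gt_atTop 0] with n hn
    have hn0 : (n : ℝ) ≠ 0 := by positivity
    field_simp
    rfl
  have hlow : Tendsto (fun n => 1 - (tiltVar p (α n) + (tiltMean p (α n) - a n) ^ 2) / (2 * b n))
      atTop (𝓝 1) := by
    have h1 := ((hvb.mul ((h.tendsto_tiltVar_div hlt hla hsd).add ((hγ.mul hsd).pow 2))).const_mul
      (1 / 2)).const_sub 1
    simp only [zero_mul, mul_zero, sub_zero] at h1
    refine h1.congr' ?_
    filter_upwards [hγe, f.tendsto.eventually h.eventually_tiltMean_tiltParam,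
      hlt.eventually h.tiltVar_pos, f.eventually_approxVar_pos y i h] with n k1 k2 k3 k4
    rw [k2] at k1
    have hbn : 0 < b n := k4
    have hvn : 0 < tiltVar p (t n) := k3
    change _ = 1 - (tiltVar p (α n) + (tiltMean p (approxShift p (a n) n y i) - a n) ^ 2) / _
    rw [k1]
    change 1 - 1 / 2 * (tiltVar p (t n) / b n * (tiltVar p (α n) / tiltVar p (t n) +
      (γ n * (Real.sqrt (tiltVar p (t n)) * (α n - t n))) ^ 2)) =
      1 - (tiltVar p (α n) + (γ n * (tiltVar p (t n) * (α n - t n))) ^ 2) / (2 * b n)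
    rw [mul_pow (γ n), mul_pow (Real.sqrt _), Real.sq_sqrt hvn.le]
    field_simp
  have hJlim : Tendsto (fun n => J n / tiltMass p (α n)) atTop (𝓝 1) := by
    refine tendsto_of_tendsto_of_tendsto_of_le_of_le' hlow tendsto_const_nhds ?_ ?_
    · filter_upwards [f.eventually_approxVar_pos y i h] with n hn
      rw [le_div_iff₀ (h.tail.tiltMass_pos _), mul_comm]
      exact (h.tail.integral_gaussian_mul_bounds (α n) (a n) hn).1
    · filter_upwards [f.eventually_approxVar_pos y i h] with n hn
      rw [div_le_one (h.tail.tiltMass_pos _)]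
      exact (h.tail.integral_gaussian_mul_bounds (α n) (a n) hn).2
  have := hJlim.inv₀ one_ne_zero
  rw [inv_one] at this
  exact this.congr fun n => inv_div _ _

/-- The approximating density `g_i` at `y_i`, expressed through the tilted law of mean `a_n`. -/
theorem exists_approxDensity_eq (h : HasStableTilts p K) :
    ∃ ρ : ℕ → ℝ, Tendsto ρ atTop (𝓝 1) ∧ ∀ᶠ n in atTop, approxDensity p (a n) n y i (y i) =
      p (y i) * (Real.exp (tiltParam p (a n) * y i) / tiltMass p (tiltParam p (a n))) *
        Real.exp (-((((i : ℕ) : ℝ) + 1 / 2) * growthRatio p a n ^ 2)) * ρ n := by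
  set α : ℕ → ℝ := fun n => approxShift p (a n) n y i with hα
  set b : ℕ → ℝ := fun n => approxVar p (a n) n y i with hb
  set t : ℕ → ℝ := fun n => tiltParam p (a n) with ht
  set J : ℕ → ℝ := fun n => ∫ u, Real.exp (-((u - a n) ^ 2 / (2 * b n))) *
    (Real.exp (α n * u) * p u) with hJ
  have hE1 := f.tendsto_sub_sq_div_approxVar y i h (y i)
  have hE2 := h.tendsto_log_tiltMass_sub (f.tendsto_tiltParam h) (f.tendsto_approxShift y i h)
    (f.tendsto_sqrt_mul_approxShift_sub y i h)
  have hE3 := f.tendsto_mul_approxShift_sub y i h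
  have hE4 := (f.tendsto_approxShift_sub y i h).mul_const (y i)
  have hE := ((hE4.sub hE1).sub hE2).sub hE3
  rw [zero_mul, sub_zero, sub_zero, sub_zero] at hE
  have hexp := (Real.continuous_exp.tendsto 0).comp hE
  rw [Real.exp_zero] at hexp
  have hρ := hexp.mul (f.tendsto_tiltMass_div_integral y i h)
  rw [one_mul] at hρ
  refine ⟨_, hρ, ?_⟩
  filter_upwards [f.eventually_approxVar_pos y i h,
    f.tendsto.eventually h.eventually_tiltMean_tiltParam] with n k1 k2
  rw [approxDensity_eq p (a n) n y i k1]
  simp only [Function.comp_apply]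
  rw [k2]
  change Real.exp (-((y i - a n) ^ 2 / (2 * b n))) * (Real.exp (α n * y i) * p (y i)) / J n =
    p (y i) * (Real.exp (t n * y i) / tiltMass p (t n)) *
      Real.exp (-((((i : ℕ) : ℝ) + 1 / 2) * growthRatio p a n ^ 2)) *
      (Real.exp ((α n - t n) * y i -
        ((y i - a n) ^ 2 / (2 * b n) - growthRatio p a n ^ 2 / 2) -
        (Real.log (tiltMass p (α n)) - Real.log (tiltMass p (t n)) - a n * (α n - t n)) -
        (a n * (α n - t n) - (i : ℕ) * growthRatio p a n ^ 2)) * (tiltMass p (α n) / J n))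
  have hΦt := h.tail.tiltMass_pos (t n)
  have hΦα := h.tail.tiltMass_pos (α n)
  have e : Real.exp (-((y i - a n) ^ 2 / (2 * b n))) * Real.exp (α n * y i) =
      Real.exp (t n * y i) * (Real.exp (-((((i : ℕ) : ℝ) + 1 / 2) * growthRatio p a n ^ 2)) *
      (Real.exp ((α n - t n) * y i -
        ((y i - a n) ^ 2 / (2 * b n) - growthRatio p a n ^ 2 / 2) -
        (Real.log (tiltMass p (α n)) - Real.log (tiltMass p (t n)) - a n * (α n - t n)) -
        (a n * (α n - t n) - (i : ℕ) * growthRatio p a n ^ 2)) *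
        (Real.exp (Real.log (tiltMass p (α n))) * Real.exp (-Real.log (tiltMass p (t n)))))) := by
    rw [← Real.exp_add, ← Real.exp_add, ← Real.exp_add, ← Real.exp_add, ← Real.exp_add]
    congr 1
    ring
  rw [Real.exp_neg (Real.log _), Real.exp_log hΦt, Real.exp_log hΦα] at e
  rw [← mul_assoc, e]
  generalize J n = j
  field_simp

end RemainingMean

end IsFastSequence

/-! ### Comparison of the joint density with the two products -/

theorem sum_fin_add_half (k : ℕ) : ∑ i : Fin k, (((i : ℕ) : ℝ) + 1 / 2) = (k : ℝ) ^ 2 / 2 := by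
  rw [Fin.sum_univ_eq_sum_range (fun i => (i : ℝ) + 1 / 2)]
  induction k with
  | zero => simp
  | succ k ih => rw [Finset.sum_range_succ, ih]; push_cast; ring

end

theorem mainTheorem5 (g q : ℝ → ℝ) (hgq : StandingAssumptions g q)
    (a : ℕ → ℝ) (ha : Tendsto a atTop atTop) (hfast : FastGrowth (expDensity g q) a) (k : ℕ) :
    (∀ y : Fin k → ℝ,
      Asymptotics.IsEquivalent atTop
        (fun n : ℕ => condDensity (expDensity g q) n k (n * a n) y)
        (fun n : ℕ => ∏ i : Fin k, approxDensity (expDensity g q) (a n) n y i (y i))) ∧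
    (2 ≤ k → ∀ y : Fin k → ℝ, (∀ i, 0 ≤ y i) →
      ¬ Asymptotics.IsEquivalent atTop
        (fun n : ℕ => condDensity (expDensity g q) n k (n * a n) y)
        (fun n : ℕ => ∏ i : Fin k,
          condDensity (expDensity g q) n 1 (n * a n) (fun _ => y i))) := by
  obtain ⟨K, h⟩ := hgq.exists_hasStableTilts
  obtain ⟨c₁, c₂, hc, hb⟩ := hfast.exists_bounds
  have f : IsFastSequence (expDensity g q) a c₁ c₂ := ⟨ha, hc, hb⟩
  set p := expDensity g q with hp
  refine ⟨fun y => ?_, fun hk y hy heq => ?_⟩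
  · obtain ⟨ρ, hρ, hρe⟩ := f.exists_condDensity_eq h y
    choose ρ' hρ' hρe' using fun i => f.exists_approxDensity_eq y i h
    have hprod : Tendsto (fun n => ∏ i, ρ' i n) atTop (𝓝 1) := by
      have := tendsto_finsetProd Finset.univ fun i _ => hρ' i
      simpa using this
    rw [Asymptotics.isEquivalent_iff_exists_eq_mul]
    refine ⟨fun n => ρ n / ∏ i, ρ' i n, ?_, ?_⟩
    · have := hρ.div hprod one_ne_zero
      rwa [div_one] at this
    filter_upwards [hρe, eventually_all.2 hρe', hprod.eventually (lt_mem_nhds one_half_lt_one)]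
      with n h1 h2 h3
    have hne : ∏ i, ρ' i n ≠ 0 := by linarith
    have hexp : ∏ i : Fin k, Real.exp (-((((i : ℕ) : ℝ) + 1 / 2) * growthRatio p a n ^ 2)) =
        Real.exp (-((k : ℝ) ^ 2 * growthRatio p a n ^ 2 / 2)) := by
      rw [← Real.exp_sum, Finset.sum_neg_distrib, ← Finset.sum_mul, sum_fin_add_half]
      congr 2
      ring
    simp only [Pi.mul_apply]
    rw [h1, Finset.prod_congr rfl fun i _ => h2 i,
      Finset.prod_mul_distrib (g := fun i => ρ' i n), Finset.prod_mul_distrib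
        (g := fun i : Fin k => Real.exp (-((((i : ℕ) : ℝ) + 1 / 2) * growthRatio p a n ^ 2))), hexp]
    generalize (∏ i, ρ' i n) = j at hne ⊢
    field_simp
  · obtain ⟨ρ, hρ, hρe⟩ := f.exists_condDensity_eq h y
    choose ρ' hρ' hρe' using fun i => f.exists_condDensity_eq h (k := 1) fun _ => y i
    have hprod : Tendsto (fun n => ∏ i, ρ' i n) atTop (𝓝 1) := by
      have := tendsto_finsetProd Finset.univ fun i _ => hρ' i
      simpa using this
    obtain ⟨φ, hφ, hφe⟩ := (Asymptotics.isEquivalent_iff_exists_eq_mul).1 heq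
    have hpos : ∀ i, 0 < p (y i) := fun i => by
      rw [hp, expDensity, if_pos (hy i)]; exact Real.exp_pos _
    -- the ratio of the two sides is `exp (-(k² - k) r² / 2) (1 + o(1))`
    have hlim : Tendsto (fun n => φ n * (∏ i, ρ' i n) / ρ n) atTop (𝓝 1) := by
      have := (hφ.mul hprod).div hρ one_ne_zero
      rwa [mul_one, div_one] at this
    have hk2 : (0 : ℝ) < (k : ℝ) ^ 2 - k := by
      have : (2 : ℝ) ≤ k := by exact_mod_cast hk
      nlinarith
    have hlt : Real.exp (-(((k : ℝ) ^ 2 - k) * c₁ ^ 2 / 2)) < 1 := by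
      rw [Real.exp_lt_one_iff]
      have : 0 < ((k : ℝ) ^ 2 - k) * c₁ ^ 2 / 2 := by positivity
      linarith
    refine absurd (le_of_tendsto hlim ?_) (not_le.2 hlt)
    filter_upwards [hρe, eventually_all.2 hρe', hφe, hρ.eventually (lt_mem_nhds one_half_lt_one),
      hb] with n h1 h2 h3 h4 h5
    have hρ0 : 0 < ρ n := by linarith
    set c := ∏ i, p (y i) * (Real.exp (tiltParam p (a n) * y i) / tiltMass p (tiltParam p (a n)))
      with hcdef
    have hc0 : 0 < c := Finset.prod_pos fun i _ =>
      mul_pos (hpos i) (div_pos (Real.exp_pos _) (h.tail.tiltMass_pos _))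
    have hmarg : ∏ i : Fin k, condDensity p n 1 (n * a n) (fun _ => y i) =
        c * Real.exp (-((k : ℝ) * growthRatio p a n ^ 2 / 2)) * ∏ i, ρ' i n := by
      rw [Finset.prod_congr rfl fun i _ => h2 i, Finset.prod_mul_distrib, Finset.prod_mul_distrib]
      simp only [Finset.univ_unique, Finset.card_singleton, pow_one, Finset.prod_const,
        Finset.card_univ, Fintype.card_fin]
      rw [← Real.exp_nat_mul, ← hcdef]
      congr 3
      push_cast
      ring
    simp only [Pi.mul_apply] at h3
    rw [h1, hmarg] at h3
    have hsplit : Real.exp (-((k : ℝ) ^ 2 * growthRatio p a n ^ 2 / 2)) =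
        Real.exp (-(((k : ℝ) ^ 2 - k) * growthRatio p a n ^ 2 / 2)) *
          Real.exp (-((k : ℝ) * growthRatio p a n ^ 2 / 2)) := by
      rw [← Real.exp_add]; congr 1; ring
    rw [hsplit] at h3
    have hE := Real.exp_pos (-((k : ℝ) * growthRatio p a n ^ 2 / 2))
    have key : φ n * (∏ i, ρ' i n) =
        Real.exp (-(((k : ℝ) ^ 2 - k) * growthRatio p a n ^ 2 / 2)) * ρ n := by
      refine mul_left_cancel₀ (mul_pos hc0 hE).ne' ?_
      linarith
    rw [key, mul_div_cancel_right₀ _ hρ0.ne']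
    refine Real.exp_le_exp.2 ?_
    have : c₁ ^ 2 ≤ growthRatio p a n ^ 2 := pow_le_pow_left₀ hc.le h5.1 2
    have := mul_le_mul_of_nonneg_left this hk2.le
    linarith
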